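/- **Setting.** Let $\{p(x\mid\theta):\theta\in\Theta\}$, $\Theta\subseteq\mathbb R^d$, be probability densities with respect to a measure $\mu$ on $\mathcal X$, let $\pi$ be a prior density, and let $x_1,x_2,\dots$ be i.i.d. with density $p(\cdot\mid\theta_0)$. For $\mathbf x=(x_1,\dots,x_n)$ write $\ell(\theta)=\log p(\mathbf x\mid\theta)=\log\prod_{m}p(x_m\mid\theta)$, with partial derivatives $\ell_i,\ell_{ij},\ell_{ijl}$, and let $I(\theta)$ be the Fisher information matrix of one observation, $\kappa_{ij}(\theta)=\mathbb E_\theta\ell_{ij}(\theta)$, $\kappa_{ijl}(\theta)=\mathbb E_\theta\ell_{ijl}(\theta)$, $K(\theta)=\{-\kappa_{ij}(\theta)\}$. Let $A(\theta)=[A^{(1)}\mid\cdots\mid A^{(d)}]$ be the $d\times d^2$ Cox–Snell matrix, where $A^{(l)}$ has the entries $\partial\kappa_{ij}/\partial\theta_l-\tfrac12\kappa_{ijl}$. Put $a(\theta)=\nabla\log\pi(\theta)-\tfrac12\nabla\log|I(\theta)|$. Let $\hat\theta_{\rm MLE}$ and $\hat\theta_{\rm MML}$ be measurable functions of $\mathbf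 x$ that, with probability tending to one, maximise $p(\mathbf x\mid\theta)$ and minimise the Wallace–Freeman codelength $-\log p(\mathbf x\mid\theta)-\log\pi(\theta)+\tfrac12\log|I(\theta)|$ over $\Theta$, respectively (the codelength is $+\infty$ where $\pi$ or the likelihood vanishes). Bias means $\mathbb E_{\theta_0}\hat\theta-\theta_0$; all limits are for $n\to\infty$. **Assumptions.** Let $U\subseteq\Theta$ be an open neighbourhood of $\theta_0$ such that: (C1) for $\mu$-almost every $x$, $p(x\mid\cdot)>0$ and $\log p(x\mid\cdot)$ is three times continuously differentiable on $U$; the second derivatives of $\log p(x\mid\cdot)$ at $\theta_0$ have finite second moments under $\theta_0$; the third derivatives are bounded on $U$, for $\mu$-almost every $x$, by one function $B(x)$ with $\mathbb E_{\theta_0}|B|<\infty$; and for $g=1$, $g=\partial_i\log p$ and $g=\partial_i\partial_j\log p$ the function $\theta\mapsto\mathbb E_\theta\, g(x,\theta)=\int g(x,\theta)p(x\mid\theta)\,d\mu(x)$ is finite and differentiable on $U$, with first derivatives obtained by differentiating under the integral sign; (C2) $-\nabla^2\ell(\hat\theta_{\rm MLE})=K(\theta_0)+O_p(n^{1/2})$,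 and $K(\theta_0)$ is nonsingular for $n\ge1$; (C3) $\hat\theta_{\rm MLE}-\theta_0=O_p(n^{-1/2})$; (C4) on $U$, $\pi>0$, $\log\pi$ and $\log|I|$ are differentiable, and $a$ is continuously differentiable; (C5) with probability tending to one $\hat\theta_{\rm MML}$ lies in a fixed compact subset of $U$; the Taylor remainder $R_n=\nabla\ell(\hat\theta_{\rm MML})-\nabla\ell(\hat\theta_{\rm MLE})-\nabla^2\ell(\hat\theta_{\rm MLE})(\hat\theta_{\rm MML}-\hat\theta_{\rm MLE})$ satisfies $K(\theta_0)^{-1}R_n=o_p(n^{-1})$; and the variables $n\{\hat\theta_{\rm MML}-\hat\theta_{\rm MLE}-K(\theta_0)^{-1}a(\theta_0)\}$ are uniformly integrable from some $n$ on. **Conclusion.** Then $K(\theta_0)=nI(\theta_0)$ and $$\hat\theta_{\rm MML}-\hat\theta_{\rm MLE}=K(\theta_0)^{-1}a(\theta_0)+o_p(n^{-1})=\tfrac1n I(\theta_0)^{-1}a(\theta_0)+o_p(n^{-1}).$$ If $\hat\theta_{\rm MLE}$ is integrable for all large $n$, then so is $\hat\theta_{\rm MML}$, and $$\operatorname{Bias}(\hat\theta_{\rm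 MML})=\operatorname{Bias}(\hat\theta_{\rm MLE})+K(\theta_0)^{-1}a(\theta_0)+o(n^{-1}).$$ If moreover the variables $n\{\hat\theta_{\rm MLE}-\theta_0-K(\theta_0)^{-1}\nabla\ell(\theta_0)\}$ are uniformly integrable from some $n$ on (which implies the integrability of $\hat\theta_{\rm MLE}$ for all large $n$), then $$\operatorname{Bias}(\hat\theta_{\rm MLE})=K(\theta_0)^{-1}A(\theta_0)\operatorname{vec}\bigl(K(\theta_0)^{-1}\bigr)+o(n^{-1}),$$ $$\operatorname{Bias}(\hat\theta_{\rm MML})=K(\theta_0)^{-1}A(\theta_0)\operatorname{vec}\bigl(K(\theta_0)^{-1}\bigr)+K(\theta_0)^{-1}a(\theta_0)+o(n^{-1}).$$ -/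

import Mathlib

open MeasureTheory ProbabilityTheory Filter Topology Asymptotics

noncomputable section

/-- The parameter space `ℝ^d` with its Euclidean norm. -/
abbrev Param (d : ℕ) : Type := EuclideanSpace ℝ (Fin d)

/-- The partial derivative `∂f/∂θ_i`. -/
def pd {d : ℕ} (i : Fin d) (f : Param d → ℝ) (θ : Param d) : ℝ :=
  fderiv ℝ f θ (EuclideanSpace.single i 1)

/-- The Hessian matrix of `f`. -/
def hessian {d : ℕ} (f : Param d → ℝ) (θ : Param d) : Matrix (Fin d) (Fin d) ℝ :=
  Matrix.of fun i j => pd i (pd j f) θ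

/-- A matrix acting on a vector of `ℝ^d`. -/
def matVec {d : ℕ} (B : Matrix (Fin d) (Fin d) ℝ) (v : Param d) : Param d :=
  WithLp.toLp 2 (B.mulVec v.ofLp)

/-- A `d`-parameter statistical model for one observation: probability densities
`p(x | θ)`, `θ ∈ Θ ⊆ ℝ^d`, with respect to a dominating measure. -/
structure ParamModel (𝒳 : Type*) [MeasurableSpace 𝒳] (d : ℕ) where
  /-- the dominating measure -/
  base : Measure 𝒳
  /-- the parameter set `Θ` -/
  Θ : Set (Param d)
  /-- the density `p(x | θ)` -/
  p : 𝒳 → Param d → ℝ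
  measurable_p : ∀ θ ∈ Θ, Measurable fun x => p x θ
  p_nonneg : ∀ θ ∈ Θ, ∀ x, 0 ≤ p x θ
  lintegral_p : ∀ θ ∈ Θ, ∫⁻ x, ENNReal.ofReal (p x θ) ∂base = 1

namespace ParamModel

variable {𝒳 : Type*} [MeasurableSpace 𝒳] {d : ℕ}

/-- The law of one observation under the parameter `θ`. -/
def law (M : ParamModel 𝒳 d) (θ : Param d) : Measure 𝒳 :=
  M.base.withDensity fun x => ENNReal.ofReal (M.p x θ)

/-- The log-likelihood of one observation. -/
def logp (M : ParamModel 𝒳 d) (x : 𝒳) (θ : Param d) : ℝ := Real.log (M.p x θ)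

/-- The likelihood `p(𝐱 | θ)` of a sample of `n` independent observations. -/
def lik (M : ParamModel 𝒳 d) (n : ℕ) (x : Fin n → 𝒳) (θ : Param d) : ℝ :=
  ∏ i, M.p (x i) θ

/-- The full-sample log-likelihood `ℓ(θ) = log p(𝐱 | θ)`. -/
def logLik (M : ParamModel 𝒳 d) (n : ℕ) (x : Fin n → 𝒳) (θ : Param d) : ℝ :=
  Real.log (M.lik n x θ)

/-- The Fisher information matrix `I(θ)` of one observation. -/
def fisher (M : ParamModel 𝒳 d) (θ : Param d) : Matrix (Fin d) (Fin d) ℝ :=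
  Matrix.of fun i j => ∫ x, pd i (M.logp x) θ * pd j (M.logp x) θ ∂(M.law θ)

/-- The joint law of a sample of `n` independent observations under `θ`. -/
def lawN (M : ParamModel 𝒳 d) (n : ℕ) (θ : Param d) : Measure (Fin n → 𝒳) :=
  Measure.pi fun _ => M.law θ

/-- `κ_{ij}(θ) = 𝔼_θ ℓ_{ij}(θ)`, for samples of size `n`. -/
def kappa2 (M : ParamModel 𝒳 d) (n : ℕ) (i j : Fin d) (θ : Param d) : ℝ :=
  ∫ x, pd i (pd j (M.logLik n x)) θ ∂(M.lawN n θ)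

/-- `κ_{ijl}(θ) = 𝔼_θ ℓ_{ijl}(θ)`, for samples of size `n`. -/
def kappa3 (M : ParamModel 𝒳 d) (n : ℕ) (i j l : Fin d) (θ : Param d) : ℝ :=
  ∫ x, pd i (pd j (pd l (M.logLik n x))) θ ∂(M.lawN n θ)

/-- The matrix `K(θ) = {-κ_{ij}(θ)}`. -/
def K (M : ParamModel 𝒳 d) (n : ℕ) (θ : Param d) : Matrix (Fin d) (Fin d) ℝ :=
  Matrix.of fun i j => -M.kappa2 n i j θ

/-- The `d × d²` Cox–Snell cumulant matrix `A = [A⁽¹⁾ | ⋯ | A⁽ᵈ⁾]`, where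
`A⁽ˡ⁾` has the entries `∂κ_{ij}/∂θ_l - κ_{ijl}/2`. The column `j` of the block
`A⁽ˡ⁾` has the index `(l, j)`, the order in which `Matrix.vec` stacks columns. -/
def coxSnell (M : ParamModel 𝒳 d) (n : ℕ) (θ : Param d) :
    Matrix (Fin d) (Fin d × Fin d) ℝ :=
  Matrix.of fun i lj =>
    pd lj.1 (M.kappa2 n i lj.2) θ - (1 / 2) * M.kappa3 n i lj.2 lj.1 θ

/-- The first-order bias term `K⁻¹ A vec(K⁻¹)`. -/
def coxSnellBias (M : ParamModel 𝒳 d) (n : ℕ) (θ : Param d) : Param d :=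
  matVec (M.K n θ)⁻¹ (WithLp.toLp 2 ((M.coxSnell n θ).mulVec (M.K n θ)⁻¹.vec))

/-- The Wallace–Freeman codelength `-log p(𝐱|θ) - log π(θ) + ½ log |I(θ)|`, up to
additive terms that do not depend on `θ`; infinite where the prior density or the
likelihood vanishes. -/
def codelength (M : ParamModel 𝒳 d) (prior : Param d → ℝ) (n : ℕ) (x : Fin n → 𝒳)
    (θ : Param d) : EReal :=
  open Classical in
  if 0 < prior θ ∧ 0 < M.lik n x θ then
    ((-M.logLik n x θ - Real.log (prior θ) + (1 / 2) * Real.log (M.fisher θ).det : ℝ) : EReal)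
  else ⊤

/-- `θ` is a maximum likelihood estimate for the data `x`. -/
def IsMLE (M : ParamModel 𝒳 d) (n : ℕ) (x : Fin n → 𝒳) (θ : Param d) : Prop :=
  θ ∈ M.Θ ∧ IsMaxOn (M.lik n x) M.Θ θ

/-- `θ` is a Wallace–Freeman estimate for the data `x`. -/
def IsMML (M : ParamModel 𝒳 d) (prior : Param d → ℝ) (n : ℕ) (x : Fin n → 𝒳)
    (θ : Param d) : Prop :=
  θ ∈ M.Θ ∧ IsMinOn (M.codelength prior n x) M.Θ θ

/-- The vector `a = ∇ log π - ½ ∇ log |I|`. -/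
def a (M : ParamModel 𝒳 d) (prior : Param d → ℝ) (θ : Param d) : Param d :=
  gradient (fun t => Real.log (prior t)) θ
    - (1 / 2 : ℝ) • gradient (fun t => Real.log (M.fisher t).det) θ

/-- Differentiation and expectation may be interchanged at `θ` for the statistic
`g(x, θ)`: in `∂_l 𝔼_θ g(·, θ) = ∂_l ∫ g p dμ` the derivative may be taken under the
integral sign. -/
structure Interchange (M : ParamModel 𝒳 d) (g : 𝒳 → Param d → ℝ) (θ : Param d) :
    Prop where
  integrable : Integrable (fun x => g x θ * M.p x θ) M.base
  integrable_pd : ∀ l, Integrable (fun x => pd l (fun t => g x t * M.p x t) θ) M.base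
  differentiableAt : DifferentiableAt ℝ (fun t => ∫ x, g x t * M.p x t ∂M.base) θ
  pd_integral : ∀ l, pd l (fun t => ∫ x, g x t * M.p x t ∂M.base) θ
    = ∫ x, pd l (fun t => g x t * M.p x t) θ ∂M.base

/-- Regularity of the model on an open neighbourhood `U ⊆ Θ` of `θ₀`: three continuous
derivatives of the log-likelihood, finite second moments of its second derivatives at
`θ₀`, an integrable bound for the third ones, and interchange of differentiation and
expectation up to the third order. -/
structure Regular (M : ParamModel 𝒳 d) (θ₀ : Param d) (U : Set (Param d)) : Prop where
  isOpen : IsOpen U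
  mem : θ₀ ∈ U
  subset : U ⊆ M.Θ
  pos : ∀ᵐ x ∂M.base, ∀ θ ∈ U, 0 < M.p x θ
  contDiffOn : ∀ᵐ x ∂M.base, ContDiffOn ℝ 3 (M.logp x) U
  second_moment : ∀ i j, Integrable (fun x => (pd i (pd j (M.logp x)) θ₀) ^ 2) (M.law θ₀)
  third_bound : ∃ B : 𝒳 → ℝ, Integrable B (M.law θ₀) ∧
    ∀ᵐ x ∂M.base, ∀ θ ∈ U, ∀ i j l, |pd i (pd j (pd l (M.logp x))) θ| ≤ B x
  interchange_one : ∀ θ ∈ U, M.Interchange (fun _ _ => 1) θ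
  interchange_two : ∀ θ ∈ U, ∀ i, M.Interchange (fun x => pd i (M.logp x)) θ
  interchange_three : ∀ θ ∈ U, ∀ i j, M.Interchange (fun x => pd i (pd j (M.logp x))) θ

/-- Regularity of the penalty on `U`: the prior density is positive, `log π` and
`log |I|` are differentiable, and `a` is continuously differentiable. -/
structure RegularPenalty (M : ParamModel 𝒳 d) (prior : Param d → ℝ) (U : Set (Param d)) :
    Prop where
  prior_pos : ∀ θ ∈ U, 0 < prior θ
  log_prior : DifferentiableOn ℝ (fun θ => Real.log (prior θ)) U
  log_det : DifferentiableOn ℝ (fun θ => Real.log (M.fisher θ).det) U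
  contDiffOn_a : ContDiffOn ℝ 1 (M.a prior) U

/-- The remainder in the first-order Taylor expansion of `∇ℓ(θ')` about `θ`. -/
def scoreRemainder (M : ParamModel 𝒳 d) (n : ℕ) (x : Fin n → 𝒳) (θ θ' : Param d) : Param d :=
  gradient (M.logLik n x) θ' - gradient (M.logLik n x) θ
    - matVec (hessian (M.logLik n x) θ) (θ' - θ)

end ParamModel

variable {Ω : Type*} [MeasurableSpace Ω] {F : Type*} [NormedAddCommGroup F]

/-- `E n` holds with probability tending to one. -/
def WithProbTendingToOne (P : Measure Ω) (E : ℕ → Ω → Prop) : Prop :=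
  Tendsto (fun n => P {ω | ¬ E n ω}) atTop (𝓝 0)

/-- `Y n = O_p(r n)`. -/
def IsBigOp (P : Measure Ω) (Y : ℕ → Ω → F) (r : ℕ → ℝ) : Prop :=
  ∀ ε : ENNReal, 0 < ε → ∃ C : ℝ, ∀ᶠ n in atTop, P {ω | C * r n < ‖Y n ω‖} ≤ ε

/-- `Y n = o_p(r n)`. -/
def IsLittleOp (P : Measure Ω) (Y : ℕ → Ω → F) (r : ℕ → ℝ) : Prop :=
  ∀ ε : ℝ, 0 < ε → Tendsto (fun n => P {ω | ε * r n < ‖Y n ω‖}) atTop (𝓝 0)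

/-- The sequence `Y n` is uniformly integrable from some index on. -/
def EventuallyUI (P : Measure Ω) (Y : ℕ → Ω → F) : Prop :=
  ∃ N : ℕ, UniformIntegrable (fun n => Y (n + N)) 1 P

end

/-! Both bias formulas come from stochastic expansions whose error, after multiplication by `n`,
tends to zero in probability. Uniform integrability and Vitali's theorem
(`EventuallyUI.tendsto_integral`) turn this into convergence of means.

Difference of the estimators. On `U` the score vanishes at the MLE and equals `-a` at the
Wallace–Freeman estimate (`IsMML.gradient_eq`). Expand the score about the MLE and multiply by `G =
I(θ₀)⁻¹`. With `D = n(mml - mle)` this gives `D = G a(mml) + R - G B D`, where `R` is the scaled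
Taylor remainder and `B = -H/n - I(θ₀)` is the error of the observed information, both `o_p(1)`. As
`a` is bounded on the compact set and `G B` is small, `D = O_p(1)`. Hence the Wallace–Freeman
estimator is consistent, `a(mml)` may be replaced by `a(θ₀)`, and `D = G a(θ₀) + o_p(1)`
(`isLittleOp_mml_sub_mle`).

Bias of the MLE. Let `S` be the score at `θ₀` and `V = √n (mle - θ₀)`. A second-order expansion of
the score at `θ₀` shows that `n I(θ₀)(mle - θ₀) - S` is, up to `o_p(1)`, a quadratic expression in
`V`, the normalised centred Hessians and the averaged third derivatives. It is therefore `O_p(1)`,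
so `V` agrees to first order with the normalised sum of `G ∇log p`. Substituting this, and replacing
the averaged third derivatives by their means, yields `quadTerm` (`isLittleOp_mle_sub_quadTerm`).
The Taylor remainder is negligible because the oscillation of the third derivatives over a small
ball has small mean (`exists_third_oscillation_le`).

The quadratic term consists of products of normalised i.i.d. sums of centred square-integrable
variables. Such products are uniformly integrable, and their mean is the one-observation covariance
for every `n > 0`. The linear term has mean zero, so only the mean of `G quadTerm` remains. By
`∂κ_ij/∂θ_l = κ_ijl + n E[∂_ij log p · ∂_l log p]` it is `n` times the Cox–Snell term
(`coxSnell_eq`, `smul_coxSnellBias`). -/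

noncomputable section

/-! ### Partial derivatives, Taylor bounds and gradients -/

section Calculus

variable {d : ℕ} {U : Set (Param d)} {f g : Param d → ℝ}

lemma pd_congr_of_eventuallyEq {θ : Param d} (h : f =ᶠ[𝓝 θ] g) (i : Fin d) :
    pd i f θ = pd i g θ := by
  unfold pd; rw [h.fderiv_eq]

lemma pd_eqOn (hU : IsOpen U) (h : Set.EqOn f g U) (i : Fin d) :
    Set.EqOn (pd i f) (pd i g) U := fun _ hθ =>
  pd_congr_of_eventuallyEq (h.eventuallyEq_of_mem (hU.mem_nhds hθ)) i

lemma contDiffOn_pd (hU : IsOpen U) {m n : WithTop ℕ∞} (hf : ContDiffOn ℝ n f U)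
    (hmn : m + 1 ≤ n) (i : Fin d) : ContDiffOn ℝ m (pd i f) U :=
  (hf.fderiv_of_isOpen hU hmn).clm_apply contDiffOn_const

lemma differentiableAt_of_contDiffOn (hU : IsOpen U) {n : WithTop ℕ∞}
    (hf : ContDiffOn ℝ n f U) (hn : n ≠ 0) {θ : Param d} (hθ : θ ∈ U) :
    DifferentiableAt ℝ f θ :=
  (hf.differentiableOn hn).differentiableAt (hU.mem_nhds hθ)

lemma pd_sum {ι : Type*} (s : Finset ι) {f : ι → Param d → ℝ} {θ : Param d}
    (h : ∀ m ∈ s, DifferentiableAt ℝ (f m) θ) (i : Fin d) :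
    pd i (fun t => ∑ m ∈ s, f m t) θ = ∑ m ∈ s, pd i (f m) θ := by
  unfold pd
  rw [fderiv_fun_sum h]
  simp

lemma pd_mul {θ : Param d} (hf : DifferentiableAt ℝ f θ) (hg : DifferentiableAt ℝ g θ)
    (i : Fin d) :
    pd i (fun t => f t * g t) θ = f θ * pd i g θ + g θ * pd i f θ := by
  unfold pd
  rw [fderiv_fun_mul hf hg]
  simp

lemma pd_sub {θ : Param d} (hf : DifferentiableAt ℝ f θ) (hg : DifferentiableAt ℝ g θ)
    (i : Fin d) :
    pd i (fun t => f t - g t) θ = pd i f θ - pd i g θ := by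
  unfold pd
  rw [fderiv_fun_sub hf hg]
  simp

lemma pd_const_mul {θ : Param d} (hf : DifferentiableAt ℝ f θ) (c : ℝ)
    (i : Fin d) :
    pd i (fun t => c * f t) θ = c * pd i f θ := by
  unfold pd
  rw [fderiv_const_mul hf]
  simp

lemma pd_const (c : ℝ) (i : Fin d) (θ : Param d) : pd i (fun _ => c) θ = 0 := by
  simp [pd]

lemma pd_exp {θ : Param d} (hf : DifferentiableAt ℝ f θ) (i : Fin d) :
    pd i (fun t => Real.exp (f t)) θ = Real.exp (f θ) * pd i f θ := by
  unfold pd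
  rw [fderiv_exp hf]
  simp

lemma pd_comm (hU : IsOpen U) (hf : ContDiffOn ℝ 2 f U) {θ : Param d} (hθ : θ ∈ U)
    (i j : Fin d) : pd i (pd j f) θ = pd j (pd i f) θ := by
  have hfa : ContDiffAt ℝ 2 f θ := hf.contDiffAt (hU.mem_nhds hθ)
  have hs : IsSymmSndFDerivAt ℝ f θ := hfa.isSymmSndFDerivAt (by simp)
  have hd : DifferentiableAt ℝ (fderiv ℝ f) θ :=
    (hfa.fderiv_right (m := 1) (by norm_num)).differentiableAt (by norm_num)
  have key : ∀ i j : Fin d, pd i (pd j f) θ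
      = fderiv ℝ (fderiv ℝ f) θ (EuclideanSpace.single i 1) (EuclideanSpace.single j 1) := by
    intro i j
    unfold pd
    rw [fderiv_clm_apply hd (differentiableAt_const _)]
    simp
  rw [key, key]
  exact hs _ _

/-- Two uses of the symmetry of second derivatives carry the outermost derivative to the innermost
place. The inner exchange is an identity on all of `U`, so it may be differentiated once more. -/
lemma pd_pd_comm_left (hU : IsOpen U) (hf : ContDiffOn ℝ 3 f U) {θ : Param d} (hθ : θ ∈ U)
    (i j l : Fin d) : pd l (pd i (pd j f)) θ = pd i (pd j (pd l f)) θ := by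
  rw [pd_comm hU (contDiffOn_pd hU hf (by norm_num) j) hθ l i]
  exact pd_eqOn hU (fun t ht => pd_comm hU (hf.of_le (by norm_num)) ht l j) i hθ

lemma coord_sum (v : Param d) : v = ∑ i, v i • EuclideanSpace.single i (1 : ℝ) := by
  ext k
  simp [Finset.sum_apply, Pi.single_apply]

lemma abs_coord_le (v : Param d) (i : Fin d) : |v i| ≤ ‖v‖ := by
  simpa using PiLp.norm_apply_le v i

lemma fderiv_apply_eq_sum_pd (f : Param d → ℝ) (θ v : Param d) :
    fderiv ℝ f θ v = ∑ i, v i * pd i f θ := by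
  conv_lhs => rw [coord_sum v]
  simp [pd]

lemma norm_fderiv_le_of_abs_pd_le {θ : Param d} {s : ℝ}
    (h : ∀ i, |pd i f θ| ≤ s) : ‖fderiv ℝ f θ‖ ≤ d * s := by
  -- The sign of `s` is not assumed: for `d = 0` the product vanishes, otherwise `s` dominates an
  -- absolute value.
  have hs : 0 ≤ (d : ℝ) * s := by
    rcases Nat.eq_zero_or_pos d with rfl | hd
    · simp
    · exact mul_nonneg d.cast_nonneg ((abs_nonneg _).trans (h ⟨0, hd⟩))
  refine ContinuousLinearMap.opNorm_le_bound _ hs fun v => ?_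
  rw [fderiv_apply_eq_sum_pd]
  calc ‖∑ i, v i * pd i f θ‖ ≤ ∑ i : Fin d, ‖v‖ * s := by
        refine norm_sum_le_of_le _ fun i _ => ?_
        rw [norm_mul]
        exact mul_le_mul (abs_coord_le v i) (h i) (abs_nonneg _) (norm_nonneg _)
    _ = d * s * ‖v‖ := by simp; ring

lemma abs_sub_le_of_abs_pd_le {θ₀ θ : Param d} {r s : ℝ} (hθ : θ ∈ Metric.ball θ₀ r)
    (hf : ∀ t ∈ Metric.ball θ₀ r, DifferentiableAt ℝ f t)
    (h : ∀ t ∈ Metric.ball θ₀ r, ∀ i, |pd i f t| ≤ s) :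
    |f θ - f θ₀| ≤ d * s * ‖θ - θ₀‖ :=
  (convex_ball θ₀ r).norm_image_sub_le_of_norm_fderiv_le hf
    (fun t ht => norm_fderiv_le_of_abs_pd_le (h t ht))
    (Metric.mem_ball_self (Metric.pos_of_mem_ball hθ)) hθ

lemma coord_hasFDerivAt (θ₀ θ : Param d) (j : Fin d) :
    HasFDerivAt (fun t : Param d => t j - θ₀ j) (EuclideanSpace.proj j : Param d →L[ℝ] ℝ) θ :=
  (EuclideanSpace.proj j : Param d →L[ℝ] ℝ).hasFDerivAt.sub_const _

lemma pd_coord (θ₀ θ : Param d) (i j : Fin d) :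
    pd i (fun t : Param d => t j - θ₀ j) θ = if j = i then 1 else 0 := by
  unfold pd
  rw [(coord_hasFDerivAt θ₀ θ j).fderiv]
  simp

lemma differentiableAt_coord (θ₀ θ : Param d) (j : Fin d) :
    DifferentiableAt ℝ (fun t : Param d => t j - θ₀ j) θ :=
  (coord_hasFDerivAt θ₀ θ j).differentiableAt

/-- First-order Taylor expansion, with the remainder bounded by the oscillation of the
first derivatives. -/
lemma taylor_one_bound {θ₀ θ : Param d} {r s : ℝ} (hθ : θ ∈ Metric.ball θ₀ r)
    (hf : ContDiffOn ℝ 1 f (Metric.ball θ₀ r))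
    (h : ∀ t ∈ Metric.ball θ₀ r, ∀ i, |pd i f t - pd i f θ₀| ≤ s) :
    |f θ - f θ₀ - ∑ j, pd j f θ₀ * (θ j - θ₀ j)| ≤ d * s * ‖θ - θ₀‖ := by
  have hfd : ∀ t ∈ Metric.ball θ₀ r, DifferentiableAt ℝ f t := fun t ht =>
    differentiableAt_of_contDiffOn Metric.isOpen_ball hf (by norm_num) ht
  have hl : ∀ t : Param d,
      DifferentiableAt ℝ (fun t : Param d => ∑ j, pd j f θ₀ * (t j - θ₀ j)) t := fun t =>
    DifferentiableAt.fun_sum fun j _ => (differentiableAt_coord θ₀ t j).const_mul _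
  have := abs_sub_le_of_abs_pd_le (f := fun t => f t - ∑ j, pd j f θ₀ * (t j - θ₀ j))
    (s := s) hθ (fun t ht => (hfd t ht).sub (hl t)) (fun t ht i => by
      rw [pd_sub (hfd t ht) (hl t), pd_sum _ (fun j _ => (differentiableAt_coord θ₀ t j).const_mul _)]
      simp_rw [pd_const_mul (differentiableAt_coord θ₀ t _), pd_coord]
      simpa using h t ht i)
  convert this using 2
  simp
  ring

/-- Second-order Taylor expansion, with the remainder bounded by the oscillation of the
second derivatives. -/
lemma taylor_two_bound {θ₀ θ : Param d} {r s : ℝ} (hθ : θ ∈ Metric.ball θ₀ r)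
    (hf : ContDiffOn ℝ 2 f (Metric.ball θ₀ r))
    (h : ∀ t ∈ Metric.ball θ₀ r, ∀ i j, |pd i (pd j f) t - pd i (pd j f) θ₀| ≤ s) :
    |f θ - f θ₀ - ∑ j, pd j f θ₀ * (θ j - θ₀ j)
      - (1 / 2) * ∑ j, ∑ l, pd j (pd l f) θ₀ * (θ j - θ₀ j) * (θ l - θ₀ l)|
      ≤ d * (d * s * ‖θ - θ₀‖) * ‖θ - θ₀‖ := by
  have hr : 0 < ‖θ - θ₀‖ ∨ θ = θ₀ := by
    rcases eq_or_ne θ θ₀ with h | h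
    · exact Or.inr h
    · exact Or.inl (norm_pos_iff.2 (sub_ne_zero.2 h))
  rcases hr with hr | rfl
  swap
  · simp
  have hrr : ‖θ - θ₀‖ < r := by simpa [dist_eq_norm] using hθ
  -- The mean value inequality is applied to `f - q`, with `q` the quadratic Taylor terms, on a ball
  -- of radius `r'` slightly larger than `‖θ - θ₀‖`, so that the open ball contains `θ`. There
  -- `taylor_one_bound` bounds each partial derivative by `d * s * r'`. At the end `r'` decreases to
  -- `‖θ - θ₀‖`.
  have hcl : ∀ r' ∈ Set.Ioo ‖θ - θ₀‖ r, 
    |f θ - f θ₀ - ∑ j, pd j f θ₀ * (θ j - θ₀ j)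
      - (1 / 2) * ∑ j, ∑ l, pd j (pd l f) θ₀ * (θ j - θ₀ j) * (θ l - θ₀ l)|
      ≤ d * (d * s * r') * ‖θ - θ₀‖ := by
    intro r' hr'
    have hsub : Metric.ball θ₀ r' ⊆ Metric.ball θ₀ r := Metric.ball_subset_ball hr'.2.le
    have hfd : ∀ t ∈ Metric.ball θ₀ r', DifferentiableAt ℝ f t := fun t ht =>
      differentiableAt_of_contDiffOn Metric.isOpen_ball hf (by norm_num) (hsub ht)
    set q : Param d → ℝ := fun t =>
      (∑ j, pd j f θ₀ * (t j - θ₀ j))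
        + (1 / 2) * ∑ j, ∑ l, pd j (pd l f) θ₀ * (t j - θ₀ j) * (t l - θ₀ l) with hq
    have hterm : ∀ (j l : Fin d) (t : Param d), HasFDerivAt
        (fun t : Param d => pd j (pd l f) θ₀ * (t j - θ₀ j) * (t l - θ₀ l))
        ((pd j (pd l f) θ₀ * (t j - θ₀ j)) • (EuclideanSpace.proj l : Param d →L[ℝ] ℝ)
          + (t l - θ₀ l) • (pd j (pd l f) θ₀ • (EuclideanSpace.proj j : Param d →L[ℝ] ℝ))) t :=
      fun j l t => ((coord_hasFDerivAt θ₀ t j).const_mul _).mul (coord_hasFDerivAt θ₀ t l)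
    have hqd : ∀ t : Param d, HasFDerivAt q
        ((∑ j, pd j f θ₀ • (EuclideanSpace.proj j : Param d →L[ℝ] ℝ))
          + (1 / 2 : ℝ) • ∑ j, ∑ l,
            ((pd j (pd l f) θ₀ * (t j - θ₀ j)) • (EuclideanSpace.proj l : Param d →L[ℝ] ℝ)
          + (t l - θ₀ l) • (pd j (pd l f) θ₀ • (EuclideanSpace.proj j : Param d →L[ℝ] ℝ)))) t :=
      fun t => (HasFDerivAt.fun_sum fun j _ => (coord_hasFDerivAt θ₀ t j).const_mul _).add
        ((HasFDerivAt.fun_sum fun j _ => HasFDerivAt.fun_sum fun l _ => hterm j l t).const_mul _)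
    have hsymm : ∀ j l, pd j (pd l f) θ₀ = pd l (pd j f) θ₀ := fun j l =>
      pd_comm Metric.isOpen_ball hf (Metric.mem_ball_self (hr.trans hrr)) j l
    -- The derivative of `q` is the linear Taylor polynomial of `pd i f`: symmetry of the Hessian
    -- merges the two halves coming from the quadratic form.
    have hpq : ∀ (t : Param d) i, pd i q t
        = pd i f θ₀ + ∑ j, pd j (pd i f) θ₀ * (t j - θ₀ j) := by
      intro t i
      rw [pd, (hqd t).fderiv]
      simp [Finset.sum_add_distrib]
      rw [Finset.sum_congr rfl (fun l _ => by rw [hsymm i l, mul_comm] :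
        ∀ l ∈ Finset.univ, (t l - θ₀ l) * pd i (pd l f) θ₀ = pd l (pd i f) θ₀ * (t l - θ₀ l))]
      ring
    have := abs_sub_le_of_abs_pd_le (f := fun t => f t - q t) (θ := θ) (θ₀ := θ₀) (r := r')
      (s := d * s * r') (by simpa [dist_eq_norm] using hr'.1)
      (fun t ht => (hfd t ht).sub (hqd t).differentiableAt) (fun t ht i => by
        rw [pd_sub (hfd t ht) (hqd t).differentiableAt, hpq, ← sub_sub]
        refine (taylor_one_bound (s := s) (hsub ht)
          (contDiffOn_pd Metric.isOpen_ball hf (by norm_num) i)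
          (fun t ht j => h t ht j i)).trans ?_
        have hs : 0 ≤ s := (abs_nonneg _).trans (h t (hsub ht) i i)
        have : ‖t - θ₀‖ ≤ r' := by
          have := Metric.mem_ball.1 ht
          rw [dist_eq_norm] at this
          exact this.le
        gcongr)
    convert this using 2
    simp [hq]
    ring
  have hlim : Tendsto (fun r' : ℝ => d * (d * s * r') * ‖θ - θ₀‖) (𝓝[>] ‖θ - θ₀‖)
      (𝓝 (d * (d * s * ‖θ - θ₀‖) * ‖θ - θ₀‖)) := by
    refine Tendsto.mono_left (Continuous.tendsto (by fun_prop) _) nhdsWithin_le_nhds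
  exact ge_of_tendsto hlim (by
    filter_upwards [Ioo_mem_nhdsGT hrr] with r' hr' using hcl r' hr')

lemma gradient_apply (f : Param d → ℝ) (θ : Param d) (i : Fin d) :
    gradient f θ i = pd i f θ := by
  have h : inner ℝ (gradient f θ) (EuclideanSpace.single i (1 : ℝ)) = pd i f θ := by
    rw [gradient, InnerProductSpace.toDual_symm_apply]; rfl
  rw [← h, EuclideanSpace.inner_single_right]
  simp

lemma gradient_eq_zero_of_isLocalMax {θ : Param d} (h : IsLocalMax f θ) : gradient f θ = 0 := by
  simp [gradient, h.fderiv_eq_zero]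

lemma gradient_eq_zero_of_isLocalMin {θ : Param d} (h : IsLocalMin f θ) : gradient f θ = 0 := by
  simp [gradient, h.fderiv_eq_zero]

end Calculus

/-! ### Matrices acting on the parameter space -/

section Matrices

variable {d : ℕ}

lemma matVec_apply (B : Matrix (Fin d) (Fin d) ℝ) (v : Param d) (i : Fin d) :
    matVec B v i = ∑ j, B i j * v j := rfl

lemma matVec_add (B : Matrix (Fin d) (Fin d) ℝ) (v w : Param d) :
    matVec B (v + w) = matVec B v + matVec B w := by
  ext i; simp [matVec_apply, mul_add, Finset.sum_add_distrib]

lemma matVec_sub (B : Matrix (Fin d) (Fin d) ℝ) (v w : Param d) :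
    matVec B (v - w) = matVec B v - matVec B w := by
  ext i; simp [matVec_apply, mul_sub, Finset.sum_sub_distrib]

lemma matVec_smul (B : Matrix (Fin d) (Fin d) ℝ) (c : ℝ) (v : Param d) :
    matVec B (c • v) = c • matVec B v := by
  ext i; simp [matVec_apply, Finset.mul_sum, mul_left_comm]

lemma smul_matVec (B : Matrix (Fin d) (Fin d) ℝ) (c : ℝ) (v : Param d) :
    matVec (c • B) v = c • matVec B v := by
  ext i; simp [matVec_apply, Finset.mul_sum, mul_assoc]

lemma matVec_mul (A B : Matrix (Fin d) (Fin d) ℝ) (v : Param d) :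
    matVec (A * B) v = matVec A (matVec B v) := by
  simp [matVec, Matrix.mulVec_mulVec]

lemma sub_matVec (A B : Matrix (Fin d) (Fin d) ℝ) (v : Param d) :
    matVec (A - B) v = matVec A v - matVec B v := by
  simp [matVec, Matrix.sub_mulVec]

lemma neg_matVec (B : Matrix (Fin d) (Fin d) ℝ) (v : Param d) :
    matVec (-B) v = -matVec B v := by
  simp [matVec, Matrix.neg_mulVec]

lemma one_matVec (v : Param d) : matVec 1 v = v := by simp [matVec]

lemma norm_le_sum_abs_coord (v : Param d) : ‖v‖ ≤ ∑ i, |v i| := by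
  conv_lhs => rw [coord_sum v]
  refine (norm_sum_le _ _).trans (le_of_eq ?_)
  simp [norm_smul]

lemma norm_matVec_le (B : Matrix (Fin d) (Fin d) ℝ) (v : Param d) :
    ‖matVec B v‖ ≤ (∑ i, ∑ j, |B i j|) * ‖v‖ := by
  refine (norm_le_sum_abs_coord _).trans ?_
  rw [Finset.sum_mul]
  refine Finset.sum_le_sum fun i _ => ?_
  rw [matVec_apply, Finset.sum_mul]
  refine (Finset.abs_sum_le_sum_abs _ _).trans (Finset.sum_le_sum fun j _ => ?_)
  rw [abs_mul]
  exact mul_le_mul_of_nonneg_left (abs_coord_le v j) (abs_nonneg _)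

end Matrices

/-! ### Calculus of stochastic orders -/

section StochasticOrder

variable {Ω : Type*} [MeasurableSpace Ω] {P : Measure Ω}
  {F : Type*} [NormedAddCommGroup F] {F' : Type*} [NormedAddCommGroup F']
  {F'' : Type*} [NormedAddCommGroup F'']

lemma WithProbTendingToOne.mono {E E' : ℕ → Ω → Prop} (h : WithProbTendingToOne P E)
    (hE : ∀ᶠ n in atTop, ∀ᵐ ω ∂P, E n ω → E' n ω) : WithProbTendingToOne P E' := by
  refine tendsto_of_tendsto_of_tendsto_of_le_of_le' tendsto_const_nhds h
    (Eventually.of_forall fun _ => zero_le) ?_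
  filter_upwards [hE] with n hn
  refine measure_mono_ae ?_
  filter_upwards [hn] with ω hω h1 h2 using h1 (hω h2)

lemma WithProbTendingToOne.mono' {E E' : ℕ → Ω → Prop} (h : WithProbTendingToOne P E)
    (hE : ∀ n ω, E n ω → E' n ω) : WithProbTendingToOne P E' :=
  h.mono (Eventually.of_forall fun n => Eventually.of_forall (hE n))

lemma WithProbTendingToOne.and {E E' : ℕ → Ω → Prop} (h : WithProbTendingToOne P E)
    (h' : WithProbTendingToOne P E') : WithProbTendingToOne P fun n ω => E n ω ∧ E' n ω := by
  have h2 := Tendsto.add h h'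
  rw [add_zero] at h2
  refine tendsto_of_tendsto_of_tendsto_of_le_of_le tendsto_const_nhds h2
    (fun _ => zero_le) (fun n => ?_)
  refine (measure_mono ?_).trans (measure_union_le _ _)
  intro ω hω
  simp only [Set.mem_ofPred_eq, Set.mem_union] at hω ⊢
  tauto

lemma WithProbTendingToOne.of_ae {E : ℕ → Ω → Prop} (h : ∀ᶠ n in atTop, ∀ᵐ ω ∂P, E n ω) :
    WithProbTendingToOne P E := by
  refine tendsto_const_nhds.congr' ?_
  filter_upwards [h] with n hn
  exact (ae_iff.1 hn).symm

lemma isLittleOp_iff {Y : ℕ → Ω → F} {r : ℕ → ℝ} :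
    IsLittleOp P Y r ↔ ∀ ε : ℝ, 0 < ε → WithProbTendingToOne P fun n ω => ‖Y n ω‖ ≤ ε * r n := by
  simp only [IsLittleOp, WithProbTendingToOne, not_le]

/-- A sequence is bounded in probability as soon as it is dominated, with probability tending
to one, by a sequence that is. -/
lemma IsBigOp.of_le {Y : ℕ → Ω → F} {Y' : ℕ → Ω → F'} {r : ℕ → ℝ} (h : IsBigOp P Y r)
    (hle : WithProbTendingToOne P fun n ω => ‖Y' n ω‖ ≤ ‖Y n ω‖) : IsBigOp P Y' r := by
  intro ε hε
  have hε2 : (0 : ENNReal) < ε / 2 := ENNReal.half_pos hε.ne'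
  obtain ⟨C, hC⟩ := h (ε / 2) hε2
  refine ⟨C, ?_⟩
  filter_upwards [hC, hle.eventually (ge_mem_nhds hε2)] with n h1 h2
  calc P {ω | C * r n < ‖Y' n ω‖}
      ≤ P ({ω | C * r n < ‖Y n ω‖} ∪ {ω | ¬ ‖Y' n ω‖ ≤ ‖Y n ω‖}) := by
        refine measure_mono fun ω hω => ?_
        simp only [Set.mem_ofPred_eq, Set.mem_union] at hω ⊢
        by_cases h : ‖Y' n ω‖ ≤ ‖Y n ω‖
        · exact Or.inl (hω.trans_le h)
        · exact Or.inr h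
    _ ≤ ε / 2 + ε / 2 := (measure_union_le _ _).trans (add_le_add h1 h2)
    _ = ε := ENNReal.add_halves ε

lemma IsLittleOp.of_le {Y : ℕ → Ω → F} {Y' : ℕ → Ω → F'} {r : ℕ → ℝ} (h : IsLittleOp P Y r)
    (hle : WithProbTendingToOne P fun n ω => ‖Y' n ω‖ ≤ ‖Y n ω‖) : IsLittleOp P Y' r := by
  rw [isLittleOp_iff] at h ⊢
  exact fun ε hε => ((h ε hε).and hle).mono' fun n ω h => h.2.trans h.1

lemma IsLittleOp.congr' {Y Y' : ℕ → Ω → F} {r : ℕ → ℝ} (h : IsLittleOp P Y r)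
    (he : WithProbTendingToOne P fun n ω => Y' n ω = Y n ω) : IsLittleOp P Y' r :=
  h.of_le (he.mono' fun n ω h => by rw [h])

lemma IsLittleOp.isBigOp {Y : ℕ → Ω → F} {r : ℕ → ℝ} (h : IsLittleOp P Y r) :
    IsBigOp P Y r := fun _ hε =>
  ⟨1, (h 1 one_pos).eventually (ge_mem_nhds hε)⟩

lemma IsLittleOp.add {Y Y' : ℕ → Ω → F} {r : ℕ → ℝ} (h : IsLittleOp P Y r)
    (h' : IsLittleOp P Y' r) : IsLittleOp P (fun n ω => Y n ω + Y' n ω) r := by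
  rw [isLittleOp_iff] at h h' ⊢
  intro ε hε
  refine ((h _ (half_pos hε)).and (h' _ (half_pos hε))).mono' fun n ω h => ?_
  calc ‖Y n ω + Y' n ω‖ ≤ ε / 2 * r n + ε / 2 * r n := norm_add_le_of_le h.1 h.2
    _ = ε * r n := by ring

lemma IsLittleOp.neg {Y : ℕ → Ω → F} {r : ℕ → ℝ} (h : IsLittleOp P Y r) :
    IsLittleOp P (fun n ω => -Y n ω) r := by
  simpa only [IsLittleOp, norm_neg] using h

lemma IsLittleOp.sub {Y Y' : ℕ → Ω → F} {r : ℕ → ℝ} (h : IsLittleOp P Y r)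
    (h' : IsLittleOp P Y' r) : IsLittleOp P (fun n ω => Y n ω - Y' n ω) r := by
  simpa only [sub_eq_add_neg] using h.add h'.neg

lemma isLittleOp_zero {r : ℕ → ℝ} (hr : ∀ n, 0 ≤ r n) :
    IsLittleOp P (fun _ _ => (0 : F)) r := by
  rw [isLittleOp_iff]
  intro ε hε
  refine .of_ae (Eventually.of_forall fun n => Eventually.of_forall fun ω => ?_)
  simpa using mul_nonneg hε.le (hr n)

lemma IsLittleOp.sum {ι : Type*} (s : Finset ι) {Y : ι → ℕ → Ω → F} {r : ℕ → ℝ}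
    (hr : ∀ n, 0 ≤ r n) (h : ∀ i ∈ s, IsLittleOp P (Y i) r) :
    IsLittleOp P (fun n ω => ∑ i ∈ s, Y i n ω) r := by
  classical
  induction s using Finset.induction_on with
  | empty => simpa using isLittleOp_zero hr
  | insert i s hi ih =>
    simp only [Finset.sum_insert hi]
    exact (h i (by simp)).add (ih fun j hj => h j (by simp [hj]))

lemma IsBigOp.add {Y Y' : ℕ → Ω → F} {r : ℕ → ℝ} (h : IsBigOp P Y r)
    (h' : IsBigOp P Y' r) : IsBigOp P (fun n ω => Y n ω + Y' n ω) r := by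
  intro ε hε
  have hε2 : (0 : ENNReal) < ε / 2 := ENNReal.half_pos hε.ne'
  obtain ⟨C, hC⟩ := h _ hε2
  obtain ⟨C', hC'⟩ := h' _ hε2
  refine ⟨C + C', ?_⟩
  filter_upwards [hC, hC'] with n h1 h2
  calc P {ω | (C + C') * r n < ‖Y n ω + Y' n ω‖}
      ≤ P ({ω | C * r n < ‖Y n ω‖} ∪ {ω | C' * r n < ‖Y' n ω‖}) := by
        refine measure_mono fun ω hω => ?_
        simp only [Set.mem_ofPred_eq, Set.mem_union] at hω ⊢
        by_contra! hcon
        have := norm_add_le_of_le hcon.1 hcon.2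
        linarith
    _ ≤ ε / 2 + ε / 2 := (measure_union_le _ _).trans (add_le_add h1 h2)
    _ = ε := ENNReal.add_halves ε

lemma isBigOp_const (c : F) : IsBigOp P (fun _ _ => c) (fun _ => 1) := fun ε hε =>
  ⟨‖c‖, Eventually.of_forall fun n => by simp⟩

lemma IsBigOp.sum {ι : Type*} (s : Finset ι) {Y : ι → ℕ → Ω → F}
    (h : ∀ i ∈ s, IsBigOp P (Y i) (fun _ => 1)) :
    IsBigOp P (fun n ω => ∑ i ∈ s, Y i n ω) (fun _ => 1) := by
  classical
  induction s using Finset.induction_on with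
  | empty => simpa using isBigOp_const (P := P) (0 : F)
  | insert i s hi ih =>
    simp only [Finset.sum_insert hi]
    exact (h i (by simp)).add (ih fun j hj => h j (by simp [hj]))

lemma IsBigOp.of_le_mul {Y : ℕ → Ω → F} {Y' : ℕ → Ω → F'} {Y'' : ℕ → Ω → F''}
    (h : IsBigOp P Y (fun _ => 1)) (h' : IsBigOp P Y' (fun _ => 1))
    (hle : WithProbTendingToOne P fun n ω => ‖Y'' n ω‖ ≤ ‖Y n ω‖ * ‖Y' n ω‖) :
    IsBigOp P Y'' (fun _ => 1) := by
  refine IsBigOp.of_le (Y := fun n ω => ‖Y n ω‖ * ‖Y' n ω‖) ?_ (by simpa using hle)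
  intro ε hε
  have hε2 : (0 : ENNReal) < ε / 2 := ENNReal.half_pos hε.ne'
  obtain ⟨C, hC⟩ := h _ hε2
  obtain ⟨C', hC'⟩ := h' _ hε2
  refine ⟨C * C', ?_⟩
  filter_upwards [hC, hC'] with n h1 h2
  calc P {ω | (C * C') * 1 < ‖‖Y n ω‖ * ‖Y' n ω‖‖}
      ≤ P ({ω | C * 1 < ‖Y n ω‖} ∪ {ω | C' * 1 < ‖Y' n ω‖}) := by
        refine measure_mono fun ω hω => ?_
        simp only [Set.mem_ofPred_eq, Set.mem_union, norm_mul, norm_norm, mul_one] at hω ⊢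
        by_contra! hcon
        have : ‖Y n ω‖ * ‖Y' n ω‖ ≤ C * C' :=
          mul_le_mul hcon.1 hcon.2 (norm_nonneg _) ((norm_nonneg _).trans hcon.1)
        linarith
    _ ≤ ε / 2 + ε / 2 := (measure_union_le _ _).trans (add_le_add h1 h2)
    _ = ε := ENNReal.add_halves ε

/-- The form in which Taylor remainders arise: the event on which the bound holds may depend on `ε`,
as long as its probability tends to one for each fixed `ε`. -/
lemma isLittleOp_of_forall_le_mul {Y : ℕ → Ω → F} {W : ℕ → Ω → F'} (hW : IsBigOp P W (fun _ => 1))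
    (h : ∀ ε : ℝ, 0 < ε → WithProbTendingToOne P fun n ω => ‖Y n ω‖ ≤ ε * ‖W n ω‖) :
    IsLittleOp P Y (fun _ => 1) := by
  intro ε hε
  rw [ENNReal.tendsto_nhds_zero]
  intro η hη
  have hη2 : (0 : ENNReal) < η / 2 := ENNReal.half_pos hη.ne'
  obtain ⟨C, hC⟩ := hW _ hη2
  -- `C` may be zero or negative; `|C| + 1` is a positive bound in its place.
  have hpos : 0 < ε / (|C| + 1) := by positivity
  filter_upwards [hC, (h _ hpos).eventually (ge_mem_nhds hη2)] with n h1 h2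
  calc P {ω | ε * 1 < ‖Y n ω‖}
      ≤ P ({ω | C * 1 < ‖W n ω‖} ∪ {ω | ¬ ‖Y n ω‖ ≤ ε / (|C| + 1) * ‖W n ω‖}) := by
        refine measure_mono fun ω hω => ?_
        simp only [Set.mem_ofPred_eq, Set.mem_union, mul_one] at hω ⊢
        by_contra! hcon
        have h3 : ‖W n ω‖ ≤ |C| + 1 := hcon.1.trans ((le_abs_self C).trans (by linarith))
        have : ‖Y n ω‖ ≤ ε / (|C| + 1) * (|C| + 1) :=
          hcon.2.trans (mul_le_mul_of_nonneg_left h3 hpos.le)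
        rw [div_mul_cancel₀ _ (by positivity)] at this
        linarith
    _ ≤ η / 2 + η / 2 := (measure_union_le _ _).trans (add_le_add h1 h2)
    _ = η := ENNReal.add_halves η

lemma IsLittleOp.norm_le {Y : ℕ → Ω → F} (h : IsLittleOp P Y (fun _ => 1)) {ε : ℝ} (hε : 0 < ε) :
    WithProbTendingToOne P fun n ω => ‖Y n ω‖ ≤ ε := by
  simpa using isLittleOp_iff.1 h ε hε

lemma IsLittleOp.of_le_mul {Y : ℕ → Ω → F} {Y' : ℕ → Ω → F'} {Y'' : ℕ → Ω → F''}
    (h : IsLittleOp P Y (fun _ => 1)) (h' : IsBigOp P Y' (fun _ => 1))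
    (hle : WithProbTendingToOne P fun n ω => ‖Y'' n ω‖ ≤ ‖Y n ω‖ * ‖Y' n ω‖) :
    IsLittleOp P Y'' (fun _ => 1) :=
  isLittleOp_of_forall_le_mul h' fun _ hε => ((h.norm_le hε).and hle).mono' fun _ _ hω =>
    hω.2.trans (mul_le_mul_of_nonneg_right hω.1 (norm_nonneg _))

lemma IsLittleOp.mul {Y Y' : ℕ → Ω → ℝ}
    (h : IsLittleOp P Y (fun _ => 1)) (h' : IsBigOp P Y' (fun _ => 1)) :
    IsLittleOp P (fun n ω => Y n ω * Y' n ω) (fun _ => 1) :=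
  h.of_le_mul h' (.of_ae (Eventually.of_forall fun _ => Eventually.of_forall fun _ =>
    (norm_mul _ _).le))

lemma IsBigOp.mul {Y Y' : ℕ → Ω → ℝ}
    (h : IsBigOp P Y (fun _ => 1)) (h' : IsBigOp P Y' (fun _ => 1)) :
    IsBigOp P (fun n ω => Y n ω * Y' n ω) (fun _ => 1) :=
  h.of_le_mul h' (.of_ae (Eventually.of_forall fun _ => Eventually.of_forall fun _ =>
    (norm_mul _ _).le))

/-- Convergence of a deterministic null sequence times a sequence bounded in probability. -/
lemma IsBigOp.isLittleOp_smul [NormedSpace ℝ F] {Y : ℕ → Ω → F} {c : ℕ → ℝ}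
    (h : IsBigOp P Y (fun _ => 1)) (hc : Tendsto c atTop (𝓝 0)) :
    IsLittleOp P (fun n ω => c n • Y n ω) (fun _ => 1) := by
  have h0 : IsLittleOp P (fun n (_ : Ω) => c n) (fun _ => 1) := by
    rw [isLittleOp_iff]
    intro ε hε
    refine .of_ae ?_
    filter_upwards [hc.norm.eventually (ge_mem_nhds (by simpa using hε))] with n hn
    exact Eventually.of_forall fun ω => by simpa using hn
  exact h0.of_le_mul h (.of_ae (Eventually.of_forall fun _ => Eventually.of_forall fun _ =>
    (norm_smul _ _).le))

/-- Reduces every rate to the rate `1`, for which sums and products are available. The relation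
between `c` and `r` is only needed eventually, which excludes `n = 0` for `c n = n` and `c n = √n`.
-/
lemma isLittleOp_smul_iff [NormedSpace ℝ F] {Y : ℕ → Ω → F} {c r : ℕ → ℝ}
    (hc : ∀ᶠ n in atTop, 0 < c n ∧ c n * r n = 1) :
    IsLittleOp P (fun n ω => c n • Y n ω) (fun _ => 1) ↔ IsLittleOp P Y r := by
  unfold IsLittleOp
  refine forall₂_congr fun ε hε => tendsto_congr' ?_
  filter_upwards [hc] with n hn
  congr 1
  ext ω
  simp only [Set.mem_ofPred_eq, norm_smul, Real.norm_eq_abs, abs_of_pos hn.1]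
  rw [← hn.2, ← mul_assoc, mul_comm ε, mul_assoc, mul_lt_mul_iff_right₀ hn.1]

lemma isBigOp_smul_iff [NormedSpace ℝ F] {Y : ℕ → Ω → F} {c r : ℕ → ℝ}
    (hc : ∀ᶠ n in atTop, 0 < c n ∧ c n * r n = 1) :
    IsBigOp P (fun n ω => c n • Y n ω) (fun _ => 1) ↔ IsBigOp P Y r := by
  unfold IsBigOp
  refine forall₂_congr fun ε hε => exists_congr fun C => eventually_congr ?_
  filter_upwards [hc] with n hn
  rw [show {ω | C * 1 < ‖c n • Y n ω‖} = {ω | C * r n < ‖Y n ω‖} from ?_]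
  ext ω
  simp only [Set.mem_ofPred_eq, norm_smul, Real.norm_eq_abs, abs_of_pos hn.1]
  rw [← hn.2, ← mul_assoc, mul_comm C, mul_assoc, mul_lt_mul_iff_right₀ hn.1]

/-- A sequence of variables whose norms are eventually bounded on average is bounded in
probability. -/
lemma isBigOp_of_integral_le [IsProbabilityMeasure P] {Y : ℕ → Ω → ℝ}
    (hY : ∀ n, Integrable (fun ω => Y n ω ^ 2) P) {c : ℝ}
    (hc : ∀ n, ∫ ω, Y n ω ^ 2 ∂P ≤ c) : IsBigOp P Y (fun _ => 1) := by
  have hc0 : 0 ≤ c := (integral_nonneg fun ω => sq_nonneg (Y 0 ω)).trans (hc 0)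
  intro ε hε
  wlog hεt : ε ≠ ⊤ generalizing ε
  · push Not at hεt
    exact ⟨0, by simp [hεt]⟩
  have hε' : 0 < ε.toReal := ENNReal.toReal_pos hε.ne' hεt
  -- Markov's inequality for the squares at level `(c + 1) / ε`; the added `1` keeps the level
  -- positive when `c = 0`.
  refine ⟨√((c + 1) / ε.toReal), Eventually.of_forall fun n => ?_⟩
  have hm : 0 < (c + 1) / ε.toReal := by positivity
  have hM := mul_meas_ge_le_integral_of_nonneg (μ := P) (f := fun ω => Y n ω ^ 2)
    (Eventually.of_forall fun ω => sq_nonneg _) (hY n) ((c + 1) / ε.toReal)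
  calc P {ω | √((c + 1) / ε.toReal) * 1 < ‖Y n ω‖}
      ≤ P {ω | (c + 1) / ε.toReal ≤ Y n ω ^ 2} := by
        refine measure_mono fun ω hω => ?_
        simp only [Set.mem_ofPred_eq, mul_one, Real.norm_eq_abs] at hω ⊢
        rw [← sq_abs, ← Real.sqrt_le_left (abs_nonneg _)]
        exact hω.le
    _ ≤ ε := by
        rw [← ENNReal.toReal_le_toReal (measure_ne_top P _) hεt]
        have h1 : (c + 1) / ε.toReal * P.real {ω | (c + 1) / ε.toReal ≤ Y n ω ^ 2} ≤ c + 1 :=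
          hM.trans ((hc n).trans (by linarith))
        rw [div_mul_eq_mul_div, div_le_iff₀ hε'] at h1
        exact le_of_mul_le_mul_left h1 (by positivity)

/-- The two notions differ only in a strict versus a weak inequality inside the event, and halving
`ε` absorbs this. -/
lemma isLittleOp_one_iff_tendstoInMeasure {Y : ℕ → Ω → F} :
    IsLittleOp P Y (fun _ => 1) ↔ TendstoInMeasure P Y atTop (fun _ => 0) := by
  rw [tendstoInMeasure_iff_norm]
  simp only [sub_zero]
  constructor
  · intro h ε hε
    refine tendsto_of_tendsto_of_tendsto_of_le_of_le tendsto_const_nhds (h _ (half_pos hε))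
      (fun _ => zero_le) fun n => measure_mono fun ω hω => ?_
    simp only [Set.mem_ofPred_eq] at hω ⊢
    linarith
  · intro h ε hε
    refine tendsto_of_tendsto_of_tendsto_of_le_of_le tendsto_const_nhds (h _ hε)
      (fun _ => zero_le) fun n => measure_mono fun ω hω => ?_
    simp only [Set.mem_ofPred_eq, mul_one] at hω ⊢
    exact hω.le

/-- Continuous mapping for a constant limit, where continuity at the limit point suffices and `g`
need not be measurable. -/
lemma isLittleOp_comp_of_continuousAt {Y : ℕ → Ω → F} {y : F} {g : F → F'}
    (h : IsLittleOp P (fun n ω => Y n ω - y) (fun _ => 1)) (hg : ContinuousAt g y) :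
    IsLittleOp P (fun n ω => g (Y n ω) - g y) (fun _ => 1) := by
  rw [isLittleOp_iff]
  intro ε hε
  obtain ⟨δ, hδ, hgδ⟩ := Metric.continuousAt_iff.1 hg ε hε
  refine (h.norm_le (half_pos hδ)).mono' fun n ω hω => ?_
  have := hgδ (x := Y n ω) (by rw [dist_eq_norm]; linarith)
  rw [dist_eq_norm] at this
  linarith

lemma isLittleOp_of_coord {d : ℕ} {Y : ℕ → Ω → Param d}
    (h : ∀ i, IsLittleOp P (fun n ω => Y n ω i) (fun _ => 1)) :
    IsLittleOp P Y (fun _ => 1) := by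
  refine (IsLittleOp.sum Finset.univ (Y := fun i n ω => ‖Y n ω i‖) (fun _ => zero_le_one)
    fun i _ => (h i).of_le (.of_ae (.of_forall fun n => .of_forall fun ω => by simp))).of_le
    (.of_ae (.of_forall fun n => .of_forall fun ω => ?_))
  exact (norm_le_sum_abs_coord _).trans (le_abs_self _)

lemma isBigOp_of_coord {d : ℕ} {Y : ℕ → Ω → Param d}
    (h : ∀ i, IsBigOp P (fun n ω => Y n ω i) (fun _ => 1)) :
    IsBigOp P Y (fun _ => 1) := by
  refine (IsBigOp.sum Finset.univ (Y := fun i n ω => ‖Y n ω i‖)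
    fun i _ => (h i).of_le (.of_ae (.of_forall fun n => .of_forall fun ω => by simp))).of_le
    (.of_ae (.of_forall fun n => .of_forall fun ω => ?_))
  exact (norm_le_sum_abs_coord _).trans (le_abs_self _)

lemma IsLittleOp.coord {d : ℕ} {Y : ℕ → Ω → Param d} (h : IsLittleOp P Y (fun _ => 1))
    (i : Fin d) : IsLittleOp P (fun n ω => Y n ω i) (fun _ => 1) :=
  h.of_le (.of_ae (.of_forall fun _ => .of_forall fun _ => abs_coord_le _ i))

lemma IsBigOp.coord {d : ℕ} {Y : ℕ → Ω → Param d} (h : IsBigOp P Y (fun _ => 1))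
    (i : Fin d) : IsBigOp P (fun n ω => Y n ω i) (fun _ => 1) :=
  h.of_le (.of_ae (.of_forall fun _ => .of_forall fun _ => abs_coord_le _ i))

lemma IsLittleOp.matVec {d : ℕ} {Y : ℕ → Ω → Param d} (h : IsLittleOp P Y (fun _ => 1))
    (B : Matrix (Fin d) (Fin d) ℝ) : IsLittleOp P (fun n ω => matVec B (Y n ω)) (fun _ => 1) :=
  h.of_le_mul (isBigOp_const (∑ i, ∑ j, |B i j|))
    (.of_ae (.of_forall fun _ => .of_forall fun _ => by
      rw [mul_comm]
      exact (norm_matVec_le _ _).trans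
        (mul_le_mul_of_nonneg_right (le_abs_self _) (norm_nonneg _))))

lemma IsBigOp.matVec {d : ℕ} {Y : ℕ → Ω → Param d} (h : IsBigOp P Y (fun _ => 1))
    (B : Matrix (Fin d) (Fin d) ℝ) : IsBigOp P (fun n ω => matVec B (Y n ω)) (fun _ => 1) :=
  h.of_le_mul (isBigOp_const (∑ i, ∑ j, |B i j|))
    (.of_ae (.of_forall fun _ => .of_forall fun _ => by
      rw [mul_comm]
      exact (norm_matVec_le _ _).trans
        (mul_le_mul_of_nonneg_right (le_abs_self _) (norm_nonneg _))))

end StochasticOrder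

/-! ### Uniform integrability and convergence of means -/

section UniformIntegrability

variable {Ω : Type*} [MeasurableSpace Ω] {P : Measure Ω}
  {F : Type*} [NormedAddCommGroup F]

lemma EventuallyUI.integrable {Y : ℕ → Ω → F} (h : EventuallyUI P Y) :
    ∀ᶠ n in atTop, Integrable (Y n) P := by
  obtain ⟨N, hN⟩ := h
  filter_upwards [eventually_ge_atTop N] with n hn
  have := hN.memLp (n - N)
  rw [Nat.sub_add_cancel hn] at this
  exact memLp_one_iff_integrable.1 this

lemma EventuallyUI.sub {Y Y' : ℕ → Ω → F} (h : EventuallyUI P Y)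
    (h' : EventuallyUI P Y') : EventuallyUI P (fun n ω => Y n ω - Y' n ω) := by
  obtain ⟨N, hm, hu, C, hC⟩ := h
  obtain ⟨N', hm', hu', C', hC'⟩ := h'
  -- The two sequences become uniformly integrable from different indices. Discarding further terms
  -- is harmless, so both are started at `N + N'`.
  have key : ∀ {Y : ℕ → Ω → F} {N : ℕ} (M : ℕ), UnifIntegrable (fun n => Y (n + N)) 1 P →
      UnifIntegrable (fun n => Y (n + (M + N))) 1 P := by
    intro Y N M h ε hε
    obtain ⟨δ, hδ, hs⟩ := h hε
    refine ⟨δ, hδ, fun i s => ?_⟩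
    have := hs (i + M) s
    beta_reduce at this
    rwa [add_assoc] at this
  have e1 : ∀ n, n + (N + N') = (n + N') + N := by intro n; ring
  have e2 : ∀ n, n + (N + N') = (n + N) + N' := by intro n; ring
  have hmA : ∀ n, AEStronglyMeasurable (Y (n + (N + N'))) P := fun n => e1 n ▸ hm _
  have hmB : ∀ n, AEStronglyMeasurable (Y' (n + (N + N'))) P := fun n => e2 n ▸ hm' _
  refine ⟨N + N', fun n => (hmA n).sub (hmB n), ?_, C + C', fun n => ?_⟩
  · exact UnifIntegrable.sub (by rw [add_comm N N']; exact key N' hu) (key N hu') le_rfl hmA hmB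
  · refine (eLpNorm_sub_le (hmA n) (hmB n) le_rfl).trans ?_
    rw [ENNReal.coe_add]
    refine add_le_add ?_ ?_
    · rw [e1]; exact hC _
    · rw [e2]; exact hC' _

/-- Vitali: a uniformly integrable sequence that tends to zero in probability tends to zero in
mean. -/
lemma EventuallyUI.tendsto_integral [NormedSpace ℝ F] [CompleteSpace F] [IsProbabilityMeasure P]
    {Y : ℕ → Ω → F} (h : EventuallyUI P Y) (h0 : IsLittleOp P Y (fun _ => 1)) :
    Tendsto (fun n => ∫ ω, Y n ω ∂P) atTop (𝓝 0) := by
  have hint := h.integrable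
  obtain ⟨N, hN⟩ := h
  rw [isLittleOp_one_iff_tendstoInMeasure] at h0
  have h0' : TendstoInMeasure P (fun n => Y (n + N)) atTop (fun _ => (0 : F)) :=
    fun ε hε => (h0 ε hε).comp (tendsto_add_atTop_nat N)
  have hL := tendsto_Lp_finite_of_tendstoInMeasure le_rfl ENNReal.one_ne_top
    (fun n => hN.aestronglyMeasurable n) (MemLp.zero) hN.unifIntegrable h0'
  rw [← tendsto_add_atTop_iff_nat N]
  have := tendsto_integral_of_L1' (μ := P) (f := fun _ => (0 : F)) aestronglyMeasurable_const
    (F := fun n => Y (n + N)) (l := atTop)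
    (Eventually.of_forall fun n => memLp_one_iff_integrable.1 (hN.memLp n)) hL
  simpa using this

end UniformIntegrability

/-! ### Moments and limit laws of sums of i.i.d. variables -/

section IID

variable {Ω 𝒳 : Type*}

/-- The sum of the statistic `f` over the first `n` observations. -/
def sampleSum (X : ℕ → Ω → 𝒳) (f : 𝒳 → ℝ) (n : ℕ) (ω : Ω) : ℝ :=
  ∑ m ∈ Finset.range n, f (X m ω)

/-- The sum of the statistic `f` over the first `n` observations, divided by `√n`. -/
def scaledSum (X : ℕ → Ω → 𝒳) (f : 𝒳 → ℝ) (n : ℕ) (ω : Ω) : ℝ :=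
  (√n)⁻¹ * sampleSum X f n ω

variable {X : ℕ → Ω → 𝒳} {f g : 𝒳 → ℝ}

lemma sampleSum_succ (n : ℕ) (ω : Ω) :
    sampleSum X f (n + 1) ω = sampleSum X f n ω + f (X n ω) := Finset.sum_range_succ _ _

lemma scaledSum_add (n : ℕ) (ω : Ω) :
    scaledSum X (fun x => f x + g x) n ω = scaledSum X f n ω + scaledSum X g n ω := by
  simp [scaledSum, sampleSum, Finset.sum_add_distrib, mul_add]

lemma scaledSum_sub (n : ℕ) (ω : Ω) :
    scaledSum X (fun x => f x - g x) n ω = scaledSum X f n ω - scaledSum X g n ω := by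
  simp [scaledSum, sampleSum, Finset.sum_sub_distrib, mul_sub]

lemma scaledSum_sum {ι : Type*} (s : Finset ι) (c : ι → ℝ) (F : ι → 𝒳 → ℝ) (n : ℕ) (ω : Ω) :
    scaledSum X (fun x => ∑ k ∈ s, c k * F k x) n ω = ∑ k ∈ s, c k * scaledSum X (F k) n ω := by
  simp only [scaledSum, sampleSum]
  rw [Finset.sum_comm, Finset.mul_sum]
  refine Finset.sum_congr rfl fun k _ => ?_
  rw [← Finset.mul_sum]; ring

lemma abs_sampleSum_le {M : ℝ} (hM : ∀ x, |f x| ≤ M) (n : ℕ) (ω : Ω) :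
    |sampleSum X f n ω| ≤ n * M := by
  refine (Finset.abs_sum_le_sum_abs _ _).trans
    ((Finset.sum_le_sum fun i _ => hM (X i ω)).trans (le_of_eq ?_))
  simp

variable [MeasurableSpace Ω] [MeasurableSpace 𝒳]

/-- `X 0, X 1, …` are independent with the common law `μ`. -/
structure IsIIDSample (P : Measure Ω) (X : ℕ → Ω → 𝒳) (μ : Measure 𝒳) : Prop where
  measurable : ∀ i, Measurable (X i)
  indep : iIndepFun X P
  map_eq : ∀ i, P.map (X i) = μ

namespace IsIIDSample

variable {P : Measure Ω} {μ : Measure 𝒳} (h : IsIIDSample P X μ)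
include h

lemma measurePreserving (i : ℕ) : MeasurePreserving (X i) P μ := ⟨h.measurable i, h.map_eq i⟩

lemma integrable_comp (hf : Integrable f μ) (i : ℕ) : Integrable (fun ω => f (X i ω)) P :=
  (h.measurePreserving i).integrable_comp_of_integrable hf

lemma integral_comp (hf : AEStronglyMeasurable f μ) (i : ℕ) :
    ∫ ω, f (X i ω) ∂P = ∫ x, f x ∂μ := by
  rw [← h.map_eq i] at hf ⊢
  exact (integral_map (h.measurable i).aemeasurable hf).symm

lemma memLp_comp {p : ENNReal} (hf : MemLp f p μ) (i : ℕ) : MemLp (fun ω => f (X i ω)) p P :=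
  hf.comp_measurePreserving (h.measurePreserving i)

lemma indep_comp (hf : AEStronglyMeasurable f μ) : iIndepFun (fun i ω => f (X i ω)) P :=
  h.indep.comp₀ (fun _ => f) (fun i => (h.measurable i).aemeasurable)
    (fun i => by rw [h.map_eq i]; exact hf.aemeasurable)

lemma aestronglyMeasurable_comp (hf : AEStronglyMeasurable f μ) (i : ℕ) :
    AEStronglyMeasurable (fun ω => f (X i ω)) P :=
  hf.comp_measurePreserving (h.measurePreserving i)

lemma aestronglyMeasurable_sampleSum (hf : AEStronglyMeasurable f μ) (n : ℕ) :
    AEStronglyMeasurable (sampleSum X f n) P :=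
  Finset.aestronglyMeasurable_fun_sum _ fun i _ => h.aestronglyMeasurable_comp hf i

lemma integrable_sampleSum (hf : Integrable f μ) (n : ℕ) : Integrable (sampleSum X f n) P :=
  integrable_finsetSum _ fun i _ => h.integrable_comp hf i

lemma integral_sampleSum (hf : Integrable f μ) (n : ℕ) :
    ∫ ω, sampleSum X f n ω ∂P = n * ∫ x, f x ∂μ := by
  unfold sampleSum
  rw [integral_finsetSum _ fun i _ => h.integrable_comp hf i]
  simp [h.integral_comp hf.1]

lemma memLp_sampleSum {p : ENNReal} (hf : MemLp f p μ) (n : ℕ) : MemLp (sampleSum X f n) p P :=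
  memLp_finsetSum _ fun i _ => h.memLp_comp hf i

lemma indepFun_sampleSum (hf : AEStronglyMeasurable f μ) (n : ℕ) :
    IndepFun (sampleSum X f n) (fun ω => f (X n ω)) P := by
  have := (h.indep_comp hf).indepFun_finsetSum_of_notMem₀
    (fun i => (h.aestronglyMeasurable_comp hf i).aemeasurable) (s := Finset.range n) (i := n)
    (by simp)
  convert this using 1
  ext ω
  simp [sampleSum]

/-- `X n` is not among the first `n` observations, so it is independent of their sum. This
factorisation drives the recursions for the second and the fourth moment. -/
lemma integral_sampleSum_pow_mul_pow (hf : AEStronglyMeasurable f μ) (n k l : ℕ) :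
    ∫ ω, sampleSum X f n ω ^ k * f (X n ω) ^ l ∂P
      = (∫ ω, sampleSum X f n ω ^ k ∂P) * ∫ x, f x ^ l ∂μ := by
  rw [← h.integral_comp (f := fun x => f x ^ l) (hf.pow l) n]
  exact IndepFun.integral_fun_mul_eq_mul_integral
    ((h.indepFun_sampleSum hf n).comp (measurable_id.pow_const k) (measurable_id.pow_const l))
    ((h.aestronglyMeasurable_sampleSum hf n).pow k)
    ((h.aestronglyMeasurable_comp hf n).pow l)

lemma integrable_scaledSum_sq (hf : MemLp f 2 μ) (n : ℕ) :
    Integrable (fun ω => scaledSum X f n ω ^ 2) P := by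
  simp only [scaledSum, mul_pow]
  exact (h.memLp_sampleSum hf n).integrable_sq.const_mul _

variable [IsProbabilityMeasure P]

lemma isProbabilityMeasure : IsProbabilityMeasure μ := by
  rw [← h.map_eq 0]
  exact Measure.isProbabilityMeasure_map (h.measurable 0).aemeasurable

/-- Induction on `n`: the cross term factors by independence and vanishes because `f` is centred. -/
lemma integral_sampleSum_sq (hf : MemLp f 2 μ) (hf0 : ∫ x, f x ∂μ = 0) (n : ℕ) :
    ∫ ω, sampleSum X f n ω ^ 2 ∂P = n * ∫ x, f x ^ 2 ∂μ := by
  have := h.isProbabilityMeasure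
  have hfi : Integrable f μ := hf.integrable one_le_two
  induction n with
  | zero => simp [sampleSum]
  | succ n ih =>
    have hS := h.memLp_sampleSum hf n
    have hY := h.memLp_comp hf n
    have h1 := h.integral_sampleSum_pow_mul_pow hf.1 n 1 1
    have h2 := h.integral_comp (f := fun x => f x ^ 2) (hf.1.pow 2) n
    have hSY : Integrable (fun ω => sampleSum X f n ω ^ 1 * f (X n ω) ^ 1) P := by
      simpa using! hS.integrable_mul hY
    calc ∫ ω, sampleSum X f (n + 1) ω ^ 2 ∂P
        = ∫ ω, (sampleSum X f n ω ^ 2 + 2 * (sampleSum X f n ω ^ 1 * f (X n ω) ^ 1)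
            + f (X n ω) ^ 2) ∂P := by
          refine integral_congr_ae (.of_forall fun ω => ?_)
          simp only [sampleSum_succ]; ring
      _ = ∫ ω, sampleSum X f n ω ^ 2 ∂P
            + 2 * ∫ ω, sampleSum X f n ω ^ 1 * f (X n ω) ^ 1 ∂P + ∫ ω, f (X n ω) ^ 2 ∂P := by
          rw [integral_add (hS.integrable_sq.fun_add (hSY.const_mul 2)) hY.integrable_sq,
            integral_add hS.integrable_sq (hSY.const_mul 2), integral_const_mul]
      _ = _ := by
          rw [ih, h1, h2]
          simp only [pow_one, hf0]
          push_cast; ring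

lemma integral_scaledSum_sq (hf : MemLp f 2 μ) (hf0 : ∫ x, f x ∂μ = 0) {n : ℕ} (hn : 0 < n) :
    ∫ ω, scaledSum X f n ω ^ 2 ∂P = ∫ x, f x ^ 2 ∂μ := by
  simp only [scaledSum, mul_pow, integral_const_mul]
  rw [h.integral_sampleSum_sq hf hf0, inv_pow, Real.sq_sqrt n.cast_nonneg]
  have : (n : ℝ) ≠ 0 := by positivity
  field_simp

/-- For `n = 0` the sum is empty and equality can fail, but the bound persists; this makes it
uniform over all indices. -/
lemma integral_scaledSum_sq_le (hf : MemLp f 2 μ) (hf0 : ∫ x, f x ∂μ = 0) (n : ℕ) :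
    ∫ ω, scaledSum X f n ω ^ 2 ∂P ≤ ∫ x, f x ^ 2 ∂μ := by
  rcases Nat.eq_zero_or_pos n with rfl | hn
  · simpa [scaledSum] using integral_nonneg fun x => sq_nonneg (f x)
  · exact (h.integral_scaledSum_sq hf hf0 hn).le

lemma isBigOp_scaledSum (hf : MemLp f 2 μ) (hf0 : ∫ x, f x ∂μ = 0) :
    IsBigOp P (scaledSum X f) (fun _ => 1) :=
  isBigOp_of_integral_le (h.integrable_scaledSum_sq hf) (h.integral_scaledSum_sq_le hf hf0)

/-- Weak law of large numbers. -/
lemma isLittleOp_average (hf : Integrable f μ) :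
    IsLittleOp P (fun n ω => (n : ℝ)⁻¹ * sampleSum X f n ω - ∫ x, f x ∂μ) (fun _ => 1) := by
  have hid : ∀ i, IdentDistrib (fun ω => f (X i ω)) (fun ω => f (X 0 ω)) P P := fun i => by
    refine IdentDistrib.comp_of_aemeasurable (u := f)
      ⟨(h.measurable i).aemeasurable, (h.measurable 0).aemeasurable, ?_⟩ ?_
    · rw [h.map_eq, h.map_eq]
    · rw [h.map_eq]; exact hf.1.aemeasurable
  have hs := strong_law_ae_real (fun i ω => f (X i ω)) (h.integrable_comp hf 0)
    (fun i j hij => (h.indep_comp hf.1).indepFun hij) hid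
  rw [isLittleOp_one_iff_tendstoInMeasure]
  refine tendstoInMeasure_of_tendsto_ae (fun n =>
    ((h.aestronglyMeasurable_sampleSum hf.1 n).const_mul _).sub
      aestronglyMeasurable_const) ?_
  filter_upwards [hs] with ω hω
  rw [h.integral_comp hf.1] at hω
  simpa [sampleSum, div_eq_inv_mul] using hω.sub_const (∫ x, f x ∂μ)

lemma integrable_sampleSum_pow_mul_pow (hf : Measurable f) {M : ℝ} (hM : ∀ x, |f x| ≤ M)
    (n k l : ℕ) : Integrable (fun ω => sampleSum X f n ω ^ k * f (X n ω) ^ l) P := by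
  refine Integrable.of_bound (C := (n * M) ^ k * M ^ l)
    (((h.aestronglyMeasurable_sampleSum hf.aestronglyMeasurable n).pow k).mul
      ((h.aestronglyMeasurable_comp hf.aestronglyMeasurable n).pow l)) (.of_forall fun ω => ?_)
  simp only [norm_mul, norm_pow, Real.norm_eq_abs]
  have hM0 : 0 ≤ M := (abs_nonneg _).trans (hM (X 0 ω))
  gcongr
  · exact abs_sampleSum_le hM n ω
  · exact hM _

/-- In the binomial expansion of `(S + Y)^4` both odd terms vanish, as `S` and `Y` are centred. The
fourth moment thus grows by at most `(6n + 1) M^4` per step, while `3n²` grows by `6n + 3`. The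
order `n²` is what keeps the fourth moments of the normalised sums bounded. -/
lemma integral_sampleSum_pow_four_le (hf : Measurable f) {M : ℝ} (hM : ∀ x, |f x| ≤ M)
    (hf0 : ∫ x, f x ∂μ = 0) (n : ℕ) :
    ∫ ω, sampleSum X f n ω ^ 4 ∂P ≤ 3 * n ^ 2 * M ^ 4 := by
  have := h.isProbabilityMeasure
  have hbd : ∀ k, ∫ x, f x ^ (2 * k) ∂μ ≤ M ^ (2 * k) := by
    intro k
    have hp : ∀ x, f x ^ (2 * k) ≤ M ^ (2 * k) := fun x => by
      rw [← Even.pow_abs (even_two_mul k)]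
      exact pow_le_pow_left₀ (abs_nonneg _) (hM x) _
    calc ∫ x, f x ^ (2 * k) ∂μ ≤ ∫ _, M ^ (2 * k) ∂μ := by
          refine integral_mono_of_nonneg (.of_forall fun x => (even_two_mul k).pow_nonneg _)
            (integrable_const _) (.of_forall hp)
      _ = M ^ (2 * k) := by simp
  have hf2 : MemLp f 2 μ := MemLp.of_bound hf.aestronglyMeasurable M (.of_forall hM)
  induction n with
  | zero => simp [sampleSum]
  | succ n ih =>
    have hI := h.integrable_sampleSum_pow_mul_pow hf hM n
    have hE := h.integral_sampleSum_pow_mul_pow hf.aestronglyMeasurable n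
    have h2 := h.integral_sampleSum_sq hf2 hf0 n
    have h22 : (∫ ω, sampleSum X f n ω ^ 2 ∂P) * ∫ x, f x ^ 2 ∂μ ≤ n * M ^ 4 := by
      rw [h2]
      have := hbd 1
      rw [mul_one] at this
      have h0 : 0 ≤ ∫ x, f x ^ 2 ∂μ := integral_nonneg fun x => sq_nonneg _
      calc n * (∫ x, f x ^ 2 ∂μ) * ∫ x, f x ^ 2 ∂μ ≤ n * (M ^ 2) * M ^ 2 := by gcongr
        _ = n * M ^ 4 := by ring
    calc ∫ ω, sampleSum X f (n + 1) ω ^ 4 ∂P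
        = ∫ ω, (sampleSum X f n ω ^ 4 * f (X n ω) ^ 0
            + 4 * (sampleSum X f n ω ^ 3 * f (X n ω) ^ 1)
            + 6 * (sampleSum X f n ω ^ 2 * f (X n ω) ^ 2)
            + 4 * (sampleSum X f n ω ^ 1 * f (X n ω) ^ 3)
            + sampleSum X f n ω ^ 0 * f (X n ω) ^ 4) ∂P := by
          refine integral_congr_ae (.of_forall fun ω => ?_)
          simp only [sampleSum_succ]; ring
      _ = ∫ ω, sampleSum X f n ω ^ 4 * f (X n ω) ^ 0 ∂P
            + 4 * ∫ ω, (sampleSum X f n ω ^ 3 * f (X n ω) ^ 1) ∂P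
            + 6 * ∫ ω, (sampleSum X f n ω ^ 2 * f (X n ω) ^ 2) ∂P
            + 4 * ∫ ω, (sampleSum X f n ω ^ 1 * f (X n ω) ^ 3) ∂P
            + ∫ ω, sampleSum X f n ω ^ 0 * f (X n ω) ^ 4 ∂P := by
          rw [integral_add ((((hI 4 0).fun_add ((hI 3 1).const_mul 4)).fun_add
              ((hI 2 2).const_mul 6)).fun_add ((hI 1 3).const_mul 4)) (hI 0 4),
            integral_add (((hI 4 0).fun_add ((hI 3 1).const_mul 4)).fun_add
              ((hI 2 2).const_mul 6)) ((hI 1 3).const_mul 4),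
            integral_add ((hI 4 0).fun_add ((hI 3 1).const_mul 4)) ((hI 2 2).const_mul 6),
            integral_add (hI 4 0) ((hI 3 1).const_mul 4)]
          simp only [integral_const_mul]
      _ ≤ 3 * n ^ 2 * M ^ 4 + 6 * (n * M ^ 4) + M ^ 4 := by
          rw [hE 3 1, hE 2 2, hE 1 3, hE 0 4, hE 4 0]
          have h4 := hbd 2
          norm_num at h4
          have hS1 := h.integral_sampleSum (hf2.integrable one_le_two) n
          simp only [pow_one, pow_zero, hf0, hS1, integral_const, probReal_univ, smul_eq_mul,
            mul_one, one_mul, mul_zero, zero_mul, add_zero]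
          linarith
      _ ≤ 3 * ((n + 1 : ℕ) : ℝ) ^ 2 * M ^ 4 := by
          push_cast
          nlinarith [pow_nonneg (sq_nonneg M) 2]

/-- Centred square-integrable statistics are approximated in mean square by centred bounded
ones. -/
lemma exists_bounded_approx (hf : MemLp f 2 μ) (hf0 : ∫ x, f x ∂μ = 0) {ε : ℝ} (hε : 0 < ε) :
    ∃ g : 𝒳 → ℝ, Measurable g ∧ (∃ M, ∀ x, |g x| ≤ M) ∧ ∫ x, g x ∂μ = 0 ∧
      ∫ x, (f x - g x) ^ 2 ∂μ ≤ ε := by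
  have := h.isProbabilityMeasure
  obtain ⟨g, hg, hg2⟩ := hf.exists_simpleFunc_eLpNorm_sub_lt (by norm_num)
    (ε := ENNReal.ofReal (√ε)) (by simpa using hε)
  obtain ⟨C, hC⟩ := g.exists_forall_norm_le
  have hgi := hg2.integrable one_le_two
  have hfi := hf.integrable one_le_two
  refine ⟨fun x => g x - ∫ y, g y ∂μ, g.measurable.sub_const _, ⟨C + |∫ y, g y ∂μ|, fun x => ?_⟩,
    ?_, ?_⟩
  · exact (abs_sub _ _).trans (add_le_add_left (hC x) _)
  · rw [integral_sub hgi (integrable_const _)]; simp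
  · have hd : MemLp (f - ⇑g) 2 μ := hf.sub hg2
    have h1 : ∫ x, (f x - g x) ^ 2 ∂μ ≤ ε := by
      have := hd.eLpNorm_eq_integral_rpow_norm (by norm_num) (by norm_num)
      rw [this] at hg
      have h0 : 0 ≤ ∫ x, (f x - g x) ^ 2 ∂μ := integral_nonneg fun x => sq_nonneg _
      simp only [ENNReal.toReal_ofNat, Pi.sub_apply, Real.rpow_ofNat, Real.norm_eq_abs,
        sq_abs] at hg
      rw [ENNReal.ofReal_lt_ofReal_iff (by positivity), ← one_div, ← Real.sqrt_eq_rpow] at hg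
      exact ((Real.sqrt_lt_sqrt_iff h0).1 hg).le
    -- Since `f` has mean zero, centring `g` amounts to centring `f - g`. The new mean-square error
    -- is the variance of `f - g`, which does not exceed its second moment.
    refine le_trans ?_ h1
    have hm : ∫ x, (f - ⇑g) x ∂μ = - ∫ y, g y ∂μ := by
      simp only [Pi.sub_apply]
      rw [integral_sub hfi hgi, hf0, zero_sub]
    have := variance_le_expectation_sq (μ := μ) (X := f - ⇑g) hd.1
    rw [variance_eq_integral hd.1.aemeasurable, hm] at this
    simpa [sub_add_eq_sub_sub, sub_sub_eq_add_sub, sub_neg_eq_add, sub_add] using this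

end IsIIDSample

end IID

/-! ### Closure properties of uniform integrability -/

section UniformIntegrability

variable {Ω : Type*} [MeasurableSpace Ω] {P : Measure Ω}
  {F : Type*} [NormedAddCommGroup F] {F' : Type*} [NormedAddCommGroup F']

lemma EventuallyUI.of_norm_le {Y : ℕ → Ω → F} {Y' : ℕ → Ω → F'} (h : EventuallyUI P Y)
    {c : ℝ} (hm : ∀ n, AEStronglyMeasurable (Y n) P → AEStronglyMeasurable (Y' n) P)
    (hle : ∀ n ω, ‖Y' n ω‖ ≤ c * ‖Y n ω‖) : EventuallyUI P Y' := by
  obtain ⟨N, hY, hu, C, hC⟩ := h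
  have hle' : ∀ n ω, ‖Y' n ω‖ ≤ |c| * ‖Y n ω‖ := fun n ω =>
    (hle n ω).trans (mul_le_mul_of_nonneg_right (le_abs_self c) (norm_nonneg _))
  refine ⟨N, fun n => hm _ (hY n), fun ε hε => ?_, ‖c‖₊ * C, fun n => ?_⟩
  -- The added `1` covers `c = 0`.
  · obtain ⟨δ, hδ, hs⟩ := hu (ε := ε / (|c| + 1)) (by positivity)
    refine ⟨δ, hδ, fun i s h1 h2 => ?_⟩
    refine (eLpNorm_le_mul_eLpNorm_of_ae_le_mul (c := |c|)
      (g := s.indicator (Y (i + N))) (.of_forall fun ω => ?_) 1).trans ?_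
    · by_cases hω : ω ∈ s <;> simp [hω, hle']
    · refine (mul_le_mul_right (hs i s h1 h2) _).trans ?_
      rw [← ENNReal.ofReal_mul (abs_nonneg c)]
      refine ENNReal.ofReal_le_ofReal ?_
      rw [mul_div_assoc', div_le_iff₀ (by positivity)]
      nlinarith [abs_nonneg c]
  · refine (eLpNorm_le_mul_eLpNorm_of_ae_le_mul (c := |c|)
      (g := Y (n + N)) (.of_forall fun ω => hle' _ _) 1).trans ?_
    rw [ENNReal.coe_mul]
    refine mul_le_mul' (le_of_eq ?_) (hC n)
    rw [← Real.norm_eq_abs, ofReal_norm, enorm_eq_nnnorm]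

lemma EventuallyUI.const_mul {Y : ℕ → Ω → ℝ} (h : EventuallyUI P Y) (c : ℝ) :
    EventuallyUI P (fun n ω => c * Y n ω) :=
  h.of_norm_le (c := |c|) (fun _ hm => hm.const_mul c) fun n ω => by simp

lemma EventuallyUI.smul_const [NormedSpace ℝ F] {Y : ℕ → Ω → ℝ} (h : EventuallyUI P Y) (v : F) :
    EventuallyUI P (fun n ω => Y n ω • v) :=
  h.of_norm_le (c := ‖v‖) (fun _ hm => hm.smul_const v) fun n ω => by
    rw [norm_smul, mul_comm]

lemma EventuallyUI.add {Y Y' : ℕ → Ω → F} (h : EventuallyUI P Y) (h' : EventuallyUI P Y') :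
    EventuallyUI P (fun n ω => Y n ω + Y' n ω) := by
  have hn : EventuallyUI P (fun n ω => -Y' n ω) :=
    h'.of_norm_le (c := 1) (fun _ hm => hm.neg) fun n ω => by simp
  simpa using h.sub hn

lemma eventuallyUI_zero : EventuallyUI P (fun _ _ => (0 : F)) :=
  ⟨0, fun _ => aestronglyMeasurable_const, fun ε hε => ⟨1, one_pos, fun i s _ _ => by
    simp⟩, 0, fun n => by simp⟩

lemma EventuallyUI.sum {ι : Type*} (s : Finset ι) {Y : ι → ℕ → Ω → F}
    (h : ∀ i ∈ s, EventuallyUI P (Y i)) : EventuallyUI P (fun n ω => ∑ i ∈ s, Y i n ω) := by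
  classical
  induction s using Finset.induction_on with
  | empty => simpa using eventuallyUI_zero
  | insert i s hi ih =>
    simp only [Finset.sum_insert hi]
    exact (h i (by simp)).add (ih fun j hj => h j (by simp [hj]))

lemma eventuallyUI_of_coord {d : ℕ} {Y : ℕ → Ω → Param d}
    (h : ∀ i, EventuallyUI P (fun n ω => Y n ω i)) : EventuallyUI P Y := by
  have : Y = fun n ω => ∑ i, Y n ω i • EuclideanSpace.single i (1 : ℝ) := by
    ext1 n; ext1 ω; exact coord_sum _
  rw [this]
  exact EventuallyUI.sum _ fun i _ => (h i).smul_const _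

end UniformIntegrability

/-- Polarisation: uniform integrability and means of products reduce to those of squares. -/
lemma scaledSum_mul_eq {Ω 𝒳 : Type*} {X : ℕ → Ω → 𝒳} {f g : 𝒳 → ℝ} (n : ℕ) (ω : Ω) : scaledSum X f n ω * scaledSum X g n ω
    = (1 / 4) * scaledSum X (fun x => f x + g x) n ω ^ 2
      - (1 / 4) * scaledSum X (fun x => f x - g x) n ω ^ 2 := by
  rw [scaledSum_add, scaledSum_sub]; ring

/-! ### Products of normalised sums -/

namespace IsIIDSample

variable {Ω 𝒳 : Type*} [MeasurableSpace Ω] [MeasurableSpace 𝒳] {X : ℕ → Ω → 𝒳} {f g : 𝒳 → ℝ}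
  {P : Measure Ω} [IsProbabilityMeasure P] {μ : Measure 𝒳} (h : IsIIDSample P X μ)
include h

/-- The squares of normalised sums of independent, centred, square-integrable variables are
uniformly integrable. -/
lemma eventuallyUI_scaledSum_sq (hf : MemLp f 2 μ) (hf0 : ∫ x, f x ∂μ = 0) :
    EventuallyUI P (fun n ω => scaledSum X f n ω ^ 2) := by
  have := h.isProbabilityMeasure
  have hint := h.integrable_scaledSum_sq hf
  have hnorm : ∀ (n : ℕ) (ν : Measure Ω), Integrable (fun ω => scaledSum X f n ω ^ 2) ν →
      eLpNorm (fun ω => scaledSum X f n ω ^ 2) 1 ν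
        = ENNReal.ofReal (∫ ω, scaledSum X f n ω ^ 2 ∂ν) := by
    intro n ν hν
    rw [eLpNorm_one_eq_lintegral_enorm, ← ofReal_integral_norm_eq_lintegral_enorm hν]
    simp
  refine ⟨0, fun n => (hint n).1, fun ε hε => ?_, (∫ x, f x ^ 2 ∂μ).toNNReal, fun n => ?_⟩
  -- Split `f` into a bounded centred `g` and a centred remainder of second moment at most `ε / 4`.
  -- The normalised sums of the remainder have second moment at most `ε / 4` for every `n`, and
  -- those of `g` have fourth moment at most `D`.
  · obtain ⟨g, hg, ⟨M, hM⟩, hg0, hfg⟩ := h.exists_bounded_approx hf hf0 (ε := ε / 4) (by positivity)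
    have hg2 : MemLp g 2 μ := MemLp.of_bound hg.aestronglyMeasurable M (.of_forall hM)
    set D : ℝ := 3 * M ^ 4 with hD
    have hD0 : 0 ≤ D := by rw [hD]; have := (even_two_mul 2).pow_nonneg M; norm_num at this; linarith
    -- With this `lam`, and sets of probability at most `lam * ε / 2`, the three contributions below
    -- are at most `ε / 4`, `ε / 4` and `ε / 2`.
    set lam : ℝ := ε / (8 * (D + 1)) with hlam
    have hlam0 : 0 < lam := by positivity
    have h4 : ∀ n, ∫ ω, scaledSum X g n ω ^ 4 ∂P ≤ D := by
      intro n
      simp only [scaledSum, mul_pow, integral_const_mul]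
      have := h.integral_sampleSum_pow_four_le hg hM hg0 n
      rcases Nat.eq_zero_or_pos n with rfl | hn
      · simpa using hD0
      · have e : (√(n : ℝ))⁻¹ ^ 4 = ((n : ℝ) ^ 2)⁻¹ := by
          rw [inv_pow, show (4 : ℕ) = 2 * 2 by norm_num, pow_mul, Real.sq_sqrt n.cast_nonneg]
        rw [e, inv_mul_le_iff₀ (by positivity), hD]
        linarith
    have h4i : ∀ n, Integrable (fun ω => scaledSum X g n ω ^ 4) P := by
      intro n
      simp only [scaledSum, mul_pow]
      refine Integrable.const_mul ?_ _
      simpa using h.integrable_sampleSum_pow_mul_pow hg hM n 4 0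
    refine ⟨lam * ε / 2, by positivity, fun n s hs hPs => ?_⟩
    have hPs' : P.real s ≤ lam * ε / 2 := ENNReal.toReal_le_of_le_ofReal (by positivity) hPs
    rw [eLpNorm_indicator_eq_eLpNorm_restrict hs, hnorm _ _ (hint _).integrableOn]
    refine ENNReal.ofReal_le_ofReal ?_
    set k := n + 0
    have hd2 : MemLp (fun x => f x - g x) 2 μ := hf.sub hg2
    have hd0 : ∫ x, f x - g x ∂μ = 0 := by
      rw [integral_sub (hf.integrable one_le_two) (hg2.integrable one_le_two), hf0, hg0, sub_zero]
    have hdle := (h.integral_scaledSum_sq_le hd2 hd0 k).trans hfg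
    have hdi := h.integrable_scaledSum_sq hd2 k
    calc ∫ ω in s, scaledSum X f k ω ^ 2 ∂P
        ≤ ∫ ω in s, (2 * (lam * scaledSum X g k ω ^ 4 + 1 / (4 * lam))
            + 2 * scaledSum X (fun x => f x - g x) k ω ^ 2) ∂P := by
          refine setIntegral_mono (hint k).integrableOn
            (((((h4i k).const_mul lam).fun_add (integrable_const _)).const_mul 2).fun_add
              (hdi.const_mul 2)).integrableOn fun ω => ?_
          rw [scaledSum_sub]
          set a := scaledSum X f k ω
          set b := scaledSum X g k ω
          -- Completing the square trades `b ^ 2` for a small multiple of the fourth power plus a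
          -- constant, whose integral over `s` is controlled by the probability of `s`.
          have e1 : b ^ 2 ≤ lam * b ^ 4 + 1 / (4 * lam) := by
            have : lam * b ^ 4 + 1 / (4 * lam) - b ^ 2 = lam * (b ^ 2 - 1 / (2 * lam)) ^ 2 := by
              field_simp
              ring
            have h0 : 0 ≤ lam * (b ^ 2 - 1 / (2 * lam)) ^ 2 := by positivity
            linarith
          have e2 : a ^ 2 ≤ 2 * b ^ 2 + 2 * (a - b) ^ 2 := by nlinarith [sq_nonneg (a - 2 * b)]
          change a ^ 2 ≤ _
          linarith
      _ = 2 * (lam * ∫ ω in s, scaledSum X g k ω ^ 4 ∂P) + 2 * (P.real s * (1 / (4 * lam)))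
            + 2 * ∫ ω in s, scaledSum X (fun x => f x - g x) k ω ^ 2 ∂P := by
          rw [integral_add ((((h4i k).const_mul lam).fun_add
              (integrable_const _)).const_mul 2).integrableOn (hdi.const_mul 2).integrableOn,
            integral_const_mul, integral_add ((h4i k).const_mul lam).integrableOn
              (integrable_const _).integrableOn, integral_const_mul, integral_const_mul,
            integral_const]
          simp [measureReal_restrict_apply]
          ring
      _ ≤ 2 * (lam * D) + 2 * (lam * ε / 2 * (1 / (4 * lam))) + 2 * (ε / 4) := by
          have i1 : ∫ ω in s, scaledSum X g k ω ^ 4 ∂P ≤ D :=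
            (setIntegral_le_integral (h4i k)
              (.of_forall fun ω => (by decide : Even 4).pow_nonneg _)).trans (h4 k)
          have i2 : ∫ ω in s, scaledSum X (fun x => f x - g x) k ω ^ 2 ∂P ≤ ε / 4 :=
            (setIntegral_le_integral hdi (.of_forall fun ω => sq_nonneg _)).trans hdle
          gcongr
      _ ≤ ε := by
          have e1 : lam * D ≤ ε / 8 := by
            rw [hlam, div_mul_eq_mul_div, div_le_div_iff₀ (by positivity) (by positivity)]
            nlinarith
          have e2 : lam * ε / 2 * (1 / (4 * lam)) = ε / 8 := by field_simp; norm_num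
          rw [e2]; linarith
  · rw [hnorm _ _ (hint _), ENNReal.ofReal]
    exact_mod_cast Real.toNNReal_le_toNNReal (h.integral_scaledSum_sq_le hf hf0 _)

lemma eventuallyUI_scaledSum_mul (hf : MemLp f 2 μ) (hf0 : ∫ x, f x ∂μ = 0)
    (hg : MemLp g 2 μ) (hg0 : ∫ x, g x ∂μ = 0) :
    EventuallyUI P (fun n ω => scaledSum X f n ω * scaledSum X g n ω) := by
  have := h.isProbabilityMeasure
  have hfi := hf.integrable one_le_two
  have hgi := hg.integrable one_le_two
  simp only [scaledSum_mul_eq]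
  exact ((h.eventuallyUI_scaledSum_sq (hf.add hg)
    (by simp [integral_add hfi hgi, hf0, hg0])).const_mul _).sub
    ((h.eventuallyUI_scaledSum_sq (hf.sub hg)
    (by simp [integral_sub hfi hgi, hf0, hg0])).const_mul _)

/-- The covariance is exact for each `n > 0`, not merely in the limit, so the mean of the quadratic
term will not depend on `n`. -/
lemma integral_scaledSum_mul (hf : MemLp f 2 μ) (hf0 : ∫ x, f x ∂μ = 0)
    (hg : MemLp g 2 μ) (hg0 : ∫ x, g x ∂μ = 0) {n : ℕ} (hn : 0 < n) :
    Integrable (fun ω => scaledSum X f n ω * scaledSum X g n ω) P ∧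
    ∫ ω, scaledSum X f n ω * scaledSum X g n ω ∂P = ∫ x, f x * g x ∂μ := by
  have := h.isProbabilityMeasure
  have hfi := hf.integrable one_le_two
  have hgi := hg.integrable one_le_two
  have ha : MemLp (fun x => f x + g x) 2 μ := hf.add hg
  have hs : MemLp (fun x => f x - g x) 2 μ := hf.sub hg
  have ha0 : ∫ x, f x + g x ∂μ = 0 := by simp [integral_add hfi hgi, hf0, hg0]
  have hs0 : ∫ x, f x - g x ∂μ = 0 := by simp [integral_sub hfi hgi, hf0, hg0]
  simp only [scaledSum_mul_eq]
  have i1 := (h.integrable_scaledSum_sq ha n).const_mul (1 / 4)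
  have i2 := (h.integrable_scaledSum_sq hs n).const_mul (1 / 4)
  refine ⟨i1.sub i2, ?_⟩
  rw [integral_sub i1 i2, integral_const_mul, integral_const_mul,
    h.integral_scaledSum_sq ha ha0 hn, h.integral_scaledSum_sq hs hs0 hn, ← integral_const_mul,
    ← integral_const_mul, ← integral_sub (ha.integrable_sq.const_mul _)
      (hs.integrable_sq.const_mul _)]
  refine integral_congr_ae (.of_forall fun x => ?_)
  ring

end IsIIDSample

/-! ### Likelihood derivatives and moment identities -/

namespace ParamModel

variable {𝒳 : Type*} [MeasurableSpace 𝒳] {d : ℕ}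

section Law

variable (M : ParamModel 𝒳 d)

lemma isProbabilityMeasure_law {θ : Param d} (hθ : θ ∈ M.Θ) :
    IsProbabilityMeasure (M.law θ) := by
  constructor
  rw [law, withDensity_apply _ MeasurableSet.univ, Measure.restrict_univ, M.lintegral_p θ hθ]

lemma law_absolutelyContinuous (θ : Param d) : M.law θ ≪ M.base :=
  withDensity_absolutelyContinuous _ _

lemma integrable_law_iff {θ : Param d} (hθ : θ ∈ M.Θ) {g : 𝒳 → ℝ} :
    Integrable g (M.law θ) ↔ Integrable (fun x => g x * M.p x θ) M.base := by
  rw [law, integrable_withDensity_iff_integrable_smul' (M.measurable_p θ hθ).ennreal_ofReal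
    (.of_forall fun x => ENNReal.ofReal_lt_top)]
  refine integrable_congr (.of_forall fun x => ?_)
  simp [ENNReal.toReal_ofReal (M.p_nonneg θ hθ x), mul_comm]

lemma integral_law {θ : Param d} (hθ : θ ∈ M.Θ) (g : 𝒳 → ℝ) :
    ∫ x, g x ∂(M.law θ) = ∫ x, g x * M.p x θ ∂M.base := by
  rw [law, integral_withDensity_eq_integral_toReal_smul (M.measurable_p θ hθ).ennreal_ofReal
    (.of_forall fun x => ENNReal.ofReal_lt_top)]
  refine integral_congr_ae (.of_forall fun x => ?_)
  simp [ENNReal.toReal_ofReal (M.p_nonneg θ hθ x), mul_comm]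

/-- The observation `x` has a positive and smooth likelihood on `U`. -/
structure SmoothAt (U : Set (Param d)) (x : 𝒳) : Prop where
  pos : ∀ θ ∈ U, 0 < M.p x θ
  contDiffOn : ContDiffOn ℝ 3 (M.logp x) U

end Law

section Sample

variable {M : ParamModel 𝒳 d} {U : Set (Param d)} {n : ℕ} {x : Fin n → 𝒳}

lemma lik_pos (hx : ∀ m, M.SmoothAt U (x m)) {θ : Param d} (hθ : θ ∈ U) : 0 < M.lik n x θ :=
  Finset.prod_pos fun m _ => (hx m).pos θ hθ

lemma logLik_eqOn (hx : ∀ m, M.SmoothAt U (x m)) :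
    Set.EqOn (M.logLik n x) (fun θ => ∑ m, M.logp (x m) θ) U := fun θ hθ =>
  Real.log_prod fun m _ => ((hx m).pos θ hθ).ne'

lemma contDiffOn_logLik (hx : ∀ m, M.SmoothAt U (x m)) : ContDiffOn ℝ 3 (M.logLik n x) U :=
  (ContDiffOn.sum fun m _ => (hx m).contDiffOn).congr (logLik_eqOn hx)

variable (hU : IsOpen U)
include hU

lemma pd_logLik_eqOn (hx : ∀ m, M.SmoothAt U (x m)) (i : Fin d) :
    Set.EqOn (pd i (M.logLik n x)) (fun θ => ∑ m, pd i (M.logp (x m)) θ) U := fun θ hθ => by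
  rw [pd_eqOn hU (logLik_eqOn hx) i hθ, pd_sum]
  exact fun m _ => differentiableAt_of_contDiffOn hU (hx m).contDiffOn (by norm_num) hθ

lemma pd_pd_logLik_eqOn (hx : ∀ m, M.SmoothAt U (x m)) (i j : Fin d) :
    Set.EqOn (pd i (pd j (M.logLik n x))) (fun θ => ∑ m, pd i (pd j (M.logp (x m))) θ) U :=
  fun θ hθ => by
  rw [pd_eqOn hU (pd_logLik_eqOn hU hx j) i hθ, pd_sum]
  exact fun m _ => differentiableAt_of_contDiffOn hU
    (contDiffOn_pd hU (m := 2) (hx m).contDiffOn (by norm_num) j) (by norm_num) hθ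

lemma pd_pd_pd_logLik_eqOn (hx : ∀ m, M.SmoothAt U (x m)) (i j l : Fin d) :
    Set.EqOn (pd i (pd j (pd l (M.logLik n x))))
      (fun θ => ∑ m, pd i (pd j (pd l (M.logp (x m)))) θ) U :=
  fun θ hθ => by
  rw [pd_eqOn hU (pd_pd_logLik_eqOn hU hx j l) i hθ, pd_sum]
  exact fun m _ => differentiableAt_of_contDiffOn hU
    (contDiffOn_pd hU (m := 1) (contDiffOn_pd hU (m := 2) (hx m).contDiffOn
      (by norm_num) l) (by norm_num) j) (by norm_num) hθ

/-- On `U` the density is the exponential of its logarithm, so the smoothness assumed of `log p`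
passes to `p`. -/
lemma SmoothAt.pd_p {x : 𝒳} (hx : M.SmoothAt U x) {θ : Param d} (hθ : θ ∈ U) (l : Fin d) :
    DifferentiableAt ℝ (M.p x) θ ∧ pd l (M.p x) θ = M.p x θ * pd l (M.logp x) θ := by
  have hd : DifferentiableAt ℝ (M.logp x) θ :=
    differentiableAt_of_contDiffOn hU hx.contDiffOn (by norm_num) hθ
  have heq : Set.EqOn (M.p x) (fun t => Real.exp (M.logp x t)) U := fun t ht =>
    (Real.exp_log (hx.pos t ht)).symm
  have hev := heq.eventuallyEq_of_mem (hU.mem_nhds hθ)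
  refine ⟨hd.exp.congr_of_eventuallyEq hev, ?_⟩
  rw [pd_congr_of_eventuallyEq hev, pd_exp hd]
  simp only [heq hθ]

lemma SmoothAt.pd_mul_p {x : 𝒳} (hx : M.SmoothAt U x) {θ : Param d} (hθ : θ ∈ U) (l : Fin d)
    {g : Param d → ℝ} (hg : DifferentiableAt ℝ g θ) :
    pd l (fun t => g t * M.p x t) θ
      = (pd l g θ + g θ * pd l (M.logp x) θ) * M.p x θ := by
  obtain ⟨hd, hp⟩ := hx.pd_p hU hθ l
  rw [pd_mul hg hd, hp]; ring

lemma SmoothAt.differentiableAt_pd {x : 𝒳} (hx : M.SmoothAt U x) {θ : Param d} (hθ : θ ∈ U)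
    (i : Fin d) : DifferentiableAt ℝ (pd i (M.logp x)) θ :=
  differentiableAt_of_contDiffOn hU
    (contDiffOn_pd hU (m := 2) hx.contDiffOn (by norm_num) i) (by norm_num) hθ

lemma SmoothAt.contDiffOn_pd_pd {x : 𝒳} (hx : M.SmoothAt U x) (i j : Fin d) :
    ContDiffOn ℝ 1 (pd i (pd j (M.logp x))) U :=
  contDiffOn_pd hU (contDiffOn_pd hU (m := 2) hx.contDiffOn (by norm_num) j) (by norm_num) i

lemma SmoothAt.differentiableAt_pd_pd {x : 𝒳} (hx : M.SmoothAt U x) {θ : Param d} (hθ : θ ∈ U)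
    (i j : Fin d) : DifferentiableAt ℝ (pd i (pd j (M.logp x))) θ :=
  differentiableAt_of_contDiffOn hU (hx.contDiffOn_pd_pd hU i j) (by norm_num) hθ

end Sample

namespace Regular

variable {M : ParamModel 𝒳 d} {θ₀ : Param d} {U : Set (Param d)} (hreg : M.Regular θ₀ U)
include hreg

lemma mem_Θ : θ₀ ∈ M.Θ := hreg.subset hreg.mem

lemma ae_smoothAt : ∀ᵐ x ∂M.base, M.SmoothAt U x := by
  filter_upwards [hreg.pos, hreg.contDiffOn] with x h1 h2 using ⟨h1, h2⟩

lemma ae_smoothAt_law (θ : Param d) : ∀ᵐ x ∂M.law θ, M.SmoothAt U x :=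
  (M.law_absolutelyContinuous θ).ae_le hreg.ae_smoothAt

lemma ae_smoothAt_lawN {θ : Param d} (hθ : θ ∈ U) (n : ℕ) :
    ∀ᵐ x ∂M.lawN n θ, ∀ m, M.SmoothAt U (x m) := by
  have := M.isProbabilityMeasure_law (hreg.subset hθ)
  rw [ae_all_iff]
  intro m
  exact (measurePreserving_eval (fun _ => M.law θ) m).quasiMeasurePreserving.ae
    (hreg.ae_smoothAt_law θ)

/-- The expectation of a sum of a statistic over a sample. -/
lemma integral_lawN_sum {θ : Param d} (hθ : θ ∈ U) (n : ℕ) {g : 𝒳 → ℝ}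
    (hg : Integrable g (M.law θ)) :
    ∫ x, ∑ m, g (x m) ∂M.lawN n θ = n * ∫ x, g x ∂M.law θ := by
  have := M.isProbabilityMeasure_law (hreg.subset hθ)
  have hmp := fun m : Fin n => measurePreserving_eval (fun _ => M.law θ) m
  have hi : ∀ m : Fin n, Integrable (fun x => g (x m)) (M.lawN n θ) := fun m =>
    (hmp m).integrable_comp_of_integrable hg
  rw [integral_finsetSum _ fun m _ => hi m]
  have : ∀ m : Fin n, ∫ x, g (x m) ∂M.lawN n θ = ∫ x, g x ∂M.law θ := fun m => by
    have hg' := hg.1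
    rw [← (hmp m).map_eq] at hg'
    conv_rhs => rw [← (hmp m).map_eq, integral_map (hmp m).measurable.aemeasurable hg']
    rfl
  simp [this]

/-- Divide by the density, which is almost everywhere positive on `U`. Measurability is obtained for
the dominating measure, so a statistic integrable under `θ` is also usable under `θ₀`. -/
lemma aestronglyMeasurable_of_mul {θ : Param d} (hθ : θ ∈ U) {g : 𝒳 → ℝ}
    (hg : AEStronglyMeasurable (fun x => g x * M.p x θ) M.base) :
    AEStronglyMeasurable g M.base := by
  have hp := (M.measurable_p θ (hreg.subset hθ)).inv.aestronglyMeasurable (μ := M.base)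
  refine (hg.mul hp).congr ?_
  filter_upwards [hreg.pos] with x hx
  have := (hx θ hθ).ne'
  simp [this]


lemma pd_mul_p_ae {θ : Param d} (hθ : θ ∈ U) (l : Fin d) {g : 𝒳 → Param d → ℝ}
    (hg : ∀ x, M.SmoothAt U x → DifferentiableAt ℝ (g x) θ) :
    (fun x => pd l (fun t => g x t * M.p x t) θ) =ᵐ[M.base]
      fun x => (pd l (g x) θ + g x θ * pd l (M.logp x) θ) * M.p x θ := by
  filter_upwards [hreg.ae_smoothAt] with x hx using hx.pd_mul_p hreg.isOpen hθ l (hg x hx)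

/-- Differentiation of an expectation under the integral sign, in terms of the score. -/
lemma pd_integral_law {θ : Param d} (hθ : θ ∈ U) (l : Fin d) {g : 𝒳 → Param d → ℝ}
    (hg : ∀ x, M.SmoothAt U x → DifferentiableAt ℝ (g x) θ)
    (hI : M.Interchange g θ) :
    Integrable (fun x => g x θ) (M.law θ) ∧
    Integrable (fun x => pd l (g x) θ + g x θ * pd l (M.logp x) θ) (M.law θ) ∧
    pd l (fun t => ∫ x, g x t ∂M.law t) θ
      = ∫ x, (pd l (g x) θ + g x θ * pd l (M.logp x) θ) ∂M.law θ := by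
  have hΘ := hreg.subset hθ
  have hae := hreg.pd_mul_p_ae hθ l hg
  refine ⟨(M.integrable_law_iff hΘ).2 hI.integrable,
    (M.integrable_law_iff hΘ).2 ((hI.integrable_pd l).congr hae), ?_⟩
  rw [M.integral_law hΘ, ← integral_congr_ae hae, ← hI.pd_integral l]
  refine pd_eqOn hreg.isOpen (fun t ht => ?_) l hθ
  exact M.integral_law (hreg.subset ht) _

/-- The total mass of the density is constantly `1` on `U`; differentiate it under the integral
sign. -/
lemma integral_score {θ : Param d} (hθ : θ ∈ U) (i : Fin d) :
    ∫ x, pd i (M.logp x) θ ∂M.law θ = 0 := by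
  have := (hreg.pd_integral_law hθ i (g := fun _ _ => 1) (fun x _ => differentiableAt_const _)
    (hreg.interchange_one θ hθ)).2.2
  simp only [pd_const, zero_add, one_mul] at this
  rw [← this]
  rw [pd_eqOn hreg.isOpen (f := fun t => ∫ _, (1 : ℝ) ∂M.law t) (g := fun _ => 1)
    (fun t ht => ?_) i hθ, pd_const]
  have := M.isProbabilityMeasure_law (hreg.subset ht)
  simp

lemma integrable_score {θ : Param d} (hθ : θ ∈ U) (i : Fin d) :
    Integrable (fun x => pd i (M.logp x) θ) (M.law θ) := by
  simpa [pd_const] using (hreg.pd_integral_law hθ i (g := fun _ _ => 1)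
    (fun x _ => differentiableAt_const _) (hreg.interchange_one θ hθ)).2.1

lemma integrable_hess {θ : Param d} (hθ : θ ∈ U) (i j : Fin d) :
    Integrable (fun x => pd i (pd j (M.logp x)) θ) (M.law θ) :=
  (hreg.pd_integral_law hθ i
    (fun _ hx => hx.differentiableAt_pd_pd hreg.isOpen hθ i j)
    (hreg.interchange_three θ hθ i j)).1

/-- Differentiating the mean score under the integral makes Hessian plus product of scores
integrable, and the Hessian itself is integrable. Second moments of the score therefore need no
separate assumption. -/
lemma integrable_score_mul {θ : Param d} (hθ : θ ∈ U) (i j : Fin d) :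
    Integrable (fun x => pd i (M.logp x) θ * pd j (M.logp x) θ) (M.law θ) := by
  have := (hreg.pd_integral_law hθ j (fun x hx => hx.differentiableAt_pd hreg.isOpen hθ i)
    (hreg.interchange_two θ hθ i)).2.1
  refine (this.sub (hreg.integrable_hess hθ j i)).congr (.of_forall fun x => ?_)
  simp

/-- The information identity. -/
lemma integral_hess {θ : Param d} (hθ : θ ∈ U) (i j : Fin d) :
    ∫ x, pd i (pd j (M.logp x)) θ ∂M.law θ = -M.fisher θ i j := by
  have h := (hreg.pd_integral_law hθ i (fun x hx => hx.differentiableAt_pd hreg.isOpen hθ j)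
    (hreg.interchange_two θ hθ j)).2.2
  -- The mean score vanishes identically on `U`, so its derivative is zero.
  rw [integral_add (hreg.integrable_hess hθ i j) (hreg.integrable_score_mul hθ j i),
    pd_eqOn hreg.isOpen (g := fun _ => 0) (fun t ht => hreg.integral_score ht j) i hθ,
    pd_const] at h
  have e : M.fisher θ i j = ∫ x, pd j (M.logp x) θ * pd i (M.logp x) θ ∂M.law θ := by
    simp [fisher, mul_comm]
  linarith

lemma memLp_score (i : Fin d) : MemLp (fun x => pd i (M.logp x) θ₀) 2 (M.law θ₀) := by
  rw [memLp_two_iff_integrable_sq (hreg.integrable_score hreg.mem i).1]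
  simpa [sq] using hreg.integrable_score_mul hreg.mem i i

lemma memLp_hess (i j : Fin d) : MemLp (fun x => pd i (pd j (M.logp x)) θ₀) 2 (M.law θ₀) := by
  rw [memLp_two_iff_integrable_sq (hreg.integrable_hess hreg.mem i j).1]
  exact hreg.second_moment i j

lemma aestronglyMeasurable_score {θ : Param d} (hθ : θ ∈ U) (i : Fin d) :
    AEStronglyMeasurable (fun x => pd i (M.logp x) θ) M.base :=
  hreg.aestronglyMeasurable_of_mul hθ
    ((M.integrable_law_iff (hreg.subset hθ)).1 (hreg.integrable_score hθ i)).1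

lemma aestronglyMeasurable_hess {θ : Param d} (hθ : θ ∈ U) (i j : Fin d) :
    AEStronglyMeasurable (fun x => pd i (pd j (M.logp x)) θ) M.base :=
  hreg.aestronglyMeasurable_of_mul hθ
    ((M.integrable_law_iff (hreg.subset hθ)).1 (hreg.integrable_hess hθ i j)).1

/-- Interchange for the Hessian gives measurability of the third derivative plus Hessian times
score; subtract the product. It is needed at every `θ ∈ U` because a supremum over parameters near
`θ₀` is taken later. -/
lemma aestronglyMeasurable_third {θ : Param d} (hθ : θ ∈ U) (i j l : Fin d) :
    AEStronglyMeasurable (fun x => pd i (pd j (pd l (M.logp x))) θ) M.base := by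
  have h1 := hreg.aestronglyMeasurable_of_mul hθ
    ((M.integrable_law_iff (hreg.subset hθ)).1 (hreg.pd_integral_law hθ i
      (fun x hx => hx.differentiableAt_pd_pd hreg.isOpen hθ j l)
      (hreg.interchange_three θ hθ j l)).2.1).1
  refine (h1.sub ((hreg.aestronglyMeasurable_hess hθ j l).mul
    (hreg.aestronglyMeasurable_score hθ i))).congr (.of_forall fun x => ?_)
  simp

lemma integrable_third (i j l : Fin d) :
    Integrable (fun x => pd i (pd j (pd l (M.logp x))) θ₀) (M.law θ₀) := by
  obtain ⟨B, hB, hle⟩ := hreg.third_bound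
  refine hB.mono' ((hreg.aestronglyMeasurable_third hreg.mem i j l).mono_ac
    (M.law_absolutelyContinuous θ₀)) ?_
  filter_upwards [(M.law_absolutelyContinuous θ₀).ae_le hle] with x hx using hx θ₀ hreg.mem i j l

lemma integrable_hess_mul_score (i j l : Fin d) :
    Integrable (fun x => pd i (pd j (M.logp x)) θ₀ * pd l (M.logp x) θ₀) (M.law θ₀) :=
  (hreg.memLp_hess i j).integrable_mul (hreg.memLp_score l)

lemma kappa2_eq {θ : Param d} (hθ : θ ∈ U) (n : ℕ) (i j : Fin d) :
    M.kappa2 n i j θ = n * ∫ x, pd i (pd j (M.logp x)) θ ∂M.law θ := by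
  rw [← hreg.integral_lawN_sum hθ n (hreg.integrable_hess hθ i j)]
  refine integral_congr_ae ?_
  filter_upwards [hreg.ae_smoothAt_lawN hθ n] with x hx
    using pd_pd_logLik_eqOn hreg.isOpen hx i j hθ

lemma kappa3_eq (n : ℕ) (i j l : Fin d) :
    M.kappa3 n i j l θ₀ = n * ∫ x, pd i (pd j (pd l (M.logp x))) θ₀ ∂M.law θ₀ := by
  rw [← hreg.integral_lawN_sum hreg.mem n (hreg.integrable_third i j l)]
  refine integral_congr_ae ?_
  filter_upwards [hreg.ae_smoothAt_lawN hreg.mem n] with x hx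
    using pd_pd_pd_logLik_eqOn hreg.isOpen hx i j l hreg.mem

lemma K_eq (n : ℕ) : M.K n θ₀ = (n : ℝ) • M.fisher θ₀ := by
  ext i j
  simp [K, hreg.kappa2_eq hreg.mem, hreg.integral_hess hreg.mem]

/-- The entries of the Cox–Snell matrix in terms of joint moments of log-likelihood
derivatives of one observation. -/
lemma coxSnell_eq (n : ℕ) (i j l : Fin d) :
    M.coxSnell n θ₀ i (l, j) = n * (∫ x, pd j (pd i (M.logp x)) θ₀ * pd l (M.logp x) θ₀ ∂M.law θ₀
      + (1 / 2) * ∫ x, pd j (pd l (pd i (M.logp x))) θ₀ ∂M.law θ₀) := by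
  have hI := hreg.pd_integral_law hreg.mem l
    (fun x hx => hx.differentiableAt_pd_pd hreg.isOpen hreg.mem i j)
    (hreg.interchange_three θ₀ hreg.mem i j)
  have hsymm : ∀ a b c : Fin d,
      (fun x => pd a (pd b (pd c (M.logp x))) θ₀) =ᵐ[M.law θ₀]
        fun x => pd b (pd c (pd a (M.logp x))) θ₀ := fun a b c => by
    filter_upwards [hreg.ae_smoothAt_law θ₀] with x hx
      using pd_pd_comm_left hreg.isOpen hx.contDiffOn hreg.mem b c a
  have hcomm : (fun x => pd j (pd i (M.logp x)) θ₀ * pd l (M.logp x) θ₀) =ᵐ[M.law θ₀]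
      fun x => pd i (pd j (M.logp x)) θ₀ * pd l (M.logp x) θ₀ := by
    filter_upwards [hreg.ae_smoothAt_law θ₀] with x hx
    rw [pd_comm hreg.isOpen (hx.contDiffOn.of_le (by norm_num)) hreg.mem j i]
  -- The product rule for an expectation: both the statistic and the density depend on `θ`. After
  -- subtraction of half of `κ_ijl`, half of the mean third derivative remains.
  have h1 : pd l (M.kappa2 n i j) θ₀
      = n * (∫ x, pd i (pd j (pd l (M.logp x))) θ₀ ∂M.law θ₀
          + ∫ x, pd i (pd j (M.logp x)) θ₀ * pd l (M.logp x) θ₀ ∂M.law θ₀) := by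
    have hd : DifferentiableAt ℝ (fun t => ∫ x, pd i (pd j (M.logp x)) t ∂M.law t) θ₀ := by
      refine (hreg.interchange_three θ₀ hreg.mem i j).differentiableAt.congr_of_eventuallyEq ?_
      filter_upwards [hreg.isOpen.mem_nhds hreg.mem] with t ht
      exact M.integral_law (hreg.subset ht) _
    rw [pd_eqOn hreg.isOpen (fun t ht => hreg.kappa2_eq ht n i j) l hreg.mem, pd_const_mul hd,
      hI.2.2, integral_add (hreg.integrable_third l i j) (hreg.integrable_hess_mul_score i j l),
      integral_congr_ae (hsymm l i j)]
  simp only [coxSnell, Matrix.of_apply]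
  rw [h1, hreg.kappa3_eq, integral_congr_ae hcomm, integral_congr_ae (hsymm i j l)]
  ring

end Regular

end ParamModel

/-! ### Stationarity and the expansion of the Wallace–Freeman estimator -/

namespace ParamModel

variable {𝒳 : Type*} [MeasurableSpace 𝒳] {d : ℕ} {M : ParamModel 𝒳 d} {θ₀ : Param d}
  {U : Set (Param d)} {prior : Param d → ℝ}

lemma IsMLE.gradient_eq_zero (hU : IsOpen U) (hUΘ : U ⊆ M.Θ) {n : ℕ} {x : Fin n → 𝒳}
    (hx : ∀ m, M.SmoothAt U (x m)) {θ : Param d} (hθ : θ ∈ U) (h : M.IsMLE n x θ) :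
    gradient (M.logLik n x) θ = 0 := by
  refine gradient_eq_zero_of_isLocalMax ?_
  filter_upwards [hU.mem_nhds hθ] with t ht
  exact Real.log_le_log (lik_pos hx ht) (h.2 (hUΘ ht))

/-- Near `θ` the codelength is finite and differentiable, so a minimiser is a critical point of `-ℓ
- log π + ½ log |I|`. -/
lemma IsMML.gradient_eq (hU : IsOpen U) (hUΘ : U ⊆ M.Θ) (hpen : M.RegularPenalty prior U)
    {n : ℕ} {x : Fin n → 𝒳} (hx : ∀ m, M.SmoothAt U (x m)) {θ : Param d} (hθ : θ ∈ U)
    (h : M.IsMML prior n x θ) :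
    gradient (M.logLik n x) θ = -M.a prior θ := by
  set f : Param d → ℝ := fun t => (1 / 2) * Real.log (M.fisher t).det
    - M.logLik n x t - Real.log (prior t) with hf
  have hcode : ∀ t ∈ U, M.codelength prior n x t = (f t : EReal) := fun t ht => by
    rw [codelength, if_pos ⟨hpen.prior_pos t ht, lik_pos hx ht⟩]
    congr 1
    simp only [hf]; ring
  have hmin : IsLocalMin f θ := by
    filter_upwards [hU.mem_nhds hθ] with t ht
    have := h.2 (hUΘ ht)
    simp only [Set.mem_ofPred_eq] at this
    rw [hcode t ht, hcode θ hθ] at this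
    exact_mod_cast this
  have hg := gradient_eq_zero_of_isLocalMin hmin
  have d1 : DifferentiableAt ℝ (fun t => Real.log (M.fisher t).det) θ :=
    hpen.log_det.differentiableAt (hU.mem_nhds hθ)
  have d2 : DifferentiableAt ℝ (M.logLik n x) θ :=
    differentiableAt_of_contDiffOn hU (contDiffOn_logLik hx) (by norm_num) hθ
  have d3 : DifferentiableAt ℝ (fun t => Real.log (prior t)) θ :=
    hpen.log_prior.differentiableAt (hU.mem_nhds hθ)
  ext i
  have hi := congrArg (fun v : Param d => v i) hg
  simp only [gradient_apply, hf] at hi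
  rw [pd_sub ((d1.const_mul _).fun_sub d2) d3, pd_sub (d1.const_mul _) d2, pd_const_mul d1] at hi
  simp only [a, PiLp.neg_apply, PiLp.sub_apply, PiLp.smul_apply, gradient_apply, smul_eq_mul,
    PiLp.zero_apply] at hi ⊢
  linarith

namespace Regular

variable (hreg : M.Regular θ₀ U)
include hreg

lemma det_fisher_ne_zero (hK : ∀ n, 0 < n → (M.K n θ₀).det ≠ 0) : (M.fisher θ₀).det ≠ 0 := by
  simpa [hreg.K_eq] using hK 1 one_pos

lemma inv_K (hK : ∀ n, 0 < n → (M.K n θ₀).det ≠ 0) {n : ℕ} (hn : 0 < n) :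
    (M.K n θ₀)⁻¹ = (n : ℝ)⁻¹ • (M.fisher θ₀)⁻¹ := by
  have hn' : (n : ℝ) ≠ 0 := by positivity
  refine Matrix.inv_eq_right_inv ?_
  rw [hreg.K_eq, Matrix.smul_mul, Matrix.mul_smul, smul_smul, mul_inv_cancel₀ hn', one_smul,
    Matrix.mul_nonsing_inv _ (hreg.det_fisher_ne_zero hK).isUnit]

lemma smul_matVec_inv_K (hK : ∀ n, 0 < n → (M.K n θ₀).det ≠ 0) {n : ℕ} (hn : 0 < n)
    (v : Param d) : (n : ℝ) • matVec (M.K n θ₀)⁻¹ v = matVec (M.fisher θ₀)⁻¹ v := by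
  have hn' : (n : ℝ) ≠ 0 := by positivity
  rw [hreg.inv_K hK hn, smul_matVec, smul_smul, mul_inv_cancel₀ hn', one_smul]

variable {Ω : Type*} [MeasurableSpace Ω] {P : Measure Ω} {X : ℕ → Ω → 𝒳}

lemma ae_smoothAt_sample (hX : IsIIDSample P X (M.law θ₀)) :
    ∀ᵐ ω ∂P, ∀ m, M.SmoothAt U (X m ω) := by
  rw [ae_all_iff]
  exact fun m => (hX.measurePreserving m).quasiMeasurePreserving.ae (hreg.ae_smoothAt_law θ₀)

end Regular

lemma eventually_natCast_mul_one_div :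
    ∀ᶠ n : ℕ in atTop, 0 < (n : ℝ) ∧ (n : ℝ) * (1 / n) = 1 := by
  filter_upwards [eventually_gt_atTop 0] with n hn
  have : (0 : ℝ) < n := by positivity
  exact ⟨this, by field_simp⟩

lemma eventually_sqrt_mul_one_div :
    ∀ᶠ n : ℕ in atTop, 0 < √(n : ℝ) ∧ √(n : ℝ) * (1 / √n) = 1 := by
  filter_upwards [eventually_gt_atTop 0] with n hn
  have : (0 : ℝ) < √n := by positivity
  exact ⟨this, by field_simp⟩

lemma tendsto_inv_sqrt_natCast : Tendsto (fun n : ℕ => (√(n : ℝ))⁻¹) atTop (𝓝 0) :=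
  tendsto_inv_atTop_zero.comp (Real.tendsto_sqrt_atTop.comp tendsto_natCast_atTop_atTop)

section Expansion

variable {Ω : Type*} [MeasurableSpace Ω] {P : Measure Ω} {F : Type*} [NormedAddCommGroup F]

lemma withProbTendingToOne_mem {Y : ℕ → Ω → F} {y : F} {V : Set F}
    (h : IsLittleOp P (fun n ω => Y n ω - y) (fun _ => 1)) (hV : V ∈ 𝓝 y) :
    WithProbTendingToOne P fun n ω => Y n ω ∈ V := by
  obtain ⟨ε, hε, hb⟩ := Metric.mem_nhds_iff.1 hV
  refine (h.norm_le (half_pos hε)).mono' fun n ω hω => hb ?_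
  rw [Metric.mem_ball, dist_eq_norm]; linarith

variable [NormedSpace ℝ F]

lemma isLittleOp_one_of_isBigOp_inv_sqrt {Y : ℕ → Ω → F}
    (h : IsBigOp P Y (fun n => 1 / √(n : ℝ))) : IsLittleOp P Y (fun _ => 1) := by
  refine (((isBigOp_smul_iff eventually_sqrt_mul_one_div).2 h).isLittleOp_smul
    tendsto_inv_sqrt_natCast).congr' (.of_ae ?_)
  filter_upwards [eventually_sqrt_mul_one_div] with n hn
  refine .of_forall fun ω => ?_
  rw [smul_smul, inv_mul_cancel₀ hn.1.ne', one_smul]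

variable {X : ℕ → Ω → 𝒳}

/-- The stochastic expansion of the Wallace–Freeman estimator about the maximum likelihood
estimator. -/
theorem isLittleOp_mml_sub_mle (hreg : M.Regular θ₀ U) (hX : IsIIDSample P X (M.law θ₀))
    {mle mml : (n : ℕ) → (Fin n → 𝒳) → Param d} {sample : (n : ℕ) → Ω → Fin n → 𝒳}
    (hsample : sample = fun n ω (i : Fin n) => X i ω)
    (hmle : WithProbTendingToOne P fun n ω => M.IsMLE n (sample n ω) (mle n (sample n ω)))
    (hmml : WithProbTendingToOne P fun n ω =>
      M.IsMML prior n (sample n ω) (mml n (sample n ω)))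
    (hobs : ∀ i j, IsBigOp P
      (fun n ω => -hessian (M.logLik n (sample n ω)) (mle n (sample n ω)) i j - M.K n θ₀ i j)
      (fun n => Real.sqrt n))
    (hK : ∀ n, 0 < n → (M.K n θ₀).det ≠ 0)
    (hroot : IsBigOp P (fun n ω => mle n (sample n ω) - θ₀) (fun n => 1 / Real.sqrt n))
    (hpen : M.RegularPenalty prior U)
    {C : Set (Param d)} (hC : IsCompact C) (hCU : C ⊆ U)
    (hmmlC : WithProbTendingToOne P fun n ω => mml n (sample n ω) ∈ C)
    (hrem : IsLittleOp P
      (fun n ω => matVec (M.K n θ₀)⁻¹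
        (M.scoreRemainder n (sample n ω) (mle n (sample n ω)) (mml n (sample n ω))))
      (fun n => 1 / (n : ℝ))) :
    IsLittleOp P
      (fun n ω => (n : ℝ) • (mml n (sample n ω) - mle n (sample n ω))
        - matVec (M.fisher θ₀)⁻¹ (M.a prior θ₀)) (fun _ => 1) := by
  set G := (M.fisher θ₀)⁻¹ with hG
  set D : ℕ → Ω → Param d := fun n ω => (n : ℝ) • (mml n (sample n ω) - mle n (sample n ω)) with hD
  set R : ℕ → Ω → Param d := fun n ω =>
    matVec G (M.scoreRemainder n (sample n ω) (mle n (sample n ω)) (mml n (sample n ω))) with hR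
  -- The error of the observed information per observation. It is `O_p(n^{-1/2})`, since the assumed
  -- `O_p(√n)` bound is divided by `n`.
  set B : ℕ → Ω → Matrix (Fin d) (Fin d) ℝ := fun n ω =>
    (n : ℝ)⁻¹ • (-hessian (M.logLik n (sample n ω)) (mle n (sample n ω))) - M.fisher θ₀ with hB
  have hdet := hreg.det_fisher_ne_zero hK
  have hGF : G * M.fisher θ₀ = 1 := Matrix.nonsing_inv_mul _ hdet.isUnit
  have hpos : ∀ᶠ n : ℕ in atTop, 0 < n := eventually_gt_atTop 0
  have hmleθ : IsLittleOp P (fun n ω => mle n (sample n ω) - θ₀) (fun _ => 1) :=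
    isLittleOp_one_of_isBigOp_inv_sqrt hroot
  have hmleU := withProbTendingToOne_mem hmleθ (hreg.isOpen.mem_nhds hreg.mem)
  have hR0 : IsLittleOp P R (fun _ => 1) := by
    refine ((isLittleOp_smul_iff eventually_natCast_mul_one_div).2 hrem).congr' (.of_ae ?_)
    filter_upwards [hpos] with n hn
    refine .of_forall fun ω => ?_
    rw [hreg.smul_matVec_inv_K hK hn]
  have hB0 : IsLittleOp P (fun n ω => ∑ i, ∑ j, |B n ω i j|) (fun _ => 1) := by
    refine .sum _ (fun _ => zero_le_one) fun i _ => .sum _ (fun _ => zero_le_one) fun j _ => ?_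
    have h1 : IsBigOp P (fun n ω => (√(n : ℝ))⁻¹ •
        (-hessian (M.logLik n (sample n ω)) (mle n (sample n ω)) i j - M.K n θ₀ i j))
        (fun _ => 1) := by
      refine (isBigOp_smul_iff ?_).2 (hobs i j)
      filter_upwards [hpos] with n hn
      have : (0 : ℝ) < √n := by positivity
      exact ⟨by positivity, by field_simp⟩
    refine (h1.isLittleOp_smul tendsto_inv_sqrt_natCast).of_le (.of_ae ?_)
    filter_upwards [hpos] with n hn
    refine .of_forall fun ω => ?_
    have hn' : (n : ℝ) ≠ 0 := by positivity
    rw [smul_smul, ← mul_inv, Real.mul_self_sqrt n.cast_nonneg, hreg.K_eq]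
    simp only [Real.norm_eq_abs, abs_abs, hB]
    refine le_of_eq (congrArg _ ?_)
    simp only [Matrix.sub_apply, Matrix.smul_apply, Matrix.neg_apply, smul_eq_mul]
    field_simp
  -- A fixed-point equation for `D`: the Taylor expansion of the score with the two stationarity
  -- conditions inserted, solved for the term with the expected information.
  have hkey : WithProbTendingToOne P fun n ω => mml n (sample n ω) ∈ C ∧
      D n ω = matVec G (M.a prior (mml n (sample n ω))) + R n ω
        - matVec G (matVec (B n ω) (D n ω)) := by
    refine ((((hmle.and hmml).and hmleU).and hmmlC).and (.of_ae (E := fun n ω =>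
      ∀ m, M.SmoothAt U (sample n ω m)) (.of_forall fun n => ?_))).mono ?_
    · filter_upwards [hreg.ae_smoothAt_sample hX] with ω hω
      rw [hsample]
      exact fun m => hω m
    filter_upwards [hpos] with n hn
    refine .of_forall fun ω ⟨⟨⟨⟨h1, h2⟩, h3⟩, h4⟩, h5⟩ => ⟨h4, ?_⟩
    have hn' : (n : ℝ) ≠ 0 := by positivity
    have e1 := h1.gradient_eq_zero hreg.isOpen hreg.subset h5 h3
    have e2 := h2.gradient_eq hreg.isOpen hreg.subset hpen h5 (hCU h4)
    set H := hessian (M.logLik n (sample n ω)) (mle n (sample n ω))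
    have e3 : matVec (B n ω) (D n ω) = -matVec H (mml n (sample n ω) - mle n (sample n ω))
        - matVec (M.fisher θ₀) (D n ω) := by
      simp only [hB, hD]
      rw [sub_matVec, matVec_smul, smul_matVec, smul_smul, mul_inv_cancel₀ hn', one_smul]
      rw [neg_matVec]
    have e4 : R n ω = matVec G (-M.a prior (mml n (sample n ω))
        - matVec H (mml n (sample n ω) - mle n (sample n ω))) := by
      simp only [hR, scoreRemainder]
      rw [e1, e2, sub_zero]
    rw [e3, e4, ← matVec_add, ← matVec_sub]
    conv_lhs => rw [← one_matVec (D n ω), ← hGF, matVec_mul]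
    congr 1
    abel
  obtain ⟨c, hc⟩ := hC.exists_bound_of_continuousOn
    (hpen.contDiffOn_a.continuousOn.mono hCU)
  have hGB : IsLittleOp P (fun n ω => (∑ i, ∑ j, |G i j|) * ∑ i, ∑ j, |B n ω i j|)
      (fun _ => 1) := by
    simpa only [mul_comm] using hB0.mul (isBigOp_const (∑ i, ∑ j, |G i j|))
  have hGBD : ∀ n ω, ‖matVec G (matVec (B n ω) (D n ω))‖
      ≤ ((∑ i, ∑ j, |G i j|) * ∑ i, ∑ j, |B n ω i j|) * ‖D n ω‖ := fun n ω => by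
    refine (norm_matVec_le _ _).trans ?_
    rw [mul_assoc]
    exact mul_le_mul_of_nonneg_left (norm_matVec_le _ _) (by positivity)
  -- Consistency of the Wallace–Freeman estimator is not yet known; only the bound `c` for `a` on
  -- `C` is used. Where `G B` has norm at most `1/2`, its term is absorbed into the left side,
  -- whence the factor `2`.
  have hDO : IsBigOp P D (fun _ => 1) := by
    have h1 : IsBigOp P (fun n ω => 2 * ((∑ i, ∑ j, |G i j|) * c + ‖R n ω‖)) (fun _ => 1) := by
      refine (isBigOp_const (2 : ℝ)).mul ((isBigOp_const _).add (hR0.isBigOp.of_le ?_))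
      exact .of_ae (.of_forall fun n => .of_forall fun ω => by simp)
    refine h1.of_le ((hkey.and (hGB.norm_le (ε := 1 / 2) (by norm_num))).mono'
      fun n ω ⟨⟨h4, h5⟩, h6⟩ => ?_)
    refine le_trans ?_ (le_abs_self _)
    have i1 : ‖matVec G (M.a prior (mml n (sample n ω)))‖ ≤ (∑ i, ∑ j, |G i j|) * c :=
      (norm_matVec_le _ _).trans (mul_le_mul_of_nonneg_left (hc _ h4) (by positivity))
    have i2 : ‖matVec G (matVec (B n ω) (D n ω))‖ ≤ 1 / 2 * ‖D n ω‖ :=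
      (hGBD n ω).trans (mul_le_mul_of_nonneg_right ((le_abs_self _).trans h6) (norm_nonneg _))
    have i3 : ‖D n ω‖ ≤ ‖matVec G (M.a prior (mml n (sample n ω)))‖ + ‖R n ω‖
        + ‖matVec G (matVec (B n ω) (D n ω))‖ := by
      conv_lhs => rw [h5]
      exact (norm_sub_le _ _).trans (add_le_add_left (norm_add_le _ _) _)
    linarith
  -- Boundedness of `D` now gives consistency, since the two estimators differ by `D / n`.
  have hmmlθ : IsLittleOp P (fun n ω => mml n (sample n ω) - θ₀) (fun _ => 1) := by
    refine ((hDO.isLittleOp_smul tendsto_inv_atTop_nhds_zero_nat).add hmleθ).congr' (.of_ae ?_)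
    filter_upwards [hpos] with n hn
    refine .of_forall fun ω => ?_
    have hn' : (n : ℝ) ≠ 0 := by positivity
    simp only [hD]
    rw [smul_smul, inv_mul_cancel₀ hn', one_smul]
    abel
  have ha := isLittleOp_comp_of_continuousAt hmmlθ
    (hpen.contDiffOn_a.continuousOn.continuousAt (hreg.isOpen.mem_nhds hreg.mem))
  have hBD : IsLittleOp P (fun n ω => matVec G (matVec (B n ω) (D n ω))) (fun _ => 1) :=
    hGB.of_le_mul hDO (.of_ae (.of_forall fun n => .of_forall fun ω =>
      (hGBD n ω).trans (mul_le_mul_of_nonneg_right (le_abs_self _) (norm_nonneg _))))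
  refine (((ha.matVec G).add hR0).sub hBD).congr' (hkey.mono' fun n ω ⟨_, h⟩ => ?_)
  change D n ω - _ = _
  conv_lhs => rw [h]
  rw [matVec_sub]
  abel

end Expansion

end ParamModel

/-! ### Oscillation of the third derivatives -/

namespace ParamModel

variable {𝒳 : Type*} [MeasurableSpace 𝒳] {d : ℕ} {M : ParamModel 𝒳 d} {θ₀ : Param d}
  {U : Set (Param d)}

lemma SmoothAt.continuousOn_third (hU : IsOpen U) {x : 𝒳} (hx : M.SmoothAt U x) (i j l : Fin d) :
    ContinuousOn (pd i (pd j (pd l (M.logp x)))) U :=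
  (contDiffOn_pd hU (m := 0) (hx.contDiffOn_pd_pd hU j l) (by norm_num) i).continuousOn

namespace Regular

variable (hreg : M.Regular θ₀ U)
include hreg

/-- The oscillation of the third derivatives of the log-likelihood over small balls is
dominated by statistics of arbitrarily small mean. -/
lemma exists_third_oscillation_le {ε : ℝ} (hε : 0 < ε) :
    ∃ r > 0, Metric.ball θ₀ r ⊆ U ∧ ∃ ρ : 𝒳 → ℝ, Integrable ρ (M.law θ₀) ∧
      ∫ x, ρ x ∂M.law θ₀ ≤ ε ∧ ∀ᵐ x ∂M.law θ₀, ∀ t ∈ Metric.ball θ₀ r, ∀ i j l,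
        |pd i (pd j (pd l (M.logp x))) t - pd i (pd j (pd l (M.logp x))) θ₀| ≤ ρ x := by
  obtain ⟨r₀, hr₀, hball⟩ := Metric.isOpen_iff.1 hreg.isOpen θ₀ hreg.mem
  obtain ⟨B, hB, hle⟩ := hreg.third_bound
  obtain ⟨D, hDc, hDd⟩ := TopologicalSpace.exists_countable_dense (Param d)
  have hle' := (M.law_absolutelyContinuous θ₀).ae_le hle
  set Δ : 𝒳 → Param d → Fin d → Fin d → Fin d → ℝ := fun x t i j l =>
    pd i (pd j (pd l (M.logp x))) t - pd i (pd j (pd l (M.logp x))) θ₀ with hΔ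
  set r : ℕ → ℝ := fun k => r₀ / (k + 1) with hr
  have hrpos : ∀ k, 0 < r k := fun k => by positivity
  have hrle : ∀ k, r k ≤ r₀ := fun k =>
    div_le_self hr₀.le (by linarith [(k.cast_nonneg : (0 : ℝ) ≤ k)])
  have hrlim : Tendsto r atTop (𝓝 0) := by
    have := tendsto_one_div_add_atTop_nhds_zero_nat (𝕜 := ℝ).const_mul r₀
    simpa [hr, div_eq_mul_inv] using this
  have hsub : ∀ k, Metric.ball θ₀ (r k) ⊆ U := fun k =>
    (Metric.ball_subset_ball (hrle k)).trans hball
  set T : ℕ → Set (Param d) := fun k => D ∩ Metric.ball θ₀ (r k) with hT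
  -- The supremum runs over a countable dense subset of the ball so that it is measurable. It is
  -- dominated by `2B` and tends to zero as the ball shrinks, by continuity of the third derivatives
  -- at `θ₀`.
  set Φ : ℕ → 𝒳 → ENNReal := fun k x => ⨆ t ∈ T k, ⨆ i, ⨆ j, ⨆ l, ‖Δ x t i j l‖ₑ with hΦ
  have hmeas : ∀ k, AEMeasurable (Φ k) (M.law θ₀) := fun k => by
    refine AEMeasurable.biSup _ (hDc.mono Set.inter_subset_left) fun t ht => ?_
    refine AEMeasurable.iSup fun i => AEMeasurable.iSup fun j => AEMeasurable.iSup fun l => ?_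
    exact (((hreg.aestronglyMeasurable_third (hsub k ht.2) i j l).mono_ac
      (M.law_absolutelyContinuous θ₀)).sub (hreg.integrable_third i j l).1).enorm
  have hbd : ∀ k, ∀ᵐ x ∂M.law θ₀, Φ k x ≤ ENNReal.ofReal (2 * B x) := fun k => by
    filter_upwards [hle'] with x hx
    refine iSup₂_le fun t ht => iSup_le fun i => iSup_le fun j => iSup_le fun l => ?_
    rw [← ofReal_norm]
    refine ENNReal.ofReal_le_ofReal ?_
    have h1 := hx t (hsub k ht.2) i j l
    have h2 := hx θ₀ hreg.mem i j l
    calc |Δ x t i j l| ≤ _ := abs_sub _ _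
      _ ≤ 2 * B x := by linarith
  have hlim : ∀ᵐ x ∂M.law θ₀, Tendsto (fun k => Φ k x) atTop (𝓝 0) := by
    filter_upwards [hreg.ae_smoothAt_law θ₀] with x hx
    rw [ENNReal.tendsto_nhds_zero]
    intro η hη
    have hc : ∀ i j l, ∀ᶠ t in 𝓝 θ₀, ‖Δ x t i j l‖ₑ ≤ η := fun i j l => by
      have h1 : ContinuousAt (fun t => ‖Δ x t i j l‖ₑ) θ₀ :=
        (((hx.continuousOn_third hreg.isOpen i j l).continuousAt
          (hreg.isOpen.mem_nhds hreg.mem)).sub continuousAt_const).enorm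
      refine h1.eventually (ge_mem_nhds ?_)
      simpa [hΔ] using hη
    have hc' : ∀ᶠ t in 𝓝 θ₀, ∀ i j l, ‖Δ x t i j l‖ₑ ≤ η := by
      simp only [eventually_all]; exact hc
    obtain ⟨δ, hδ, hδb⟩ := Metric.eventually_nhds_iff_ball.1 hc'
    filter_upwards [hrlim.eventually (gt_mem_nhds hδ)] with k hk
    refine iSup₂_le fun t ht => iSup_le fun i => iSup_le fun j => iSup_le fun l => ?_
    exact hδb t (Metric.ball_subset_ball hk.le ht.2) i j l
  have hB2 : ∫⁻ x, ENNReal.ofReal (2 * B x) ∂M.law θ₀ ≠ ⊤ :=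
    ((hB.const_mul 2).lintegral_lt_top).ne
  have hint := tendsto_lintegral_of_dominated_convergence' _ hmeas hbd hB2 hlim
  simp only [lintegral_zero] at hint
  obtain ⟨k, hk⟩ := (hint.eventually (ge_mem_nhds (ENNReal.ofReal_pos.2 hε))).exists
  have hfin : ∀ᵐ x ∂M.law θ₀, Φ k x < ⊤ := by
    filter_upwards [hbd k] with x hx using hx.trans_lt ENNReal.ofReal_lt_top
  refine ⟨r k, hrpos k, hsub k, fun x => (Φ k x).toReal,
    integrable_toReal_of_lintegral_ne_top (hmeas k) (hk.trans_lt ENNReal.ofReal_lt_top).ne, ?_, ?_⟩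
  · rw [integral_toReal (hmeas k) hfin]
    exact ENNReal.toReal_le_of_le_ofReal hε.le hk
  · filter_upwards [hfin, hreg.ae_smoothAt_law θ₀] with x hx hsm t ht i j l
    have hdense : ∀ s ∈ T k, |Δ x s i j l| ≤ (Φ k x).toReal := fun s hs => by
      rw [← ENNReal.ofReal_le_iff_le_toReal hx.ne, ← Real.norm_eq_abs, ofReal_norm]
      refine le_trans ?_ (le_iSup₂ (f := fun t (_ : t ∈ T k) =>
        ⨆ i, ⨆ j, ⨆ l, ‖Δ x t i j l‖ₑ) s hs)
      exact le_iSup_of_le i (le_iSup_of_le j (le_iSup (fun l => ‖Δ x s i j l‖ₑ) l))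
    -- A violation at some `t` of the ball would persist near `t` by continuity, hence at a point of
    -- the dense set.
    by_contra! hcon
    have hcont : ContinuousAt (fun t => |Δ x t i j l|) t :=
      (((hsm.continuousOn_third hreg.isOpen i j l).continuousAt
        (hreg.isOpen.mem_nhds (hsub k ht))).sub continuousAt_const).abs
    obtain ⟨s, hsD, hs1, hs2⟩ := ((mem_closure_iff_frequently.1 (hDd t)).and_eventually
      ((hcont.eventually (lt_mem_nhds hcon)).and (Metric.isOpen_ball.mem_nhds ht))).exists
    exact absurd (hdense s ⟨hsD, hs2⟩) (not_le.2 hs1)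

end Regular

end ParamModel

/-! ### Matrices and expectations -/

section MatVecIntegral

variable {d : ℕ} {Ω : Type*} [MeasurableSpace Ω] {P : Measure Ω} {f : Ω → Param d}

/-- The action of a matrix on `ℝ^d` as a continuous linear map. -/
def matVecCLM (B : Matrix (Fin d) (Fin d) ℝ) : Param d →L[ℝ] Param d :=
  LinearMap.toContinuousLinearMap
    { toFun := matVec B
      map_add' := matVec_add B
      map_smul' := matVec_smul B }

lemma integrable_matVec (B : Matrix (Fin d) (Fin d) ℝ) (hf : Integrable f P) :
    Integrable (fun ω => matVec B (f ω)) P := (matVecCLM B).integrable_comp hf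

lemma integral_matVec (B : Matrix (Fin d) (Fin d) ℝ) (hf : Integrable f P) :
    ∫ ω, matVec B (f ω) ∂P = matVec B (∫ ω, f ω ∂P) := (matVecCLM B).integral_comp_comm hf

lemma EventuallyUI.matVec {Y : ℕ → Ω → Param d} (h : EventuallyUI P Y)
    (B : Matrix (Fin d) (Fin d) ℝ) : EventuallyUI P (fun n ω => matVec B (Y n ω)) :=
  h.of_norm_le (fun _ hm => (matVecCLM B).continuous.comp_aestronglyMeasurable hm)
    fun _ _ => norm_matVec_le _ _

end MatVecIntegral

/-! ### The quadratic term and its mean -/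

namespace ParamModel

variable {𝒳 : Type*} [MeasurableSpace 𝒳] {d : ℕ} {M : ParamModel 𝒳 d} {θ₀ : Param d}
  {U : Set (Param d)}

section Statistics

variable (M θ₀)

/-- The `j`-th component of the standardised score `I⁻¹ ∇ log p` of one observation. -/
def effScore (j : Fin d) (x : 𝒳) : ℝ :=
  ∑ k, (M.fisher θ₀)⁻¹ j k * pd k (M.logp x) θ₀

/-- The centred second derivatives of the log-likelihood of one observation. -/
def centredHess (j i : Fin d) (x : 𝒳) : ℝ :=
  pd j (pd i (M.logp x)) θ₀ + M.fisher θ₀ j i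

/-- The mean third derivatives of the log-likelihood of one observation. -/
def meanThird (j l i : Fin d) : ℝ :=
  ∫ x, pd j (pd l (pd i (M.logp x))) θ₀ ∂M.law θ₀

/-- The vector `A vec(I⁻¹)` for one observation. -/
def biasVec (i : Fin d) : ℝ :=
  ∑ j, ∑ l, (M.fisher θ₀)⁻¹ j l *
    (∫ x, pd j (pd i (M.logp x)) θ₀ * pd l (M.logp x) θ₀ ∂M.law θ₀
      + (1 / 2) * M.meanThird θ₀ j l i)

/-- The quadratic approximation to the scaled second-order term of the score expansion at
the maximum likelihood estimator. -/
def quadTerm {Ω : Type*} (X : ℕ → Ω → 𝒳) (n : ℕ) (ω : Ω) : Param d :=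
  WithLp.toLp 2 fun i =>
    (∑ j, scaledSum X (M.centredHess θ₀ j i) n ω * scaledSum X (M.effScore θ₀ j) n ω)
    + (1 / 2) * ∑ j, ∑ l, M.meanThird θ₀ j l i *
      (scaledSum X (M.effScore θ₀ j) n ω * scaledSum X (M.effScore θ₀ l) n ω)

end Statistics

lemma fisher_symm (M : ParamModel 𝒳 d) (θ : Param d) (i j : Fin d) :
    M.fisher θ i j = M.fisher θ j i := by
  simp [fisher, mul_comm]

lemma inv_fisher_symm (M : ParamModel 𝒳 d) (θ : Param d) (i j : Fin d) :
    (M.fisher θ)⁻¹ i j = (M.fisher θ)⁻¹ j i := by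
  have h : (M.fisher θ).transpose = M.fisher θ := by
    ext i j; exact M.fisher_symm θ j i
  conv_lhs => rw [← h, ← Matrix.transpose_nonsing_inv]
  rfl

namespace Regular

variable (hreg : M.Regular θ₀ U)
include hreg

lemma memLp_effScore (j : Fin d) : MemLp (M.effScore θ₀ j) 2 (M.law θ₀) :=
  memLp_finsetSum _ fun k _ => (hreg.memLp_score k).const_mul _

lemma integral_effScore (j : Fin d) : ∫ x, M.effScore θ₀ j x ∂M.law θ₀ = 0 := by
  unfold effScore
  rw [integral_finsetSum _ fun k _ => (hreg.integrable_score hreg.mem k).const_mul _]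
  simp [integral_const_mul, hreg.integral_score hreg.mem]

lemma memLp_centredHess (j i : Fin d) : MemLp (M.centredHess θ₀ j i) 2 (M.law θ₀) := by
  have := M.isProbabilityMeasure_law hreg.mem_Θ
  exact (hreg.memLp_hess j i).add (memLp_const _)

lemma integral_centredHess (j i : Fin d) : ∫ x, M.centredHess θ₀ j i x ∂M.law θ₀ = 0 := by
  have := M.isProbabilityMeasure_law hreg.mem_Θ
  unfold centredHess
  rw [integral_add (hreg.integrable_hess hreg.mem j i) (integrable_const _),
    hreg.integral_hess hreg.mem]
  simp

/-- The centring constant of the Hessian contributes nothing because the standardised score has mean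
zero. -/
lemma integral_centredHess_mul_effScore (j i : Fin d) :
    ∫ x, M.centredHess θ₀ j i x * M.effScore θ₀ j x ∂M.law θ₀
      = ∑ l, (M.fisher θ₀)⁻¹ j l *
        ∫ x, pd j (pd i (M.logp x)) θ₀ * pd l (M.logp x) θ₀ ∂M.law θ₀ := by
  have hi : ∀ l, Integrable (fun x => (M.fisher θ₀)⁻¹ j l *
      (pd j (pd i (M.logp x)) θ₀ * pd l (M.logp x) θ₀)) (M.law θ₀) := fun l =>
    (hreg.integrable_hess_mul_score j i l).const_mul _
  have hs : Integrable (M.effScore θ₀ j) (M.law θ₀) := by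
    have := M.isProbabilityMeasure_law hreg.mem_Θ
    exact (hreg.memLp_effScore j).integrable one_le_two
  calc ∫ x, M.centredHess θ₀ j i x * M.effScore θ₀ j x ∂M.law θ₀
      = ∫ x, ((∑ l, (M.fisher θ₀)⁻¹ j l *
          (pd j (pd i (M.logp x)) θ₀ * pd l (M.logp x) θ₀))
          + M.fisher θ₀ j i * M.effScore θ₀ j x) ∂M.law θ₀ := by
        refine integral_congr_ae (.of_forall fun x => ?_)
        simp only [centredHess, effScore, add_mul, Finset.mul_sum]
        rw [← Finset.sum_add_distrib]
        exact Finset.sum_congr rfl fun l _ => by ring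
    _ = _ := by
        rw [integral_add (integrable_finsetSum _ fun l _ => hi l) (hs.const_mul _),
          integral_finsetSum _ fun l _ => hi l]
        simp [integral_const_mul, hreg.integral_effScore]

/-- The covariance of `I⁻¹ ∇log p` is `I⁻¹ I I⁻¹`, by symmetry of `I⁻¹`. -/
lemma integral_effScore_mul (hdet : (M.fisher θ₀).det ≠ 0) (j l : Fin d) :
    ∫ x, M.effScore θ₀ j x * M.effScore θ₀ l x ∂M.law θ₀ = (M.fisher θ₀)⁻¹ j l := by
  have hi : ∀ k m, Integrable (fun x => (M.fisher θ₀)⁻¹ j k * (M.fisher θ₀)⁻¹ l m *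
      (pd k (M.logp x) θ₀ * pd m (M.logp x) θ₀)) (M.law θ₀) := fun k m =>
    (hreg.integrable_score_mul hreg.mem k m).const_mul _
  calc ∫ x, M.effScore θ₀ j x * M.effScore θ₀ l x ∂M.law θ₀
      = ∫ x, ∑ m, ∑ k, (M.fisher θ₀)⁻¹ j k * (M.fisher θ₀)⁻¹ l m *
          (pd k (M.logp x) θ₀ * pd m (M.logp x) θ₀) ∂M.law θ₀ := by
        refine integral_congr_ae (.of_forall fun x => ?_)
        simp only [effScore, Finset.sum_mul, Finset.mul_sum]
        exact Finset.sum_congr rfl fun m _ => Finset.sum_congr rfl fun k _ => by ring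
    _ = ∑ m, ∑ k, (M.fisher θ₀)⁻¹ j k * (M.fisher θ₀)⁻¹ l m * M.fisher θ₀ k m := by
        rw [integral_finsetSum _ fun m _ => integrable_finsetSum _ fun k _ => hi k m]
        refine Finset.sum_congr rfl fun m _ => ?_
        rw [integral_finsetSum _ fun k _ => hi k m]
        exact Finset.sum_congr rfl fun k _ => integral_const_mul _ _
    _ = ∑ m, (M.fisher θ₀)⁻¹ l m * ((M.fisher θ₀)⁻¹ * M.fisher θ₀) j m := by
        refine Finset.sum_congr rfl fun m _ => ?_
        rw [Matrix.mul_apply, Finset.mul_sum]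
        exact Finset.sum_congr rfl fun k _ => by ring
    _ = _ := by
        rw [Matrix.nonsing_inv_mul _ hdet.isUnit]
        simp [Matrix.one_apply, M.inv_fisher_symm θ₀ l j]

/-- `K⁻¹` occurs twice and contributes `n⁻²`, while `A` grows like `n`, so the bias term is `1/n`
times a vector independent of `n`. -/
lemma smul_coxSnellBias (hK : ∀ n, 0 < n → (M.K n θ₀).det ≠ 0) {n : ℕ} (hn : 0 < n) :
    (n : ℝ) • M.coxSnellBias n θ₀
      = matVec (M.fisher θ₀)⁻¹ (WithLp.toLp 2 (M.biasVec θ₀)) := by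
  have hn' : (n : ℝ) ≠ 0 := by positivity
  rw [coxSnellBias, hreg.smul_matVec_inv_K hK hn]
  congr 2
  ext i
  simp only [Matrix.mulVec, dotProduct, Fintype.sum_prod_type, biasVec]
  -- The columns of the Cox–Snell matrix are indexed by `(l, j)`, whereas `biasVec` sums over `j`
  -- first.
  rw [Finset.sum_comm]
  refine Finset.sum_congr rfl fun j _ => Finset.sum_congr rfl fun l _ => ?_
  rw [hreg.coxSnell_eq, Matrix.vec, hreg.inv_K hK hn]
  simp only [Matrix.smul_apply, smul_eq_mul, meanThird]
  field_simp

section Sample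

variable {Ω : Type*} [MeasurableSpace Ω] {P : Measure Ω} [IsProbabilityMeasure P]
  {X : ℕ → Ω → 𝒳} (hX : IsIIDSample P X (M.law θ₀))
include hX

lemma eventuallyUI_quadTerm : EventuallyUI P (M.quadTerm θ₀ X) := by
  refine eventuallyUI_of_coord fun i => ?_
  refine (EventuallyUI.sum _ fun j _ => ?_).add ((EventuallyUI.sum _ fun j _ =>
    EventuallyUI.sum _ fun l _ => EventuallyUI.const_mul ?_ _).const_mul _)
  · exact hX.eventuallyUI_scaledSum_mul (hreg.memLp_centredHess j i)
      (hreg.integral_centredHess j i) (hreg.memLp_effScore j) (hreg.integral_effScore j)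
  · exact hX.eventuallyUI_scaledSum_mul (hreg.memLp_effScore j) (hreg.integral_effScore j)
      (hreg.memLp_effScore l) (hreg.integral_effScore l)

lemma integral_quadTerm (hdet : (M.fisher θ₀).det ≠ 0) {n : ℕ} (hn : 0 < n) (i : Fin d) :
    Integrable (fun ω => M.quadTerm θ₀ X n ω i) P ∧
    ∫ ω, M.quadTerm θ₀ X n ω i ∂P = M.biasVec θ₀ i := by
  have h1 := fun j => hX.integral_scaledSum_mul (hreg.memLp_centredHess j i)
      (hreg.integral_centredHess j i) (hreg.memLp_effScore j) (hreg.integral_effScore j) hn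
  have h2 := fun j l => hX.integral_scaledSum_mul (hreg.memLp_effScore j)
      (hreg.integral_effScore j) (hreg.memLp_effScore l) (hreg.integral_effScore l) hn
  have i1 := integrable_finsetSum Finset.univ fun j _ => (h1 j).1
  have i2 : ∀ j, Integrable (fun ω => ∑ l, M.meanThird θ₀ j l i *
      (scaledSum X (M.effScore θ₀ j) n ω * scaledSum X (M.effScore θ₀ l) n ω)) P := fun j =>
    integrable_finsetSum _ fun l _ => (h2 j l).1.const_mul _
  have i3 := (integrable_finsetSum Finset.univ fun j _ => i2 j).const_mul (1 / 2 : ℝ)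
  refine ⟨i1.add i3, ?_⟩
  change ∫ ω, ((∑ j, scaledSum X (M.centredHess θ₀ j i) n ω * scaledSum X (M.effScore θ₀ j) n ω)
    + (1 / 2) * ∑ j, ∑ l, M.meanThird θ₀ j l i *
      (scaledSum X (M.effScore θ₀ j) n ω * scaledSum X (M.effScore θ₀ l) n ω)) ∂P = _
  rw [integral_add i1 i3, integral_finsetSum _ fun j _ => (h1 j).1, integral_const_mul,
    integral_finsetSum _ fun j _ => i2 j]
  have e2 : ∀ j, ∫ ω, ∑ l, M.meanThird θ₀ j l i *
      (scaledSum X (M.effScore θ₀ j) n ω * scaledSum X (M.effScore θ₀ l) n ω) ∂P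
      = ∑ l, M.meanThird θ₀ j l i * (M.fisher θ₀)⁻¹ j l := fun j => by
    rw [integral_finsetSum _ fun l _ => (h2 j l).1.const_mul _]
    refine Finset.sum_congr rfl fun l _ => ?_
    rw [integral_const_mul, (h2 j l).2, hreg.integral_effScore_mul hdet]
  simp only [e2, (h1 _).2, hreg.integral_centredHess_mul_effScore, biasVec]
  rw [Finset.mul_sum, ← Finset.sum_add_distrib]
  refine Finset.sum_congr rfl fun j _ => ?_
  rw [Finset.mul_sum, ← Finset.sum_add_distrib]
  exact Finset.sum_congr rfl fun l _ => by ring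

lemma integral_matVec_quadTerm (hdet : (M.fisher θ₀).det ≠ 0) {n : ℕ} (hn : 0 < n) :
    Integrable (fun ω => matVec (M.fisher θ₀)⁻¹ (M.quadTerm θ₀ X n ω)) P ∧
    ∫ ω, matVec (M.fisher θ₀)⁻¹ (M.quadTerm θ₀ X n ω) ∂P
      = matVec (M.fisher θ₀)⁻¹ (WithLp.toLp 2 (M.biasVec θ₀)) := by
  have hi : Integrable (M.quadTerm θ₀ X n) P := by
    have : M.quadTerm θ₀ X n
        = fun ω => ∑ i, M.quadTerm θ₀ X n ω i • EuclideanSpace.single i (1 : ℝ) := by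
      ext1 ω; exact coord_sum _
    rw [this]
    exact integrable_finsetSum _ fun i _ =>
      (hreg.integral_quadTerm hX hdet hn i).1.smul_const _
  refine ⟨integrable_matVec _ hi, (integral_matVec _ hi).trans ?_⟩
  congr 1
  ext i
  have := (EuclideanSpace.proj i : Param d →L[ℝ] ℝ).integral_comp_comm hi
  change ∫ ω, M.quadTerm θ₀ X n ω i ∂P = (∫ ω, M.quadTerm θ₀ X n ω ∂P) i at this
  rw [← this, (hreg.integral_quadTerm hX hdet hn i).2]

end Sample

end Regular

end ParamModel

/-! ### Second-order expansion of the maximum likelihood estimator -/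

namespace ParamModel

variable {𝒳 : Type*} [MeasurableSpace 𝒳] {d : ℕ} {M : ParamModel 𝒳 d} {θ₀ : Param d}
  {U : Set (Param d)}

lemma gradient_logLik_apply (hU : IsOpen U) {Ω : Type*} {X : ℕ → Ω → 𝒳} {n : ℕ} {ω : Ω}
    (hx : ∀ m, M.SmoothAt U (X m ω)) {θ : Param d} (hθ : θ ∈ U) (i : Fin d) :
    gradient (M.logLik n fun m : Fin n => X m ω) θ i
      = sampleSum X (fun x => pd i (M.logp x) θ) n ω := by
  rw [gradient_apply, pd_logLik_eqOn hU (fun m : Fin n => hx m) i hθ, sampleSum,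
    Finset.sum_range]

/-- Second-order Taylor expansion of the score of a sample. -/
lemma score_taylor {r : ℝ} (hsub : Metric.ball θ₀ r ⊆ U) {ρ : 𝒳 → ℝ} {Ω : Type*}
    {X : ℕ → Ω → 𝒳} {ω : Ω} (hx : ∀ m, M.SmoothAt U (X m ω))
    (hρ : ∀ m, ∀ t ∈ Metric.ball θ₀ r, ∀ i j l, |pd i (pd j (pd l (M.logp (X m ω)))) t
      - pd i (pd j (pd l (M.logp (X m ω)))) θ₀| ≤ ρ (X m ω))
    {θ : Param d} (hθ : θ ∈ Metric.ball θ₀ r) (n : ℕ) (i : Fin d) :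
    |sampleSum X (fun x => pd i (M.logp x) θ) n ω - sampleSum X (fun x => pd i (M.logp x) θ₀) n ω
      - ∑ j, sampleSum X (fun x => pd j (pd i (M.logp x)) θ₀) n ω * (θ j - θ₀ j)
      - (1 / 2) * ∑ j, ∑ l, sampleSum X (fun x => pd j (pd l (pd i (M.logp x))) θ₀) n ω
          * (θ j - θ₀ j) * (θ l - θ₀ l)|
      ≤ d ^ 2 * ‖θ - θ₀‖ ^ 2 * sampleSum X ρ n ω := by
  have hone : ∀ m, |pd i (M.logp (X m ω)) θ - pd i (M.logp (X m ω)) θ₀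
      - ∑ j, pd j (pd i (M.logp (X m ω))) θ₀ * (θ j - θ₀ j)
      - (1 / 2) * ∑ j, ∑ l, pd j (pd l (pd i (M.logp (X m ω)))) θ₀
          * (θ j - θ₀ j) * (θ l - θ₀ l)| ≤ d ^ 2 * ‖θ - θ₀‖ ^ 2 * ρ (X m ω) := fun m => by
    refine (taylor_two_bound hθ (contDiffOn_pd Metric.isOpen_ball
      ((hx m).contDiffOn.mono hsub) (by norm_num) i)
      (fun t ht j l => hρ m t ht j l i)).trans (le_of_eq (by ring))
  have hsum := Finset.abs_sum_le_sum_abs (fun m => pd i (M.logp (X m ω)) θ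
      - pd i (M.logp (X m ω)) θ₀
      - ∑ j, pd j (pd i (M.logp (X m ω))) θ₀ * (θ j - θ₀ j)
      - (1 / 2) * ∑ j, ∑ l, pd j (pd l (pd i (M.logp (X m ω)))) θ₀
          * (θ j - θ₀ j) * (θ l - θ₀ l)) (Finset.range n)
  have hle := hsum.trans (Finset.sum_le_sum fun m _ => hone m)
  rw [← Finset.mul_sum] at hle
  refine le_trans (le_of_eq (congrArg _ ?_)) hle
  simp only [Finset.sum_sub_distrib, sampleSum, ← Finset.mul_sum, Finset.sum_mul]
  congr 2
  · rw [Finset.sum_comm]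
  · conv_rhs => rw [Finset.sum_comm]
    refine Finset.sum_congr rfl fun j _ => ?_
    rw [Finset.sum_comm]

namespace Regular

variable (hreg : M.Regular θ₀ U)
  {Ω : Type*} [MeasurableSpace Ω] {P : Measure Ω} [IsProbabilityMeasure P]
  {X : ℕ → Ω → 𝒳} (hX : IsIIDSample P X (M.law θ₀))
include hreg hX

/-- The second-order stochastic expansion of the maximum likelihood estimator. -/
theorem isLittleOp_mle_sub_quadTerm (hdet : (M.fisher θ₀).det ≠ 0)
    {est : ℕ → Ω → Param d}
    (hmle : WithProbTendingToOne P fun n ω => M.IsMLE n (fun m : Fin n => X m ω) (est n ω))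
    (hroot : IsBigOp P (fun n ω => est n ω - θ₀) (fun n => 1 / √(n : ℝ))) :
    IsLittleOp P (fun n ω => ((n : ℝ) • (est n ω - θ₀)
        - matVec (M.fisher θ₀)⁻¹ (gradient (M.logLik n fun m : Fin n => X m ω) θ₀))
      - matVec (M.fisher θ₀)⁻¹ (M.quadTerm θ₀ X n ω)) (fun _ => 1) := by
  have hprob := M.isProbabilityMeasure_law hreg.mem_Θ
  set G := (M.fisher θ₀)⁻¹ with hG
  have hGF : G * M.fisher θ₀ = 1 := Matrix.nonsing_inv_mul _ hdet.isUnit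
  have hpos : ∀ᶠ n : ℕ in atTop, 0 < n := eventually_gt_atTop 0
  have hsmooth := hreg.ae_smoothAt_sample hX
  set S : ℕ → Ω → Param d := fun n ω => gradient (M.logLik n fun m : Fin n => X m ω) θ₀ with hS
  set V : ℕ → Ω → Param d := fun n ω => √(n : ℝ) • (est n ω - θ₀) with hV
  set w : ℕ → Ω → Param d := fun n ω =>
    matVec (M.fisher θ₀) ((n : ℝ) • (est n ω - θ₀)) - S n ω with hw
  set ξ : Fin d → ℕ → Ω → ℝ := fun j => scaledSum X (M.effScore θ₀ j) with hξ
  set h : Fin d → Fin d → ℕ → Ω → ℝ := fun j i => scaledSum X (M.centredHess θ₀ j i) with hh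
  set T : Fin d → Fin d → Fin d → ℕ → Ω → ℝ := fun j l i n ω => (n : ℝ)⁻¹ *
    sampleSum X (fun x => pd j (pd l (pd i (M.logp x))) θ₀) n ω with hT
  have hVO : IsBigOp P V (fun _ => 1) := (isBigOp_smul_iff eventually_sqrt_mul_one_div).2 hroot
  have hestθ : IsLittleOp P (fun n ω => est n ω - θ₀) (fun _ => 1) :=
    isLittleOp_one_of_isBigOp_inv_sqrt hroot
  have hξO : ∀ j, IsBigOp P (ξ j) (fun _ => 1) := fun j =>
    hX.isBigOp_scaledSum (hreg.memLp_effScore j) (hreg.integral_effScore j)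
  have hhO : ∀ j i, IsBigOp P (h j i) (fun _ => 1) := fun j i =>
    hX.isBigOp_scaledSum (hreg.memLp_centredHess j i) (hreg.integral_centredHess j i)
  have hTo : ∀ j l i, IsLittleOp P (fun n ω => T j l i n ω - M.meanThird θ₀ j l i)
      (fun _ => 1) := fun j l i => hX.isLittleOp_average (hreg.integrable_third j l i)
  have hTO : ∀ j l i, IsBigOp P (T j l i) (fun _ => 1) := fun j l i => by
    simpa using (hTo j l i).isBigOp.add (isBigOp_const (M.meanThird θ₀ j l i))
  -- the expansion of the score with a remainder of smaller order
  have hrem : ∀ i, IsLittleOp P (fun n ω => w n ω i - ((∑ j, h j i n ω * V n ω j)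
      + (1 / 2) * ∑ j, ∑ l, T j l i n ω * (V n ω j * V n ω l))) (fun _ => 1) := by
    intro i
    have hV2 : IsBigOp P (fun n ω => ‖V n ω‖ * ‖V n ω‖) (fun _ => 1) := by
      have : IsBigOp P (fun n ω => ‖V n ω‖) (fun _ => 1) :=
        hVO.of_le (.of_ae (.of_forall fun n => .of_forall fun ω => by simp))
      exact this.mul this
    refine isLittleOp_of_forall_le_mul hV2 fun ε hε => ?_
    -- The mean of `ρ` is at most `η`, and by the law of large numbers its sample average is at most
    -- `2η` with probability tending to one. The Taylor constant `d ^ 2` then gives `2 η d ^ 2 ≤ ε`.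
    set η : ℝ := ε / (2 * (d ^ 2 + 1)) with hη
    have hη0 : 0 < η := by positivity
    obtain ⟨r, hr, hsub, ρ, hρi, hρm, hρ⟩ := hreg.exists_third_oscillation_le hη0
    have hρX : ∀ᵐ ω ∂P, ∀ m, ∀ t ∈ Metric.ball θ₀ r, ∀ i j l,
        |pd i (pd j (pd l (M.logp (X m ω)))) t
          - pd i (pd j (pd l (M.logp (X m ω)))) θ₀| ≤ ρ (X m ω) := by
      rw [ae_all_iff]
      exact fun m => (hX.measurePreserving m).quasiMeasurePreserving.ae hρ
    have hball := withProbTendingToOne_mem hestθ (Metric.ball_mem_nhds θ₀ hr)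
    refine ((hmle.and hball).and ((hX.isLittleOp_average hρi).norm_le hη0)).mono ?_
    filter_upwards [hpos] with n hn
    filter_upwards [hsmooth, hρX] with ω hsm hρω
    rintro ⟨⟨h1, h2⟩, h3⟩
    have hn' : (0 : ℝ) < n := by positivity
    have hsq : √(n : ℝ) * √n = n := Real.mul_self_sqrt n.cast_nonneg
    have hsq0 : √(n : ℝ) ≠ 0 := by positivity
    have hgrad : sampleSum X (fun x => pd i (M.logp x) (est n ω)) n ω = 0 := by
      rw [← gradient_logLik_apply hreg.isOpen hsm (hsub h2),
        h1.gradient_eq_zero hreg.isOpen hreg.subset (fun m => hsm m) (hsub h2)]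
      rfl
    have htay := score_taylor hsub hsm hρω h2 n i
    rw [hgrad] at htay
    have hρle : (n : ℝ)⁻¹ * sampleSum X ρ n ω ≤ 2 * η := by
      have := (le_abs_self _).trans h3
      linarith
    have hVn : ‖V n ω‖ * ‖V n ω‖ = n * ‖est n ω - θ₀‖ ^ 2 := by
      simp only [hV, norm_smul, Real.norm_eq_abs, abs_of_nonneg (Real.sqrt_nonneg _)]
      rw [mul_mul_mul_comm, hsq, sq]
    have hcoord : ∀ j, V n ω j = √(n : ℝ) * (est n ω j - θ₀ j) := fun j => by simp [hV]
    -- Centring the Hessian splits off `n I (est - θ₀)`, the leading term of `w`.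
    have hhV : ∀ j, h j i n ω * V n ω j
        = sampleSum X (fun x => pd j (pd i (M.logp x)) θ₀) n ω * (est n ω j - θ₀ j)
          + n * (M.fisher θ₀ i j * (est n ω j - θ₀ j)) := fun j => by
      rw [hcoord]
      simp only [hh, scaledSum, sampleSum, centredHess, Finset.sum_add_distrib, Finset.sum_const,
        Finset.card_range, nsmul_eq_mul, M.fisher_symm θ₀ j i]
      field_simp
    have hTV : ∀ j l, T j l i n ω * (V n ω j * V n ω l)
        = sampleSum X (fun x => pd j (pd l (pd i (M.logp x))) θ₀) n ω
          * (est n ω j - θ₀ j) * (est n ω l - θ₀ l) := fun j l => by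
      rw [hcoord, hcoord]
      simp only [hT]
      calc _ = (n : ℝ)⁻¹ * (√(n : ℝ) * √n)
            * (sampleSum X (fun x => pd j (pd l (pd i (M.logp x))) θ₀) n ω
            * (est n ω j - θ₀ j) * (est n ω l - θ₀ l)) := by ring
        _ = _ := by rw [hsq, inv_mul_cancel₀ hn'.ne', one_mul]
    have hwi : w n ω i = (∑ j, n * (M.fisher θ₀ i j * (est n ω j - θ₀ j)))
        - sampleSum X (fun x => pd i (M.logp x) θ₀) n ω := by
      simp only [hw, hS, PiLp.sub_apply]
      rw [gradient_logLik_apply hreg.isOpen hsm hreg.mem, matVec_apply]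
      congr 1
      refine Finset.sum_congr rfl fun j _ => ?_
      simp only [PiLp.smul_apply, PiLp.sub_apply, smul_eq_mul]
      ring
    rw [Real.norm_eq_abs, Real.norm_eq_abs, abs_of_nonneg (by positivity :
      0 ≤ ‖V n ω‖ * ‖V n ω‖), hVn]
    simp only [hhV, hTV, Finset.sum_add_distrib, hwi]
    calc _ ≤ d ^ 2 * ‖est n ω - θ₀‖ ^ 2 * sampleSum X ρ n ω := by
          refine le_trans (le_of_eq (congrArg _ ?_)) htay
          ring
      _ = d ^ 2 * (n * ‖est n ω - θ₀‖ ^ 2) * ((n : ℝ)⁻¹ * sampleSum X ρ n ω) := by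
          field_simp
      _ ≤ d ^ 2 * (n * ‖est n ω - θ₀‖ ^ 2) * (2 * η) := by gcongr
      _ = (d ^ 2 * (2 * η)) * (n * ‖est n ω - θ₀‖ ^ 2) := by ring
      _ ≤ ε * (n * ‖est n ω - θ₀‖ ^ 2) := by
          refine mul_le_mul_of_nonneg_right ?_ (by positivity)
          rw [hη]
          field_simp
          nlinarith
  -- Every factor of the quadratic expression is `O_p(1)`, hence so is `w`.
  have hwO : IsBigOp P w (fun _ => 1) := by
    refine isBigOp_of_coord fun i => ?_
    have := (hrem i).isBigOp.add ((IsBigOp.sum Finset.univ fun j _ =>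
      (hhO j i).mul (hVO.coord j)).add ((isBigOp_const (1 / 2 : ℝ)).mul
      (IsBigOp.sum Finset.univ fun j _ => IsBigOp.sum Finset.univ fun l _ =>
        (hTO j l i).mul ((hVO.coord j).mul (hVO.coord l)))))
    simpa using this
  have hGw : ∀ n ω, matVec G (w n ω) = (n : ℝ) • (est n ω - θ₀) - matVec G (S n ω) := by
    intro n ω
    simp only [hw]
    rw [matVec_sub, ← matVec_mul, hGF, one_matVec]
  -- first-order expansion
  have hVξ : ∀ j, IsLittleOp P (fun n ω => V n ω j - ξ j n ω) (fun _ => 1) := by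
    intro j
    -- The vector `G w` divided by `√n` is exactly `V` minus the normalised sum of standardised
    -- scores.
    refine (((hwO.matVec G).isLittleOp_smul tendsto_inv_sqrt_natCast).coord j).congr' (.of_ae ?_)
    filter_upwards [hpos] with n hn
    filter_upwards [hsmooth] with ω hsm
    have hsq : √(n : ℝ) * √n = n := Real.mul_self_sqrt n.cast_nonneg
    have hsq0 : √(n : ℝ) ≠ 0 := by positivity
    rw [hGw]
    simp only [PiLp.smul_apply, PiLp.sub_apply, smul_eq_mul, hV, hξ, matVec_apply, hS,
      gradient_logLik_apply hreg.isOpen hsm hreg.mem]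
    have e1 : scaledSum X (M.effScore θ₀ j) n ω = (√(n : ℝ))⁻¹ *
        ∑ k, G j k * sampleSum X (fun x => pd k (M.logp x) θ₀) n ω := by
      have := scaledSum_sum (X := X) Finset.univ (fun k => G j k)
        (fun k x => pd k (M.logp x) θ₀) n ω
      refine this.trans ?_
      simp only [scaledSum, Finset.mul_sum]
      exact Finset.sum_congr rfl fun k _ => by ring
    have e3 : (√(n : ℝ))⁻¹ * n = √n := (inv_mul_eq_iff_eq_mul₀ hsq0).2 hsq.symm
    rw [e1]
    linear_combination (-(est n ω j - θ₀ j)) * e3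
  -- replacing the estimator by its first-order expansion in the quadratic terms
  have hwq : IsLittleOp P (fun n ω => w n ω - M.quadTerm θ₀ X n ω) (fun _ => 1) := by
    refine isLittleOp_of_coord fun i => ?_
    have h1 : IsLittleOp P (fun n ω => ∑ j, h j i n ω * (V n ω j - ξ j n ω)) (fun _ => 1) :=
      .sum _ (fun _ => zero_le_one) fun j _ => by
        simpa only [mul_comm] using (hVξ j).mul (hhO j i)
    -- The difference `T V V - meanThird ξ ξ` is telescoped by changing one factor at a time, so
    -- that each summand has one `o_p(1)` factor and otherwise bounded ones.
    have h2 : IsLittleOp P (fun n ω => ∑ j, ∑ l,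
        ((T j l i n ω - M.meanThird θ₀ j l i) * (V n ω j * V n ω l)
          + ((V n ω j - ξ j n ω) * (M.meanThird θ₀ j l i * V n ω l)
            + (V n ω l - ξ l n ω) * (M.meanThird θ₀ j l i * ξ j n ω)))) (fun _ => 1) :=
      .sum _ (fun _ => zero_le_one) fun j _ => .sum _ (fun _ => zero_le_one) fun l _ =>
        ((hTo j l i).mul ((hVO.coord j).mul (hVO.coord l))).add
          (((hVξ j).mul ((isBigOp_const _).mul (hVO.coord l))).add
            ((hVξ l).mul ((isBigOp_const _).mul (hξO j))))
    refine ((hrem i).add (h1.add (h2.mul (isBigOp_const (1 / 2 : ℝ))))).congr'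
      (.of_ae (.of_forall fun n => .of_forall fun ω => ?_))
    have e2 : ∀ j l, (T j l i n ω - M.meanThird θ₀ j l i) * (V n ω j * V n ω l)
          + ((V n ω j - ξ j n ω) * (M.meanThird θ₀ j l i * V n ω l)
            + (V n ω l - ξ l n ω) * (M.meanThird θ₀ j l i * ξ j n ω))
        = T j l i n ω * (V n ω j * V n ω l)
          - M.meanThird θ₀ j l i * (ξ j n ω * ξ l n ω) := fun j l => by ring
    simp only [e2, mul_sub, Finset.sum_sub_distrib]
    simp only [PiLp.sub_apply, quadTerm]
    ring
  refine (hwq.matVec G).congr' (.of_ae (.of_forall fun n => .of_forall fun ω => ?_))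
  rw [matVec_sub, hGw]

end Regular

end ParamModel

/-! ### From scaled limits to bias statements -/

lemma isLittleO_one_div_of_tendsto {F : Type*} [NormedAddCommGroup F] [NormedSpace ℝ F]
    {f : ℕ → F} (h : Tendsto (fun n : ℕ => (n : ℝ) • f n) atTop (𝓝 0)) :
    f =o[atTop] (fun n : ℕ => 1 / (n : ℝ)) := by
  rw [isLittleO_iff]
  intro c hc
  filter_upwards [h.norm.eventually (ge_mem_nhds (by simpa using hc)),
    eventually_gt_atTop 0] with n hn hpos
  have hpos' : (0 : ℝ) < n := by positivity
  rw [norm_smul, Real.norm_of_nonneg hpos'.le] at hn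
  rw [Real.norm_of_nonneg (by positivity), mul_one_div, le_div_iff₀ hpos', mul_comm]
  exact hn

namespace ParamModel.Regular

variable {𝒳 : Type*} [MeasurableSpace 𝒳] {d : ℕ} {M : ParamModel 𝒳 d} {θ₀ : Param d}
  {U : Set (Param d)} (hreg : M.Regular θ₀ U)
  {Ω : Type*} [MeasurableSpace Ω] {P : Measure Ω} {X : ℕ → Ω → 𝒳}
  (hX : IsIIDSample P X (M.law θ₀))
include hreg hX

/-- The score at the true parameter is integrable with mean zero. -/
lemma integral_gradient_logLik (n : ℕ) :
    Integrable (fun ω => gradient (M.logLik n fun m : Fin n => X m ω) θ₀) P ∧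
    ∫ ω, gradient (M.logLik n fun m : Fin n => X m ω) θ₀ ∂P = 0 := by
  have hae : (fun ω => gradient (M.logLik n fun m : Fin n => X m ω) θ₀) =ᵐ[P]
      fun ω => ∑ i, sampleSum X (fun x => pd i (M.logp x) θ₀) n ω •
        EuclideanSpace.single i (1 : ℝ) := by
    filter_upwards [hreg.ae_smoothAt_sample hX] with ω hω
    conv_lhs => rw [coord_sum (gradient _ _)]
    simp only [gradient_logLik_apply hreg.isOpen hω hreg.mem]
  have hi := fun i => hX.integrable_sampleSum (hreg.integrable_score hreg.mem i) n
  refine ⟨(integrable_finsetSum _ fun i _ => (hi i).smul_const _).congr hae.symm, ?_⟩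
  rw [integral_congr_ae hae, integral_finsetSum _ fun i _ => (hi i).smul_const _]
  refine Finset.sum_eq_zero fun i _ => ?_
  rw [integral_smul_const, hX.integral_sampleSum (hreg.integrable_score hreg.mem i),
    hreg.integral_score hreg.mem, mul_zero, zero_smul]

end ParamModel.Regular

end

/-! ### Assembly of the expansions and the bias formulas -/

theorem theorem3 {𝒳 : Type*} [MeasurableSpace 𝒳] {d : ℕ} (M : ParamModel 𝒳 d)
    (prior : Param d → ℝ) (θ₀ : Param d) (U : Set (Param d))
    -- independent observations from the model with the true parameter `θ₀`
    {Ω : Type*} [MeasurableSpace Ω] (P : Measure Ω) [IsProbabilityMeasure P]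
    (X : ℕ → Ω → 𝒳) (hX : ∀ i, Measurable (X i)) (hindep : iIndepFun X P)
    (hlaw : ∀ i, P.map (X i) = M.law θ₀)
    (sample : (n : ℕ) → Ω → Fin n → 𝒳)
    (hsample : sample = fun n ω (i : Fin n) => X i ω)
    -- the two estimators
    (mle mml : (n : ℕ) → (Fin n → 𝒳) → Param d)
    (hmle_meas : ∀ n, Measurable (mle n)) (hmml_meas : ∀ n, Measurable (mml n))
    (hmle : WithProbTendingToOne P fun n ω => M.IsMLE n (sample n ω) (mle n (sample n ω)))
    (hmml : WithProbTendingToOne P fun n ω =>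
      M.IsMML prior n (sample n ω) (mml n (sample n ω)))
    -- smoothness, moments, interchange of differentiation and expectation
    (hreg : M.Regular θ₀ U)
    -- observed information at the MLE, nonsingular `K`
    (hobs : ∀ i j, IsBigOp P
      (fun n ω => -hessian (M.logLik n (sample n ω)) (mle n (sample n ω)) i j - M.K n θ₀ i j)
      (fun n => Real.sqrt n))
    (hK : ∀ n, 0 < n → (M.K n θ₀).det ≠ 0)
    -- root-n consistency of the MLE
    (hroot : IsBigOp P (fun n ω => mle n (sample n ω) - θ₀) (fun n => 1 / Real.sqrt n))
    -- smoothness of `a`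
    (hpen : M.RegularPenalty prior U)
    -- the Taylor expansion of the score at the Wallace–Freeman estimator: it takes place
    -- in `U`, and its remainder contributes `o_p(1/n)` to the difference of the estimators
    (C : Set (Param d)) (hC : IsCompact C) (hCU : C ⊆ U)
    (hmmlC : WithProbTendingToOne P fun n ω => mml n (sample n ω) ∈ C)
    (hrem : IsLittleOp P
      (fun n ω => matVec (M.K n θ₀)⁻¹
        (M.scoreRemainder n (sample n ω) (mle n (sample n ω)) (mml n (sample n ω))))
      (fun n => 1 / (n : ℝ)))
    -- the error term is uniformly integrable after multiplication by `n`
    (hUI : EventuallyUI P fun n ω =>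
      (n : ℝ) • (mml n (sample n ω) - mle n (sample n ω)
        - matVec (M.K n θ₀)⁻¹ (M.a prior θ₀))) :
    -- `K(θ₀) = n I(θ₀)`
    (∀ n, M.K n θ₀ = (n : ℝ) • M.fisher θ₀) ∧
    -- the stochastic expansion, in both forms
    IsLittleOp P
      (fun n ω => mml n (sample n ω) - mle n (sample n ω)
        - matVec (M.K n θ₀)⁻¹ (M.a prior θ₀))
      (fun n => 1 / (n : ℝ)) ∧
    IsLittleOp P
      (fun n ω => mml n (sample n ω) - mle n (sample n ω)
        - (1 / (n : ℝ)) • matVec (M.fisher θ₀)⁻¹ (M.a prior θ₀))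
      (fun n => 1 / (n : ℝ)) ∧
    -- the bias relative to the MLE, as soon as the bias of the MLE exists
    ((∀ᶠ n in atTop, Integrable (fun ω => mle n (sample n ω)) P) →
      (∀ᶠ n in atTop, Integrable (fun ω => mml n (sample n ω)) P) ∧
      (fun n : ℕ => (∫ ω, (mml n (sample n ω) - θ₀) ∂P)
        - ((∫ ω, (mle n (sample n ω) - θ₀) ∂P) + matVec (M.K n θ₀)⁻¹ (M.a prior θ₀)))
        =o[atTop] (fun n : ℕ => 1 / (n : ℝ))) ∧
    -- the bias in Cox–Snell form, as soon as the error in the first-order expansion of the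
    -- MLE is uniformly integrable after multiplication by `n`
    ((EventuallyUI P fun n ω =>
        (n : ℝ) • (mle n (sample n ω) - θ₀
          - matVec (M.K n θ₀)⁻¹ (gradient (M.logLik n (sample n ω)) θ₀))) →
      (∀ᶠ n in atTop, Integrable (fun ω => mle n (sample n ω)) P) ∧
      (∀ᶠ n in atTop, Integrable (fun ω => mml n (sample n ω)) P) ∧
      (fun n : ℕ => (∫ ω, (mle n (sample n ω) - θ₀) ∂P) - M.coxSnellBias n θ₀)
        =o[atTop] (fun n : ℕ => 1 / (n : ℝ)) ∧
      (fun n : ℕ => (∫ ω, (mml n (sample n ω) - θ₀) ∂P)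
        - (M.coxSnellBias n θ₀ + matVec (M.K n θ₀)⁻¹ (M.a prior θ₀)))
        =o[atTop] (fun n : ℕ => 1 / (n : ℝ))) := by
  have hiid : IsIIDSample P X (M.law θ₀) := ⟨hX, hindep, hlaw⟩
  have hdet := hreg.det_fisher_ne_zero hK
  have hpos : ∀ᶠ n : ℕ in atTop, 0 < n := eventually_gt_atTop 0
  have hscaled : IsLittleOp P (fun n ω => (n : ℝ) • (mml n (sample n ω) - mle n (sample n ω)
      - matVec (M.K n θ₀)⁻¹ (M.a prior θ₀))) (fun _ => 1) := by
    refine (ParamModel.isLittleOp_mml_sub_mle hreg hiid hsample hmle hmml hobs hK hroot hpen hC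
      hCU hmmlC hrem).congr' (.of_ae ?_)
    filter_upwards [hpos] with n hn
    refine .of_forall fun ω => ?_
    rw [smul_sub, hreg.smul_matVec_inv_K hK hn]
  have hexp := (isLittleOp_smul_iff ParamModel.eventually_natCast_mul_one_div).1 hscaled
  have hmmlInt : (∀ᶠ n in atTop, Integrable (fun ω => mle n (sample n ω)) P) →
      ∀ᶠ n in atTop, Integrable (fun ω => mml n (sample n ω)) P := by
    intro hint
    filter_upwards [hint, hUI.integrable, hpos] with n h1 h2 hn
    have hn' : (n : ℝ) ≠ 0 := by positivity
    -- The Wallace–Freeman estimator is the MLE plus a constant plus `1/n` times the uniformly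
    -- integrable error.
    refine ((h1.add (integrable_const (matVec (M.K n θ₀)⁻¹ (M.a prior θ₀)))).add
      (h2.smul (n : ℝ)⁻¹)).congr (.of_forall fun ω => ?_)
    simp only [Pi.add_apply, Pi.smul_apply]
    rw [smul_smul, inv_mul_cancel₀ hn', one_smul]
    abel
  have hmmlBias : (∀ᶠ n in atTop, Integrable (fun ω => mle n (sample n ω)) P) →
      Tendsto (fun n : ℕ => (n : ℝ) • ((∫ ω, (mml n (sample n ω) - θ₀) ∂P)
        - ((∫ ω, (mle n (sample n ω) - θ₀) ∂P) + matVec (M.K n θ₀)⁻¹ (M.a prior θ₀))))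
        atTop (𝓝 0) := by
    intro hint
    refine (hUI.tendsto_integral hscaled).congr' ?_
    filter_upwards [hint, hmmlInt hint] with n h1 h2
    have e : (fun ω => mml n (sample n ω) - mle n (sample n ω)
        - matVec (M.K n θ₀)⁻¹ (M.a prior θ₀))
        = fun ω => (mml n (sample n ω) - θ₀)
          - ((mle n (sample n ω) - θ₀) + matVec (M.K n θ₀)⁻¹ (M.a prior θ₀)) := by
      ext1 ω; abel
    have i1 : Integrable (fun ω => mle n (sample n ω) - θ₀) P := h1.sub (integrable_const _)
    have i2 : Integrable (fun ω => mml n (sample n ω) - θ₀) P := h2.sub (integrable_const _)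
    rw [integral_smul, e, integral_sub i2 (i1.fun_add (integrable_const _)),
      integral_add i1 (integrable_const _)]
    simp
  refine ⟨hreg.K_eq, hexp, ?_, fun hint => ⟨hmmlInt hint,
    isLittleO_one_div_of_tendsto (hmmlBias hint)⟩, fun hUImle => ?_⟩
  · refine hexp.congr' (.of_ae ?_)
    filter_upwards [hpos] with n hn
    refine .of_forall fun ω => ?_
    rw [hreg.inv_K hK hn, smul_matVec, one_div]
  · have hscore := hreg.integral_gradient_logLik hiid
    -- The linear term has mean zero, so subtracting it leaves the bias of the MLE unchanged.
    have hKscore : ∀ n, Integrable (fun ω => matVec (M.K n θ₀)⁻¹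
        (gradient (M.logLik n (sample n ω)) θ₀)) P ∧
        ∫ ω, matVec (M.K n θ₀)⁻¹ (gradient (M.logLik n (sample n ω)) θ₀) ∂P = 0 := fun n => by
      rw [hsample]
      refine ⟨integrable_matVec _ (hscore n).1, ?_⟩
      rw [integral_matVec _ (hscore n).1, (hscore n).2]
      simpa using matVec_smul (M.K n θ₀)⁻¹ 0 0
    have hint : ∀ᶠ n in atTop, Integrable (fun ω => mle n (sample n ω)) P := by
      filter_upwards [hUImle.integrable, hpos] with n h2 hn
      have hn' : (n : ℝ) ≠ 0 := by positivity
      refine (((integrable_const θ₀).add (hKscore n).1).add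
        (h2.smul (n : ℝ)⁻¹)).congr (.of_forall fun ω => ?_)
      simp only [Pi.add_apply, Pi.smul_apply]
      rw [smul_smul, inv_mul_cancel₀ hn', one_smul]
      abel
    have hquad : IsLittleOp P (fun n ω => (n : ℝ) • (mle n (sample n ω) - θ₀
        - matVec (M.K n θ₀)⁻¹ (gradient (M.logLik n (sample n ω)) θ₀))
        - matVec (M.fisher θ₀)⁻¹ (M.quadTerm θ₀ X n ω)) (fun _ => 1) := by
      subst hsample
      refine (hreg.isLittleOp_mle_sub_quadTerm hiid hdet hmle hroot).congr' (.of_ae ?_)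
      filter_upwards [hpos] with n hn
      refine .of_forall fun ω => ?_
      rw [smul_sub, hreg.smul_matVec_inv_K hK hn]
    have hmleBias : Tendsto (fun n : ℕ => (n : ℝ) • ((∫ ω, (mle n (sample n ω) - θ₀) ∂P)
        - M.coxSnellBias n θ₀)) atTop (𝓝 0) := by
      -- Vitali's theorem is applied to the scaled error minus the quadratic term: only this
      -- difference tends to zero in probability, and it is uniformly integrable because both parts
      -- are.
      refine ((hUImle.sub ((hreg.eventuallyUI_quadTerm hiid).matVec _)).tendsto_integral
        hquad).congr' ?_
      filter_upwards [hint, hUImle.integrable, hpos] with n h1 h2 hn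
      have i1 : Integrable (fun ω => mle n (sample n ω) - θ₀) P := h1.sub (integrable_const _)
      obtain ⟨q1, q2⟩ := hreg.integral_matVec_quadTerm hiid hdet hn
      rw [integral_sub h2 q1, q2, integral_smul, integral_sub i1 (hKscore n).1, (hKscore n).2,
        sub_zero, smul_sub, hreg.smul_coxSnellBias hK hn]
    refine ⟨hint, hmmlInt hint, isLittleO_one_div_of_tendsto hmleBias,
      isLittleO_one_div_of_tendsto ?_⟩
    have hsum := (hmmlBias hint).add hmleBias
    rw [add_zero] at hsum
    refine hsum.congr fun n => ?_
    rw [← smul_add]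
    congr 1
    abel
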